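/- Let $Q$ be a finite or countable set, $Z$ a $Q$-valued random variable on a probability space $(\Omega_0,\mathcal F,P)$, $f:Q\times Q\to\{0,1\}$ a function, and $\lambda,r\in(0,\infty)$. The vertex-based random connection model with these parameters is the following random graph. Its vertex set $V$ is a homogeneous Poisson point process of density $\lambda$ in $\mathbb R^2$ together with an additional point at the origin. Each $u\in V$ carries a mark $Z_u$; the marks are independent copies of $Z$ and are independent of the positions of the points. Two distinct points $u,v\in V$ are joined by an (undirected) edge if and only if their Euclidean distance is at most $r$ and $f(Z_u,Z_v)=1$ or $f(Z_v,Z_u)=1$ (for symmetric $f$, the usual case, these two conditions coincide). Assume: (non-triviality) for two independent copies $Z_1,Z_2$ of $Z$, $0<\mathbb P(f(Z_1,Z_2)=1)<1$; (finite reachability) with $S=\{q\in Q: P(Z=q)>0\}$, for all $x,y\in S$ there are a finite $k$ and a sequence $w_0=x,w_1,\dots,w_k=y$ with $w_i\in S$ for $0<i<k$ and $f(w_i,w_{i+1})=1$ for $0\le i<k$. Then, almost surely, the graph has at most one infinite connected component. -/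

import Mathlib

open MeasureTheory ProbabilityTheory
open scoped ENNReal

namespace VertexRCM

/-- The Euclidean plane `ℝ²`. -/
abbrev Plane : Type := EuclideanSpace ℝ (Fin 2)

/-- The number of points of the sequence `x` that lie in `A`. -/
noncomputable def pointCount (x : ℕ → Plane) (A : Set Plane) : ℕ∞ :=
  {n : ℕ | x n ∈ A}.encard

/-- The random points `X 0, X 1, …` enumerate a homogeneous Poisson point process of density
`lam` in the plane: the number of points in a Borel set `A` of finite area is Poisson
distributed with mean `lam * area A`, and the numbers of points in finitely many pairwise
disjoint such sets are independent. (For `lam > 0` the process almost surely has infinitely many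
points, so enumerating it by `ℕ` loses nothing.) -/
structure IsPoissonProcess {Ω : Type*} [MeasurableSpace Ω] (μ : Measure Ω) (lam : ℝ)
    (X : ℕ → Ω → Plane) : Prop where
  measurable : ∀ n, Measurable (X n)
  poisson : ∀ A : Set Plane, MeasurableSet A → volume A ≠ ∞ → ∀ k : ℕ,
    μ {ω | pointCount (fun n => X n ω) A = (k : ℕ∞)} =
      ENNReal.ofReal (Real.exp (-(lam * (volume A).toReal)) *
        (lam * (volume A).toReal) ^ k / (Nat.factorial k : ℝ))
  indep : ∀ (m : ℕ) (A : Fin m → Set Plane), (∀ i, MeasurableSet (A i)) →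
    (∀ i, volume (A i) ≠ ∞) → (∀ i j, i ≠ j → Disjoint (A i) (A j)) →
    iIndepFun (fun i ω => pointCount (fun n => X n ω) (A i)) μ

/-- The position of a vertex. The vertices are labelled by `Option ℕ`: `none` is the additional
vertex at the origin, and `some n` is the `n`-th point of the Poisson process. -/
def position (x : ℕ → Plane) : Option ℕ → Plane
  | none => 0
  | some n => x n

/-- The random data of the vertex-based random connection model with density `lam`, in which
the vertex `u` carries the mark `ζ u`: the points other than the origin form a Poisson process
of density `lam`, the marks are independent copies of `Z`, and they are independent of the
points. -/
structure IsModel {Ω Ω₀ Q : Type*} [MeasurableSpace Ω] [MeasurableSpace Ω₀] [MeasurableSpace Q]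
    (μ : Measure Ω) (lam : ℝ) (P : Measure Ω₀) (Z : Ω₀ → Q)
    (X : ℕ → Ω → Plane) (ζ : Option ℕ → Ω → Q) : Prop where
  poisson : IsPoissonProcess μ lam X
  measurable_mark : ∀ u, Measurable (ζ u)
  identDistrib : ∀ u, IdentDistrib (ζ u) Z μ P
  indep_marks : iIndepFun ζ μ
  indep_points_marks : IndepFun (fun ω (n : ℕ) => X n ω) (fun ω (u : Option ℕ) => ζ u ω) μ

/-- The graph built from positions `x` and marks `z`: two distinct vertices `u`, `v` are joined
iff their distance is at most `r` and `f (z u) (z v) = 1`, read as a condition on the unordered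
pair `{u, v}` (for symmetric `f` the two disjuncts coincide). -/
def graph {V Q : Type*} (r : ℝ) (f : Q → Q → Fin 2) (x : V → Plane) (z : V → Q) :
    SimpleGraph V where
  Adj u v := u ≠ v ∧ dist (x u) (x v) ≤ r ∧ (f (z u) (z v) = 1 ∨ f (z v) (z u) = 1)
  symm := ⟨fun u v h => ⟨h.1.symm, by rw [dist_comm]; exact h.2.1, h.2.2.symm⟩⟩
  loopless := ⟨fun _ h => h.1 rfl⟩

/-- Non-triviality: for two independent copies `Z₁`, `Z₂` of `Z` (the two coordinates on the
product space), `0 < P (f(Z₁, Z₂) = 1) < 1`. -/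
def NonTrivial {Ω₀ Q : Type*} [MeasurableSpace Ω₀] (P : Measure Ω₀) (Z : Ω₀ → Q)
    (f : Q → Q → Fin 2) : Prop :=
  0 < (P.prod P) {p : Ω₀ × Ω₀ | f (Z p.1) (Z p.2) = 1} ∧
    (P.prod P) {p : Ω₀ × Ω₀ | f (Z p.1) (Z p.2) = 1} < 1

/-- The support of the discrete random variable `Z`: the values taken with positive
probability. -/
def discreteSupport {Ω₀ Q : Type*} [MeasurableSpace Ω₀] (P : Measure Ω₀) (Z : Ω₀ → Q) : Set Q :=
  {q | 0 < P {ω | Z ω = q}}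

/-- Finite reachability: any two `x`, `y` in the support of `Z` are joined by a finite sequence
`x = w 0, w 1, …, w k = y` with `f (w i) (w (i + 1)) = 1` for `i < k`, whose intermediate terms
lie in the support. -/
def FiniteReachability {Ω₀ Q : Type*} [MeasurableSpace Ω₀] (P : Measure Ω₀) (Z : Ω₀ → Q)
    (f : Q → Q → Fin 2) : Prop :=
  ∀ x ∈ discreteSupport P Z, ∀ y ∈ discreteSupport P Z,
    ∃ (k : ℕ) (w : ℕ → Q), w 0 = x ∧ w k = y ∧
      (∀ i, 0 < i → i < k → w i ∈ discreteSupport P Z) ∧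
      ∀ i, i < k → f (w i) (w (i + 1)) = 1

end VertexRCM

/-! The argument is that of Burton and Keane, carried out on a lattice of cells. The plane is cut
into square cells of mesh `h` with `4 * h ≤ r`. Recording for each cell the marks found in all its
dyadic subcells turns the marked Poisson process into an i.i.d. field indexed by `ℤ²`
(`IsMarkedPoisson.map_cellState`), from which positions and marks can be read off again
(`exists_label`). The graph becomes a translation-covariant function of this field with edges of
bounded range, and what happens outside a box of cells is independent of what happens inside.

The modification made inside a box is to prescribe the set of marks present in each cell. Finite
reachability, together with one edge supplied by non-triviality, puts any finite set of possible
marks inside a finite set `A` that is connected under `f` (`exists_linked`). With positive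
probability every cell of the box shows exactly the marks in `A`; then all points of the box are
connected to each other, and every outside point close enough to the box with a mark in `A` is
joined to one of them.

Three infinite components: if they occurred with positive probability, then three infinite
components of the graph outside some box would come close to that box with positive probability.
Here the mesh is taken so fine that deleting the box deletes exactly the points of a given square
(`exists_mem_meet`). Filling the box turns it into a trifurcation. By translation invariance the
expected number of trifurcation boxes in a large square would grow like its area. But their number
is at most the number of points in a surrounding annulus of fixed width
(`card_le_of_trifurcations`), whose expectation grows like the perimeter
(`CellGraph.measure_trif_eq_zero`).

Two infinite components: their existence is translation invariant, so it has probability zero or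
one. If it has positive probability, two infinite outside components come close to some box with
positive probability. The outside graph almost surely has no third infinite component, because the
box could as well have been empty. Filling the box merges the two, so with positive probability at
most one infinite component is left, which excludes probability one
(`CellField.measure_manyInf_two`).

The origin is added last: a vertex of finite degree cannot create an infinite component
(`eq_of_not_manyInf_two`). -/

namespace VertexRCM

/-! ### Infinite components under deletion of vertices. -/

section Graph

variable {V : Type*}

/-- The graph `G` with only the edges both of whose ends lie in `A`. -/
def keep (G : SimpleGraph V) (A : Set V) : SimpleGraph V where
  Adj u v := G.Adj u v ∧ u ∈ A ∧ v ∈ A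
  symm := ⟨fun _ _ h => ⟨h.1.symm, h.2.2, h.2.1⟩⟩
  loopless := ⟨fun _ h => h.1.ne rfl⟩

/-- The vertices in the connected component of `v`. -/
def cluster (G : SimpleGraph V) (v : V) : Set V := {u | G.Reachable v u}

/-- The graph has at least `k` infinite connected components. -/
def ManyInf (G : SimpleGraph V) (k : ℕ) : Prop :=
  ∃ c : Fin k → V, (∀ i, (cluster G (c i)).Infinite) ∧ ∀ i j, i ≠ j → ¬ G.Reachable (c i) (c j)

lemma keep_le (G : SimpleGraph V) (A : Set V) : keep G A ≤ G := fun _ _ h => h.1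

lemma keep_mono (G : SimpleGraph V) {A B : Set V} (h : A ⊆ B) : keep G A ≤ keep G B :=
  fun _ _ hu => ⟨hu.1, h hu.2.1, h hu.2.2⟩

lemma mem_of_keep_reachable {G : SimpleGraph V} {A : Set V} {u v : V}
    (h : (keep G A).Reachable u v) (huv : u ≠ v) : u ∈ A ∧ v ∈ A := by
  obtain ⟨p⟩ := h
  induction p with
  | nil => exact absurd rfl huv
  | @cons a b c hab p ih =>
    refine ⟨hab.2.1, ?_⟩
    by_cases hbc : b = c
    · exact hbc ▸ hab.2.2
    · exact (ih hbc).2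

lemma mem_of_cluster_infinite {G : SimpleGraph V} {A : Set V} {v : V}
    (h : (cluster (keep G A) v).Infinite) : v ∈ A := by
  by_contra hv
  refine h ((Set.finite_singleton v).subset fun u hu => ?_)
  by_contra huv
  exact hv (mem_of_keep_reachable hu (Ne.symm huv)).1

/-- Removing finitely many vertices of finite degree from an infinite component leaves an
infinite component, either that of a given vertex or one next to the removed set. -/
lemma exists_infinite_cluster_keep {G : SimpleGraph V} {T : Set V} (hT : T.Finite)
    (hdeg : ∀ t ∈ T, {u | G.Adj t u}.Finite) {v : V} (hv : (cluster G v).Infinite) :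
    ∃ u, G.Reachable v u ∧ (cluster (keep G Tᶜ) u).Infinite ∧ (u = v ∨ ∃ t ∈ T, G.Adj u t) := by
  by_contra hcon
  push Not at hcon
  have hfin0 : (cluster (keep G Tᶜ) v).Finite := by
    by_contra h
    exact (hcon v (SimpleGraph.Reachable.refl v) h).1 rfl
  have hN : (⋃ t ∈ T, {u | G.Adj t u}).Finite := hT.biUnion hdeg
  -- The component of `v` is covered by `T`, the remaining cluster of `v`, and the remaining
  -- clusters of the finitely many neighbours of `T`. If none of these clusters were infinite, the
  -- component would be finite.
  have hfin1 : (⋃ u ∈ {u | u ∈ (⋃ t ∈ T, {u | G.Adj t u}) ∧ G.Reachable v u},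
      cluster (keep G Tᶜ) u).Finite := by
    refine (hN.subset fun u hu => hu.1).biUnion fun u hu => ?_
    by_contra h
    obtain ⟨hu1, hu2⟩ := hu
    simp only [Set.mem_iUnion, Set.mem_ofPred_eq, exists_prop] at hu1
    obtain ⟨t, ht, htu⟩ := hu1
    exact (hcon u hu2 h).2 t ht htu.symm
  refine hv (((hT.union hfin0).union hfin1).subset ?_)
  intro x hx
  -- The alternative is decided by the last vertex of `T` on the walk: what follows it starts at a
  -- neighbour of `T` and avoids `T`.
  have key : ∀ a b (p : G.Walk a b), G.Reachable v a → b ∉ T →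
      (keep G Tᶜ).Reachable a b ∨ ∃ u, (∃ t ∈ T, G.Adj t u) ∧ G.Reachable v u ∧
        (keep G Tᶜ).Reachable u b := by
    intro a b p
    induction p with
    | nil => exact fun _ _ => Or.inl (SimpleGraph.Reachable.refl _)
    | @cons a b c hab p ih =>
      intro hva hc
      have hvb := hva.trans hab.reachable
      rcases ih hvb hc with h | h
      · by_cases ha : a ∈ T
        · exact Or.inr ⟨b, ⟨a, ha, hab⟩, hvb, h⟩
        · by_cases hb : b ∈ T
          · by_cases hbc : b = c
            · exact absurd (hbc ▸ hb) hc
            · exact absurd hb (mem_of_keep_reachable h hbc).1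
          · left
            have : (keep G Tᶜ).Adj a b := ⟨hab, ha, hb⟩
            exact this.reachable.trans h
      · exact Or.inr h
  by_cases hxT : x ∈ T
  · exact Or.inl (Or.inl hxT)
  · obtain ⟨p⟩ : G.Reachable v x := hx
    rcases key v x p (SimpleGraph.Reachable.refl v) hxT with h | ⟨u, ⟨t, ht, htu⟩, hvu, h⟩
    · exact Or.inl (Or.inr h)
    · right
      simp only [Set.mem_iUnion, Set.mem_ofPred_eq, exists_prop]
      exact ⟨u, ⟨⟨t, ht, htu⟩, hvu⟩, h⟩

/-! ### The combinatorial bound on the number of trifurcations. -/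

section BurtonKeane

variable {G : SimpleGraph V} {Y : Finset V} {ι : Type*} {T : ι → Set V} {t : ι → V}

/-- A walk to `T j` started where `T i` cannot be reached without crossing `T j` meets `T j` before
`T i`. Stopped on entering `T j` and continued inside the connected set `T j`, it avoids `T i`
altogether. -/
lemma reachable_keep_compl_of_not_reachable
    (hdisj : ∀ i j, i ≠ j → Disjoint (T i) (T j))
    (hconn : ∀ i, ∀ a ∈ T i, (keep G (T i)).Reachable (t i) a) {i j : ι} (hij : i ≠ j) {v w : V}
    (p : G.Walk v w) (hw : w ∈ T j)
    (hv : v ∉ T j → ∀ x ∈ T i, ¬ (keep G (T j)ᶜ).Reachable v x) :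
    (keep G (T i)ᶜ).Reachable v (t j) := by
  have hle : keep G (T j) ≤ keep G (T i)ᶜ := keep_mono G ((hdisj i j hij).symm.subset_compl_right)
  induction p with
  | nil => exact ((hconn j _ hw).mono hle).symm
  | @cons a b c hab p ih =>
    by_cases ha : a ∈ T j
    · exact ((hconn j _ ha).mono hle).symm
    · have hva := hv ha
      have haT : a ∉ T i := fun h => hva a h (SimpleGraph.Reachable.refl a)
      have hb : b ∉ T j → ∀ x ∈ T i, ¬ (keep G (T j)ᶜ).Reachable b x := fun hb x hx hbx => by
        have hab' : (keep G (T j)ᶜ).Adj a b := ⟨hab, ha, hb⟩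
        exact hva x hx (hab'.reachable.trans hbx)
      have hbT : b ∉ T i := by
        intro h
        by_cases hbj : b ∈ T j
        · exact Set.disjoint_left.1 (hdisj i j hij) h hbj
        · exact hb hbj b h (SimpleGraph.Reachable.refl b)
      have hab' : (keep G (T i)ᶜ).Adj a b := ⟨hab, haT, hbT⟩
      exact hab'.reachable.trans (ih hw hb)

/-- A mean-zero function supported on two classes of a relation and constant on classes. -/
lemma exists_balanced (H : SimpleGraph V) (Y : Finset V) {a b : V} (ha : a ∈ Y) (hb : b ∈ Y)
    (hab : ¬ H.Reachable a b) :
    ∃ φ : V → ℝ, ∑ y ∈ Y, φ y = 0 ∧ (∀ y, φ y ≠ 0 → H.Reachable y a ∨ H.Reachable y b) ∧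
      (∀ y z, H.Reachable y z → φ y = φ z) ∧ φ a ≠ 0 := by
  classical
  have hcard : ∀ c ∈ Y, (∑ y ∈ Y, if H.Reachable y c then (1 : ℝ) else 0) ≠ 0 := by
    intro c hc
    refine ne_of_gt (Finset.sum_pos' (fun y _ => by split_ifs <;> norm_num) ⟨c, hc, ?_⟩)
    simp
  refine ⟨fun y => (if H.Reachable y a then (1 : ℝ) else 0) /
      (∑ y ∈ Y, if H.Reachable y a then (1 : ℝ) else 0) -
      (if H.Reachable y b then (1 : ℝ) else 0) /
      (∑ y ∈ Y, if H.Reachable y b then (1 : ℝ) else 0), ?_, ?_, ?_, ?_⟩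
  · rw [Finset.sum_sub_distrib, ← Finset.sum_div, ← Finset.sum_div, div_self (hcard a ha),
      div_self (hcard b hb), sub_self]
  · intro y hy
    by_contra hcon
    push Not at hcon
    simp [hcon.1, hcon.2] at hy
  · intro y z hyz
    have h : ∀ c, H.Reachable y c ↔ H.Reachable z c := fun c =>
      ⟨fun h => hyz.symm.trans h, fun h => hyz.trans h⟩
    simp only [h]
  · simp only [SimpleGraph.Reachable.refl, if_true, hab, if_false, zero_div, sub_zero]
    exact div_ne_zero one_ne_zero (hcard a ha)

/-- The combinatorial lemma of Burton and Keane: disjoint connected sets, each of which separates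
three points of `Y` in its component, are at most as many as the points of `Y`. -/
theorem card_le_of_trifurcations [Fintype ι]
    (hdisj : ∀ i j, i ≠ j → Disjoint (T i) (T j))
    (ht : ∀ i, t i ∈ T i)
    (hconn : ∀ i, ∀ a ∈ T i, (keep G (T i)).Reachable (t i) a)
    (c : ι → Fin 3 → V) (hcY : ∀ i k, c i k ∈ Y)
    (hc : ∀ i k l, k ≠ l → ¬ (keep G (T i)ᶜ).Reachable (c i k) (c i l))
    (hct : ∀ i k, G.Reachable (c i k) (t i)) :
    Fintype.card ι ≤ Y.card := by
  classical
  -- A root in `Y` is fixed for each component of `G` containing some `t i`, so that the branches at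
  -- each `T i` split into the one towards the root and the others.
  obtain ⟨root, hrootY, hroott, hrooteq⟩ : ∃ root : ι → V, (∀ i, root i ∈ Y) ∧
      (∀ i, G.Reachable (root i) (t i)) ∧
      ∀ i j, G.Reachable (t i) (t j) → root i = root j := by
    let f : G.ConnectedComponent → V := fun κ =>
      if h : ∃ y ∈ Y, G.connectedComponentMk y = κ then h.choose else κ.out
    have hf : ∀ i, f (G.connectedComponentMk (t i)) ∈ Y ∧
        G.connectedComponentMk (f (G.connectedComponentMk (t i))) =
          G.connectedComponentMk (t i) := by
      intro i
      have h : ∃ y ∈ Y, G.connectedComponentMk y = G.connectedComponentMk (t i) :=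
        ⟨c i 0, hcY i 0, SimpleGraph.ConnectedComponent.sound (hct i 0)⟩
      simp only [f, dif_pos h]
      exact h.choose_spec
    refine ⟨fun i => f (G.connectedComponentMk (t i)), fun i => (hf i).1, fun i =>
      SimpleGraph.ConnectedComponent.exact (hf i).2, fun i j hij => ?_⟩
    simp only [SimpleGraph.ConnectedComponent.sound hij]
  -- At most one of the three branches at `T i` contains the root. The other two carry a mean-zero
  -- function `φ i` on `Y`, constant on the classes of the graph off `T i`; these functions will
  -- turn out to be orthogonal.
  have htwo : ∀ i, ∃ a ∈ Y, ∃ b ∈ Y, ¬ (keep G (T i)ᶜ).Reachable a b ∧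
      ¬ (keep G (T i)ᶜ).Reachable a (root i) ∧ ¬ (keep G (T i)ᶜ).Reachable b (root i) ∧
      G.Reachable a (t i) ∧ G.Reachable b (t i) := by
    intro i
    have hk : ∃ k l : Fin 3, k ≠ l ∧ ¬ (keep G (T i)ᶜ).Reachable (c i k) (root i) ∧
        ¬ (keep G (T i)ᶜ).Reachable (c i l) (root i) := by
      have hu : ∀ k l, k ≠ l → (keep G (T i)ᶜ).Reachable (c i k) (root i) →
          ¬ (keep G (T i)ᶜ).Reachable (c i l) (root i) := fun k l hkl h1 h2 =>
        hc i k l hkl (h1.trans h2.symm)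
      by_cases h0 : (keep G (T i)ᶜ).Reachable (c i 0) (root i)
      · exact ⟨1, 2, by decide, hu 0 1 (by decide) h0, hu 0 2 (by decide) h0⟩
      · by_cases h1 : (keep G (T i)ᶜ).Reachable (c i 1) (root i)
        · exact ⟨0, 2, by decide, h0, hu 1 2 (by decide) h1⟩
        · exact ⟨0, 1, by decide, h0, h1⟩
    obtain ⟨k, l, hkl, h1, h2⟩ := hk
    exact ⟨c i k, hcY i k, c i l, hcY i l, hc i k l hkl, h1, h2, hct i k, hct i l⟩
  choose a haY b hbY hab har hbr hat hbt using htwo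
  choose φ hsum hsupp hconst hne using fun i =>
    exists_balanced (keep G (T i)ᶜ) Y (haY i) (hbY i) (hab i)
  -- If `T i` lies on the root side of `T j`, the support of `φ j` sits in branches at `T j` away
  -- from the root. These reach `t j` without meeting `T i`, so `φ i` is constant on that support,
  -- and the product sums to a multiple of the zero sum of `φ j`.
  have hone : ∀ i j, i ≠ j → G.Reachable (t i) (t j) →
      (keep G (T j)ᶜ).Reachable (t i) (root j) → ∑ y ∈ Y, φ i y * φ j y = 0 := by
    intro i j hij hreach hir
    have hcls : ∀ y ∈ Y, φ j y ≠ 0 → (keep G (T i)ᶜ).Reachable y (t j) := by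
      intro y hy hyne
      have hyr : ¬ (keep G (T j)ᶜ).Reachable y (root j) := fun h =>
        (hsupp j y hyne).elim (fun h' => har j (h'.symm.trans h))
          (fun h' => hbr j (h'.symm.trans h))
      have hyt : G.Reachable y (t j) := (hsupp j y hyne).elim
        (fun h' => (h'.mono (keep_le _ _)).trans (hat j))
        (fun h' => (h'.mono (keep_le _ _)).trans (hbt j))
      obtain ⟨p⟩ := hyt
      refine reachable_keep_compl_of_not_reachable hdisj hconn hij p (ht j) fun _ x hx hyx => ?_
      have : (keep G (T j)ᶜ).Reachable (t i) x := (hconn i x hx).mono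
        (keep_mono G (hdisj i j hij).subset_compl_right)
      exact hyr (hyx.trans (this.symm.trans hir))
    by_cases hall : ∀ y ∈ Y, φ j y = 0
    · exact Finset.sum_eq_zero fun y hy => by rw [hall y hy, mul_zero]
    · push Not at hall
      obtain ⟨y₀, hy₀, hy₀ne⟩ := hall
      have : ∀ y ∈ Y, φ i y * φ j y = φ i y₀ * φ j y := by
        intro y hy
        by_cases hyne : φ j y = 0
        · rw [hyne, mul_zero, mul_zero]
        · rw [hconst i y y₀ ((hcls y hy hyne).trans (hcls y₀ hy₀ hy₀ne).symm)]
      rw [Finset.sum_congr rfl this, ← Finset.mul_sum, hsum, mul_zero]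
  -- Within one component, either `t i` is on the root side of `T j`, or the root reaches `t j`
  -- avoiding `T i`, so that the roles of `i` and `j` are exchanged. In different components the
  -- supports are disjoint.
  have horth : ∀ i j, i ≠ j → ∑ y ∈ Y, φ i y * φ j y = 0 := by
    intro i j hij
    by_cases hreach : G.Reachable (t i) (t j)
    · by_cases hir : (keep G (T j)ᶜ).Reachable (t i) (root j)
      · exact hone i j hij hreach hir
      · have hjr : (keep G (T i)ᶜ).Reachable (root j) (t j) := by
          obtain ⟨p⟩ := hroott j
          refine reachable_keep_compl_of_not_reachable hdisj hconn hij p (ht j) fun _ x hx h => ?_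
          have : (keep G (T j)ᶜ).Reachable (t i) x := (hconn i x hx).mono
            (keep_mono G (hdisj i j hij).subset_compl_right)
          exact hir (this.trans h.symm)
        rw [← hrooteq i j hreach] at hjr
        have := hone j i hij.symm hreach.symm hjr.symm
        simpa only [mul_comm] using this
    · refine Finset.sum_eq_zero fun y _ => ?_
      by_contra hcon
      have h1 := hsupp i y (left_ne_zero_of_mul hcon)
      have h2 := hsupp j y (right_ne_zero_of_mul hcon)
      have h1' : G.Reachable y (t i) := h1.elim
        (fun h' => (h'.mono (keep_le _ _)).trans (hat i))
        (fun h' => (h'.mono (keep_le _ _)).trans (hbt i))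
      have h2' : G.Reachable y (t j) := h2.elim
        (fun h' => (h'.mono (keep_le _ _)).trans (hat j))
        (fun h' => (h'.mono (keep_le _ _)).trans (hbt j))
      exact hreach (h1'.symm.trans h2')
  -- Nonzero orthogonal vectors are independent, so there are at most `Y.card` of them.
  let ψ : ι → EuclideanSpace ℝ Y := fun i => WithLp.toLp 2 fun y => φ i y
  have hψ : LinearIndependent ℝ ψ := by
    refine linearIndependent_of_ne_zero_of_inner_eq_zero (fun i h => ?_) fun i j hij => ?_
    · have := congrArg (fun x : EuclideanSpace ℝ Y => x ⟨a i, haY i⟩) h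
      exact hne i this
    · have := horth j i hij.symm
      rw [← Finset.sum_coe_sort] at this
      simpa [ψ, PiLp.inner_apply] using this
  have := hψ.fintype_card_le_finrank
  simpa using this

end BurtonKeane

end Graph

/-! ### Measurability of connectivity events. -/

section RandomGraph

variable {W V : Type*} [MeasurableSpace W] [Countable V] {H : W → SimpleGraph V}

lemma measurableSet_reachable (hH : ∀ u v, MeasurableSet {w | (H w).Adj u v}) (u v : V) :
    MeasurableSet {w | (H w).Reachable u v} := by
  have hn : ∀ (n : ℕ) (u : V), MeasurableSet {w | ∃ p : (H w).Walk u v, p.length = n} := by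
    intro n
    induction n with
    | zero =>
      intro u
      have : {w | ∃ p : (H w).Walk u v, p.length = 0} = {_w | u = v} := by
        ext w
        constructor
        · rintro ⟨p, hp⟩
          exact SimpleGraph.Walk.eq_of_length_eq_zero hp
        · rintro (rfl : u = v)
          exact ⟨SimpleGraph.Walk.nil, rfl⟩
      rw [this]
      exact MeasurableSet.const _
    | succ n ih =>
      intro u
      have : {w | ∃ p : (H w).Walk u v, p.length = n + 1} =
          ⋃ x, {w | (H w).Adj u x} ∩ {w | ∃ p : (H w).Walk x v, p.length = n} := by
        ext w
        simp only [Set.mem_ofPred_eq, Set.mem_iUnion, Set.mem_inter_iff]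
        constructor
        · rintro ⟨p, hp⟩
          cases p with
          | nil => simp at hp
          | @cons _ x _ h q => exact ⟨x, h, q, by simpa using hp⟩
        · rintro ⟨x, h, q, hq⟩
          exact ⟨SimpleGraph.Walk.cons h q, by simp [hq]⟩
      rw [this]
      exact MeasurableSet.iUnion fun x => (hH u x).inter (ih x)
  have : {w | (H w).Reachable u v} = ⋃ n, {w | ∃ p : (H w).Walk u v, p.length = n} := by
    ext w
    simp only [Set.mem_ofPred_eq, Set.mem_iUnion]
    exact ⟨fun ⟨p⟩ => ⟨p.length, p, rfl⟩, fun ⟨_, p, _⟩ => ⟨p⟩⟩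
  rw [this]
  exact MeasurableSet.iUnion fun n => hn n u

/-- A set is infinite when it leaves every finite set; over countably many vertices this is a
countable intersection of countable unions of reachability events. -/
lemma measurableSet_cluster_infinite (hH : ∀ u v, MeasurableSet {w | (H w).Adj u v}) (v : V) :
    MeasurableSet {w | (cluster (H w) v).Infinite} := by
  have : {w | (cluster (H w) v).Infinite} =
      ⋂ s : Finset V, ⋃ u : {u // u ∉ s}, {w | (H w).Reachable v u} := by
    ext w
    simp only [Set.mem_ofPred_eq, Set.mem_iInter, Set.mem_iUnion]
    constructor
    · intro h s
      obtain ⟨u, hu, hus⟩ := h.exists_notMem_finset s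
      exact ⟨⟨u, hus⟩, hu⟩
    · intro h hfin
      obtain ⟨⟨u, hus⟩, hu⟩ := h hfin.toFinset
      exact hus (hfin.mem_toFinset.2 hu)
  rw [this]
  exact MeasurableSet.iInter fun s => MeasurableSet.iUnion fun u => measurableSet_reachable hH v u

lemma measurableSet_manyInf (hH : ∀ u v, MeasurableSet {w | (H w).Adj u v}) (k : ℕ) :
    MeasurableSet {w | ManyInf (H w) k} := by
  simp only [ManyInf, Set.ofPred_exists, Set.ofPred_and, Set.ofPred_forall]
  refine MeasurableSet.iUnion fun c => MeasurableSet.inter ?_ ?_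
  · exact MeasurableSet.iInter fun i => measurableSet_cluster_infinite hH _
  · exact MeasurableSet.iInter fun i => MeasurableSet.iInter fun j =>
      MeasurableSet.iInter fun _ => (measurableSet_reachable hH _ _).compl

end RandomGraph

/-! ### Independent fields: disjoint coordinates, translations and the zero-one law. -/

section Product

variable {I S : Type*} [MeasurableSpace S] (ν₀ : Measure S) [IsProbabilityMeasure ν₀]

/-- The set `A` of fields depends only on the coordinates in `D`. -/
def DependsOnly (A : Set (I → S)) (D : Set I) : Prop :=
  ∀ w w' : I → S, (∀ z ∈ D, w z = w' z) → (w ∈ A ↔ w' ∈ A)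

/-- Events depending on disjoint sets of coordinates are independent under a product measure. -/
lemma measure_inter_of_dependsOnly {A B : Set (I → S)} {D E : Set I} (hA : MeasurableSet A)
    (hB : MeasurableSet B) (hAD : DependsOnly A D) (hBE : DependsOnly B E) (hDE : Disjoint D E) :
    Measure.infinitePi (fun _ : I => ν₀) (A ∩ B) =
      Measure.infinitePi (fun _ : I => ν₀) A * Measure.infinitePi (fun _ : I => ν₀) B := by
  classical
  have hne : Nonempty S := nonempty_of_isProbabilityMeasure ν₀
  let s₀ : S := hne.some
  have hind : iIndep (fun i : I => MeasurableSpace.comap (fun w : I → S => w i) inferInstance)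
      (Measure.infinitePi (fun _ : I => ν₀)) :=
    iIndepFun.iIndep
      (iIndepFun_infinitePi (P := fun _ : I => ν₀) (X := fun _ ω => ω) fun _ => measurable_id)
  have hmeas : ∀ (A : Set (I → S)) (D : Set I), MeasurableSet A → DependsOnly A D →
      MeasurableSet[⨆ i ∈ D, MeasurableSpace.comap (fun w : I → S => w i) inferInstance] A := by
    intro A D hA hAD
    -- Freezing the coordinates outside `D` does not change membership in `A`. As the frozen field
    -- is measurable with respect to the coordinates in `D`, so is `A`.
    let f : (I → S) → (I → S) := fun w i => if i ∈ D then w i else s₀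
    have hf : Measurable[⨆ i ∈ D, MeasurableSpace.comap (fun w : I → S => w i) inferInstance] f := by
      refine @measurable_pi_lambda _ _ _ (_) _ _ fun i => ?_
      by_cases hi : i ∈ D
      · simp only [f, hi, if_true]
        exact (comap_measurable (fun w : I → S => w i)).mono
          (le_iSup₂_of_le (f := fun i (_ : i ∈ D) =>
            MeasurableSpace.comap (fun w : I → S => w i) inferInstance) i hi le_rfl) le_rfl
      · simp only [f, hi, if_false]
        exact @measurable_const _ _ _ (_) _
    have hpre : A = f ⁻¹' A := by
      ext w
      exact hAD w (f w) fun z hz => by simp [f, hz]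
    rw [hpre]
    exact hf hA
  have := indep_iSup_of_disjoint (fun i => (measurable_pi_apply i).comap_le) hind hDE
  exact Indep_iff _ _ _ |>.1 this A B (hmeas A D hA hAD) (hmeas B E hB hBE)

section Shift

variable [AddCommGroup I]

/-- Translation of a field. -/
def shift (a : I) (w : I → S) : I → S := fun z => w (z + a)

lemma measurable_shift (a : I) : Measurable (shift (S := S) a) :=
  measurable_pi_lambda _ fun z => measurable_pi_apply (z + a)

lemma map_shift (a : I) : (Measure.infinitePi (fun _ : I => ν₀)).map (shift a) =
    Measure.infinitePi (fun _ : I => ν₀) :=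
  Measure.map_infinitePi_infinitePi_of_inj (P := fun _ : I => ν₀) (add_left_injective a)

lemma measure_preimage_shift (a : I) {A : Set (I → S)} (hA : MeasurableSet A) :
    Measure.infinitePi (fun _ : I => ν₀) (shift a ⁻¹' A) =
      Measure.infinitePi (fun _ : I => ν₀) A := by
  rw [← Measure.map_apply (measurable_shift a) hA, map_shift]

lemma exists_disjoint_translate [Infinite I] (s : Finset I) :
    ∃ a : I, ∀ z ∈ s, z + a ∉ s := by
  classical
  obtain ⟨a, ha⟩ := Infinite.exists_notMem_finset (Finset.image₂ (fun x y => x - y) s s)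
  refine ⟨a, fun z hz hza => ha (Finset.mem_image₂.2 ⟨z + a, hza, z, hz, by abel⟩)⟩

open scoped symmDiff in
/-- The zero-one law for translation-invariant events of an independent field. -/
theorem measure_eq_zero_or_one_of_shift_invariant [Infinite I] {E : Set (I → S)}
    (hE : MeasurableSet E) (hinv : ∀ a : I, shift a ⁻¹' E = E) :
    Measure.infinitePi (fun _ : I => ν₀) E = 0 ∨ Measure.infinitePi (fun _ : I => ν₀) E = 1 := by
  set ν := Measure.infinitePi (fun _ : I => ν₀) with hν
  -- A cylinder `A` within `ε` of `E` is translated off its own coordinates. The translate is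
  -- independent of `A` and, by invariance of `E`, also within `ε` of `E`. Hence `E` is within `2 *
  -- ε` of an event of probability `ν.real A ^ 2`, which differs from `ν.real E ^ 2` by at most `2 *
  -- ε`.
  have key : ∀ ε : ℝ, 0 < ε → |ν.real E - ν.real E ^ 2| ≤ 4 * ε := by
    intro ε hε
    obtain ⟨A, hA, hAE⟩ := exists_measure_symmDiff_lt_of_generateFrom_isSetRing (μ := ν)
      (isSetRing_measurableCylinders (α := fun _ : I => S))
      ⟨{Set.univ}, Set.countable_singleton _, by
        simpa using univ_mem_measurableCylinders (fun _ : I => S), by simp⟩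
      generateFrom_measurableCylinders.symm hE (ENNReal.ofReal_pos.2 hε)
    obtain ⟨s, B, hB, rfl⟩ := (mem_measurableCylinders A).1 hA
    have hAm : MeasurableSet (cylinder (α := fun _ : I => S) s B) := MeasurableSet.cylinder s hB
    set A := cylinder (α := fun _ : I => S) s B with hAdef
    obtain ⟨a, ha⟩ := exists_disjoint_translate s
    have hdep : DependsOnly A (s : Set I) := by
      intro w w' h
      have : (s.restrict w : s → S) = s.restrict w' := funext fun i => h i i.2
      simp only [hAdef, mem_cylinder, this]
    have hdep' : DependsOnly (shift a ⁻¹' A) ((fun z => z + a) '' (s : Set I)) := by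
      intro w w' h
      exact hdep _ _ fun z hz => h (z + a) ⟨z, hz, rfl⟩
    have hdisj : Disjoint (s : Set I) ((fun z => z + a) '' (s : Set I)) := by
      rw [Set.disjoint_left]
      rintro _ hx ⟨z, hz, rfl⟩
      exact ha z hz hx
    have hA'm := measurable_shift (S := S) a hAm
    have hmul : ν.real (A ∩ shift a ⁻¹' A) = ν.real A ^ 2 := by
      rw [measureReal_def, hν, measure_inter_of_dependsOnly ν₀ hAm hA'm hdep hdep' hdisj,
        measure_preimage_shift ν₀ a hAm, ENNReal.toReal_mul, sq, measureReal_def]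
    have h1 : ν.real (A ∆ E) ≤ ε := by
      rw [measureReal_def]
      exact ENNReal.toReal_le_of_le_ofReal hε.le hAE.le
    have h2 : ν.real ((shift a ⁻¹' A) ∆ E) ≤ ε := by
      rw [← hinv a, ← Set.preimage_symmDiff, measureReal_def,
        measure_preimage_shift ν₀ a (hAm.symmDiff hE), ← measureReal_def]
      exact h1
    have h3 : |ν.real A - ν.real E| ≤ ε :=
      (abs_measureReal_sub_le_measureReal_symmDiff hAm.nullMeasurableSet
        hE.nullMeasurableSet).trans h1
    have h4 : |ν.real (A ∩ shift a ⁻¹' A) - ν.real E| ≤ 2 * ε := by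
      refine (abs_measureReal_sub_le_measureReal_symmDiff (hAm.inter hA'm).nullMeasurableSet
        hE.nullMeasurableSet).trans ?_
      have hsub : (A ∩ shift a ⁻¹' A) ∆ E ⊆ A ∆ E ∪ (shift a ⁻¹' A) ∆ E := by
        intro x hx
        simp only [Set.mem_symmDiff, Set.mem_inter_iff, Set.mem_union] at hx ⊢
        tauto
      linarith [(measureReal_mono hsub (measure_ne_top ν _)).trans (measureReal_union_le _ _)]
    rw [hmul] at h4
    have hA1 : ν.real A ≤ 1 := measureReal_le_one
    have hE1 : ν.real E ≤ 1 := measureReal_le_one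
    have hA0 : 0 ≤ ν.real A := measureReal_nonneg
    have hE0 : 0 ≤ ν.real E := measureReal_nonneg
    have h5 : |ν.real A ^ 2 - ν.real E ^ 2| ≤ 2 * ε := by
      have : ν.real A ^ 2 - ν.real E ^ 2 =
          (ν.real A - ν.real E) * (ν.real A + ν.real E) := by ring
      rw [this, abs_mul, abs_of_nonneg (by linarith : 0 ≤ ν.real A + ν.real E)]
      nlinarith [abs_nonneg (ν.real A - ν.real E)]
    rw [abs_le] at h4 h5 ⊢
    constructor <;> linarith [h4.1, h4.2, h5.1, h5.2]
  have hzero : ν.real E - ν.real E ^ 2 = 0 := by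
    by_contra hne
    have := key (|ν.real E - ν.real E ^ 2| / 8) (by positivity)
    have hpos : 0 < |ν.real E - ν.real E ^ 2| := abs_pos.2 hne
    linarith
  have hfac : ν.real E * (1 - ν.real E) = 0 := by linarith
  rcases mul_eq_zero.1 hfac with h | h
  · left
    exact (measureReal_eq_zero_iff).1 h
  · right
    have h1 : ν.real E = 1 := by linarith
    rw [measureReal_def] at h1
    rw [← ENNReal.ofReal_toReal (measure_ne_top ν E), h1, ENNReal.ofReal_one]

end Shift

end Product

/-! ### Transport of components along a bijection of vertices. -/

section Transport

variable {V V' : Type*}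

lemma reachable_comap_equiv (G : SimpleGraph V') (e : V ≃ V') (u v : V) :
    (G.comap e).Reachable u v ↔ G.Reachable (e u) (e v) :=
  (SimpleGraph.Iso.comap e G).reachable_iff.symm

lemma cluster_comap_equiv (G : SimpleGraph V') (e : V ≃ V') (v : V) :
    cluster (G.comap e) v = e ⁻¹' cluster G (e v) :=
  Set.ext fun u => reachable_comap_equiv G e v u

lemma cluster_comap_equiv_infinite (G : SimpleGraph V') (e : V ≃ V') (v : V) :
    (cluster (G.comap e) v).Infinite ↔ (cluster G (e v)).Infinite := by
  rw [cluster_comap_equiv, ← Set.infinite_image_iff (f := e) e.injective.injOn,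
    Set.image_preimage_eq _ e.surjective]

lemma keep_comap (G : SimpleGraph V') (e : V → V') (A : Set V') :
    keep (G.comap e) (e ⁻¹' A) = (keep G A).comap e := rfl

lemma manyInf_comap_equiv (G : SimpleGraph V') (e : V ≃ V') (k : ℕ) :
    ManyInf (G.comap e) k ↔ ManyInf G k := by
  constructor
  · rintro ⟨c, h1, h2⟩
    exact ⟨fun i => e (c i), fun i => (cluster_comap_equiv_infinite G e _).1 (h1 i),
      fun i j hij h => h2 i j hij ((reachable_comap_equiv G e _ _).2 h)⟩
  · rintro ⟨c, h1, h2⟩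
    refine ⟨fun i => e.symm (c i), fun i => ?_, fun i j hij h => h2 i j hij ?_⟩
    · rw [cluster_comap_equiv_infinite, e.apply_symm_apply]
      exact h1 i
    · simpa using (reachable_comap_equiv G e _ _).1 h

end Transport

/-! ### Finite-range graphs over the lattice of cells, and the density of trifurcation boxes. -/

/-- Cells of a square lattice. -/
abbrev Cell : Type := Fin 2 → ℤ

/-- The square box `[a, b)²` of cells. -/
noncomputable def box (a b : ℤ) : Finset Cell := Fintype.piFinset fun _ => Finset.Ico a b

lemma mem_box {a b : ℤ} {z : Cell} : z ∈ box a b ↔ ∀ i, a ≤ z i ∧ z i < b := by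
  simp [box]

lemma card_box (a b : ℤ) : (box a b).card = (b - a).toNat ^ 2 := by
  simp [box]

/-- A random graph of finite range on the vertices `(z, l)`, built from a field of cell states in
a translation-covariant way. -/
structure CellGraph (S Λ : Type*) [MeasurableSpace S] where
  valid : S → Λ → Prop
  gr : (Cell → S) → SimpleGraph (Cell × Λ)
  range : ℤ
  measurableSet_valid : ∀ l, MeasurableSet {s | valid s l}
  measurableSet_adj : ∀ u v, MeasurableSet {w | (gr w).Adj u v}
  adj_local : ∀ w w' u v, w u.1 = w' u.1 → w v.1 = w' v.1 → ((gr w).Adj u v ↔ (gr w').Adj u v)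
  adj_shift : ∀ a w u v, (gr (shift a w)).Adj u v ↔ (gr w).Adj (u.1 + a, u.2) (v.1 + a, v.2)
  valid_of_adj : ∀ w u v, (gr w).Adj u v → valid (w u.1) u.2
  adj_range : ∀ w u v, (gr w).Adj u v → ∀ i, |u.1 i - v.1 i| ≤ range

namespace CellGraph

variable {S Λ : Type*} [MeasurableSpace S] (H : CellGraph S Λ)

/-- The vertices present in the cells of `K`. -/
def occ (w : Cell → S) (K : Finset Cell) : Set (Cell × Λ) := {v | v.1 ∈ K ∧ H.valid (w v.1) v.2}

/-- All potential vertices outside the cells of `K`. -/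
def off (Λ : Type*) (K : Finset Cell) : Set (Cell × Λ) := {v | v.1 ∉ K}

/-- Edges only join valid vertices, so removing the occupied vertices of `K` or all potential ones
gives the same graph. The second form does not refer to the states in `K`, which is what
independence needs. -/
lemma keep_occ_compl (w : Cell → S) (K : Finset Cell) :
    keep (H.gr w) (H.occ w K)ᶜ = keep (H.gr w) (off Λ K) := by
  ext u v
  constructor
  · rintro ⟨h, hu, hv⟩
    exact ⟨h, fun hK => hu ⟨hK, H.valid_of_adj w u v h⟩,
      fun hK => hv ⟨hK, H.valid_of_adj w v u h.symm⟩⟩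
  · rintro ⟨h, hu, hv⟩
    exact ⟨h, fun hK => hu hK.1, fun hK => hv hK.1⟩

/-- The points in the cells of `K` form a connected set, next to three distinct infinite
components of the rest of the graph. -/
def Trif (w : Cell → S) (K : Finset Cell) : Prop :=
  (∀ a ∈ H.occ w K, ∀ b ∈ H.occ w K, (keep (H.gr w) (H.occ w K)).Reachable a b) ∧
  ∃ c : Fin 3 → Cell × Λ, (∀ i, (cluster (keep (H.gr w) (off Λ K)) (c i)).Infinite) ∧
    (∀ i j, i ≠ j → ¬ (keep (H.gr w) (off Λ K)).Reachable (c i) (c j)) ∧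
    ∀ i, ∃ t ∈ H.occ w K, (H.gr w).Adj (c i) t

/-- Translation of vertices. -/
def translate (Λ : Type*) (a : Cell) : Cell × Λ ≃ Cell × Λ where
  toFun v := (v.1 + a, v.2)
  invFun v := (v.1 - a, v.2)
  left_inv v := by simp
  right_inv v := by simp

lemma gr_shift (a : Cell) (w : Cell → S) :
    H.gr (shift a w) = (H.gr w).comap (translate Λ a) := by
  ext u v
  exact H.adj_shift a w u v

lemma manyInf_shift (a : Cell) (w : Cell → S) (k : ℕ) :
    ManyInf (H.gr (shift a w)) k ↔ ManyInf (H.gr w) k := by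
  rw [gr_shift, manyInf_comap_equiv]

lemma trif_of_shift (a : Cell) (w : Cell → S) {K K' : Finset Cell}
    (hK : ∀ z, z + a ∈ K' ↔ z ∈ K) (h : H.Trif (shift a w) K) : H.Trif w K' := by
  have hocc : H.occ (shift a w) K = translate Λ a ⁻¹' H.occ w K' := by
    ext v
    exact and_congr (hK v.1).symm Iff.rfl
  have hoff : off Λ K = translate Λ a ⁻¹' off Λ K' := by
    ext v
    exact not_congr (hK v.1).symm
  have hsurj := (translate Λ a).surjective
  simp only [Trif, gr_shift, hocc, hoff, keep_comap] at h
  obtain ⟨h1, c, h2, h3, h4⟩ := h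
  refine ⟨?_, fun i => translate Λ a (c i), fun i => (cluster_comap_equiv_infinite _ _ _).1 (h2 i),
    fun i j hij hr => h3 i j hij ((reachable_comap_equiv _ _ _ _).2 hr), fun i => ?_⟩
  · intro x hx y hy
    obtain ⟨x, rfl⟩ := hsurj x
    obtain ⟨y, rfl⟩ := hsurj y
    exact (reachable_comap_equiv _ _ _ _).1 (h1 x hx y hy)
  · obtain ⟨t, ht, hadj⟩ := h4 i
    exact ⟨translate Λ a t, ht, hadj⟩

/-- The first vertex outside the box on the walk is within `H.range` of its predecessor inside,
hence in the annulus, and it is valid as an end of an edge. -/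
lemma exists_mem_annulus {w : Cell → S} {G : SimpleGraph (Cell × Λ)} (hG : G ≤ H.gr w)
    {a b : ℤ} {u v : Cell × Λ} (p : G.Walk u v) (hu : u.1 ∈ box a b) (hv : v.1 ∉ box a b) :
    ∃ y, G.Reachable u y ∧ y ∈ H.occ w (box (a - H.range) (b + H.range) \ box a b) := by
  induction p with
  | nil => exact absurd hu hv
  | @cons x y z hxy p ih =>
    by_cases hy : y.1 ∈ box a b
    · obtain ⟨y', h1, h2⟩ := ih hy hv
      exact ⟨y', hxy.reachable.trans h1, h2⟩
    · refine ⟨y, hxy.reachable, Finset.mem_sdiff.2 ⟨?_, hy⟩, H.valid_of_adj w y x (hG hxy).symm⟩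
      rw [mem_box] at hu ⊢
      intro i
      have := abs_le.1 (H.adj_range w x y (hG hxy) i)
      have := hu i
      constructor <;> linarith

lemma occ_finite {w : Cell → S} (hfin : ∀ z, {l | H.valid (w z) l}.Finite) (K : Finset Cell) :
    (H.occ w K).Finite := by
  refine ((K.finite_toSet).biUnion fun z _ => (hfin z).image fun l => (z, l)).subset ?_
  rintro ⟨z, l⟩ ⟨hz, hl⟩
  exact Set.mem_biUnion (Finset.mem_coe.2 hz) ⟨l, hl, rfl⟩

lemma finite_adj {w : Cell → S} (hfin : ∀ z, {l | H.valid (w z) l}.Finite) (t : Cell × Λ) :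
    {u | (H.gr w).Adj t u}.Finite := by
  refine (H.occ_finite hfin (Fintype.piFinset fun i =>
    Finset.Icc (t.1 i - H.range) (t.1 i + H.range))).subset fun u hu => ⟨?_, ?_⟩
  · rw [Fintype.mem_piFinset]
    intro i
    have := abs_le.1 (H.adj_range w t u hu i)
    rw [Finset.mem_Icc]
    constructor <;> linarith
  · exact H.valid_of_adj w u t (SimpleGraph.Adj.symm hu)

/-- In a locally finite configuration, the trifurcation boxes inside a large box are at most as
many as the points in the surrounding annulus. -/
lemma card_trif_le {w : Cell → S} (hfin : ∀ z, {l | H.valid (w z) l}.Finite)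
    {ι : Type*} [Fintype ι] (K : ι → Finset Cell) (hdisj : ∀ i j, i ≠ j → Disjoint (K i) (K j))
    {a b : ℤ} (hK : ∀ i, K i ⊆ box a b) (hT : ∀ i, H.Trif w (K i)) (Y : Finset (Cell × Λ))
    (hY : H.occ w (box (a - H.range) (b + H.range) \ box a b) ⊆ Y) :
    Fintype.card ι ≤ Y.card := by
  choose hconn c hinf hsep htouch using hT
  choose t ht hadj using htouch
  have hex : ∀ i k, ∃ y ∈ Y, (keep (H.gr w) (off Λ (K i))).Reachable (c i k) y := by
    intro i k
    -- A branch starting inside the large box must leave it, since the box has finitely many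
    -- occupied vertices, and it crosses the annulus. A branch starting outside is adjacent to a
    -- point of `K i`, so its first vertex already lies in the annulus.
    by_cases hc : (c i k).1 ∈ box a b
    · obtain ⟨v, hv, hvb⟩ : ∃ v ∈ cluster (keep (H.gr w) (off Λ (K i))) (c i k),
          v.1 ∉ box a b := by
        by_contra hcon
        push Not at hcon
        refine hinf i k (((Set.finite_singleton (c i k)).union (H.occ_finite hfin (box a b))).subset ?_)
        intro v hv
        by_cases hvc : v = c i k
        · exact Or.inl hvc
        · right
          refine ⟨hcon v hv, ?_⟩
          obtain ⟨p⟩ : (keep (H.gr w) (off Λ (K i))).Reachable v (c i k) :=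
            SimpleGraph.Reachable.symm hv
          cases p with
          | nil => exact absurd rfl hvc
          | cons h p => exact H.valid_of_adj w _ _ h.1
      obtain ⟨p⟩ : (keep (H.gr w) (off Λ (K i))).Reachable (c i k) v := hv
      obtain ⟨y, hy1, hy2⟩ := H.exists_mem_annulus (keep_le _ _) p hc hvb
      exact ⟨y, hY hy2, hy1⟩
    · refine ⟨c i k, hY ⟨Finset.mem_sdiff.2 ⟨?_, hc⟩, H.valid_of_adj w _ _ (hadj i k)⟩,
        SimpleGraph.Reachable.refl _⟩
      have h1 := mem_box.1 (hK i (ht i k).1)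
      rw [mem_box]
      intro j
      have := abs_le.1 (H.adj_range w _ _ (hadj i k) j)
      have := h1 j
      constructor <;> linarith
  choose y hyY hyc using hex
  refine card_le_of_trifurcations (G := H.gr w) (T := fun i => H.occ w (K i))
    (t := fun i => t i 0) (fun i j hij => ?_) (fun i => ht i 0)
    (fun i x hx => hconn i _ (ht i 0) x hx) y hyY (fun i k l hkl h => ?_) (fun i k => ?_)
  · rw [Set.disjoint_left]
    intro v hv hv'
    exact Finset.disjoint_left.1 (hdisj i j hij) hv.1 hv'.1
  · rw [keep_occ_compl] at h
    exact hsep i k l hkl ((hyc i k).trans (h.trans (hyc i l).symm))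
  · refine ((hyc i k).mono (keep_le _ _)).symm.trans ((hadj i k).reachable.trans ?_)
    exact (hconn i _ (ht i k) _ (ht i 0)).mono (keep_le _ _)

lemma le_zero_of_quadratic_le_linear {p a b : ℝ} (hb : 0 ≤ b)
    (h : ∀ L : ℕ, (L : ℝ) ^ 2 * p ≤ a * L + b) : p ≤ 0 := by
  by_contra hp
  push Not at hp
  obtain ⟨L, hL⟩ := exists_nat_gt ((a + b) / p)
  have hL' : a + b < (L + 1 : ℕ) * p := by
    rw [div_lt_iff₀ hp] at hL
    push_cast
    nlinarith
  have h1 := h (L + 1)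
  have h2 : (1 : ℝ) ≤ (L + 1 : ℕ) := by push_cast; linarith [Nat.cast_nonneg (α := ℝ) L]
  nlinarith

variable (ν₀ : Measure S) [IsProbabilityMeasure ν₀]

lemma ae_finite_valid [Countable Λ] (hfin : ∑' l, ν₀ {s | H.valid s l} ≠ ∞) :
    ∀ᵐ w ∂Measure.infinitePi (fun _ : Cell => ν₀), ∀ z, {l | H.valid (w z) l}.Finite := by
  rw [ae_all_iff]
  intro z
  have h0 : ∀ᵐ s ∂ν₀, {l | H.valid s l}.Finite := ae_finite_setOfPred_mem hfin
  exact (measurePreserving_eval_infinitePi (fun _ : Cell => ν₀) z).quasiMeasurePreserving.ae h0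

/-- Trifurcation boxes have probability zero. -/
theorem measure_trif_eq_zero [Countable Λ] (hfin : ∑' l, ν₀ {s | H.valid s l} ≠ ∞) (N : ℕ)
    {A : Set (Cell → S)} (hA : MeasurableSet A) (hT : ∀ w ∈ A, H.Trif w (box (-N) N)) :
    Measure.infinitePi (fun _ : Cell => ν₀) A = 0 := by
  classical
  set ν := Measure.infinitePi (fun _ : Cell => ν₀) with hν
  set m := ∑' l, ν₀ {s | H.valid s l} with hm
  obtain ⟨ρ, hρ⟩ : ∃ ρ : ℕ, H.range ≤ ρ := ⟨H.range.toNat, Int.self_le_toNat _⟩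
  -- Area against perimeter: `L ^ 2` disjoint translates of the box are compared with the mean
  -- number of points in an annulus whose size is linear in `L`.
  have hmain : ∀ L : ℕ, (L : ℝ≥0∞) ^ 2 * ν A ≤ ((4 * ρ * (2 * N * L + N) + 4 * ρ ^ 2 : ℕ) : ℝ≥0∞) * m := by
    intro L
    -- The box has side `2 * N`, so translates by multiples of `2 * N` are disjoint.
    let vec : (Fin 2 → Fin L) → Cell := fun x i => 2 * N * (x i : ℕ)
    let K : (Fin 2 → Fin L) → Finset Cell := fun x =>
      Fintype.piFinset fun i => Finset.Ico (-N + vec x i) (N + vec x i)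
    have hKmem : ∀ x z, z ∈ K x ↔ ∀ i, -(N : ℤ) + vec x i ≤ z i ∧ z i < N + vec x i := by
      intro x z
      simp [K]
    set B := box (-N) (2 * N * L) with hB
    set Ann := box (-N - H.range) (2 * N * L + H.range) \ B with hAnn
    have hKB : ∀ x, K x ⊆ B := by
      intro x z hz
      rw [hKmem] at hz
      rw [hB, mem_box]
      intro i
      have h1 := hz i
      have h2 : ((x i : ℕ) : ℤ) + 1 ≤ L := by exact_mod_cast (x i).2
      have h3 : (0 : ℤ) ≤ (x i : ℕ) := by positivity
      have h4 : (0 : ℤ) ≤ N := by positivity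
      simp only [vec] at h1
      constructor <;> nlinarith
    have hKdisj : ∀ x y, x ≠ y → Disjoint (K x) (K y) := by
      have hlt : ∀ (x y : Fin 2 → Fin L) i, x i < y i → ∀ z, z ∈ K x → z ∉ K y := by
        intro x y i hi z hx hy
        rw [hKmem] at hx hy
        have h1 := hx i
        have h2 := hy i
        simp only [vec] at h1 h2
        have h3 : ((x i : ℕ) : ℤ) + 1 ≤ (y i : ℕ) := by exact_mod_cast hi
        have h4 : (0 : ℤ) ≤ N := by positivity
        nlinarith
      intro x y hxy
      obtain ⟨i, hi⟩ := Function.ne_iff.1 hxy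
      rw [Finset.disjoint_left]
      intro z hx hy
      rcases lt_or_gt_of_ne hi with h | h
      · exact hlt x y i h z hx hy
      · exact hlt y x i h z hy hx
    have hshift : ∀ x w, shift (vec x) w ∈ A → H.Trif w (K x) := by
      intro x w hw
      refine H.trif_of_shift (vec x) w (fun z => ?_) (hT _ hw)
      rw [hKmem, mem_box]
      refine forall_congr' fun i => ?_
      simp only [Pi.add_apply]
      constructor <;> rintro ⟨h1, h2⟩ <;> constructor <;> linarith
    -- The deterministic bound, written with indicators so that it can be integrated. The right side
    -- counts the valid labels in the annulus.
    have hpt : ∀ᵐ w ∂ν, ∑ x : Fin 2 → Fin L, (shift (vec x) ⁻¹' A).indicator (1 : (Cell → S) → ℝ≥0∞) w ≤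
        ∑ z ∈ Ann, ∑' l, {w : Cell → S | H.valid (w z) l}.indicator (1 : (Cell → S) → ℝ≥0∞) w := by
      filter_upwards [H.ae_finite_valid ν₀ hfin] with w hw
      let Y : Finset (Cell × Λ) := Ann.biUnion fun z => (hw z).toFinset.image fun l => (z, l)
      have hYocc : H.occ w Ann ⊆ Y := by
        rintro ⟨z, l⟩ ⟨hz, hl⟩
        simp only [Y, Finset.coe_biUnion, Set.mem_iUnion]
        refine ⟨z, hz, ?_⟩
        rw [Finset.mem_coe]
        exact Finset.mem_image_of_mem _ ((hw z).mem_toFinset.2 hl)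
      have hcard := H.card_trif_le hw (ι := {x : Fin 2 → Fin L // shift (vec x) w ∈ A})
        (fun x => K x) (fun x y hxy => hKdisj x y fun h => hxy (Subtype.ext h))
        (fun x => hKB x) (fun x => hshift x w x.2) Y hYocc
      calc ∑ x : Fin 2 → Fin L, (shift (vec x) ⁻¹' A).indicator (1 : (Cell → S) → ℝ≥0∞) w
          = (Fintype.card {x : Fin 2 → Fin L // shift (vec x) w ∈ A} : ℝ≥0∞) := by
            rw [Fintype.card_subtype, Finset.card_eq_sum_ones, Finset.sum_filter]
            push_cast
            refine Finset.sum_congr rfl fun x _ => ?_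
            simp [Set.indicator_apply]
        _ ≤ (Y.card : ℝ≥0∞) := by exact_mod_cast hcard
        _ ≤ ∑ z ∈ Ann, ((hw z).toFinset.card : ℝ≥0∞) := by
            exact_mod_cast Finset.card_biUnion_le.trans
              (Finset.sum_le_sum fun z _ => Finset.card_image_le)
        _ ≤ _ := by
            refine Finset.sum_le_sum fun z _ => ?_
            refine le_trans (le_of_eq ?_) (ENNReal.sum_le_tsum (hw z).toFinset)
            rw [Finset.card_eq_sum_ones]
            push_cast
            refine Finset.sum_congr rfl fun l hl => ?_
            have : H.valid (w z) l := (hw z).mem_toFinset.1 hl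
            simp [this]
    have hvm : ∀ z l, MeasurableSet {w : Cell → S | H.valid (w z) l} := fun z l =>
      (measurable_pi_apply z : Measurable fun w : Cell → S => w z) (H.measurableSet_valid l)
    have hint := lintegral_mono_ae hpt
    rw [lintegral_finsetSum _ fun x _ =>
        measurable_one.indicator (measurable_shift (vec x) hA),
      lintegral_finsetSum _ fun z _ => Measurable.tsum fun l =>
        measurable_one.indicator (hvm z l)] at hint
    have hl : ∀ x : Fin 2 → Fin L, ∫⁻ w, (shift (vec x) ⁻¹' A).indicator (1 : (Cell → S) → ℝ≥0∞) w ∂ν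
        = ν A := by
      intro x
      rw [lintegral_indicator_one (measurable_shift (vec x) hA), hν, measure_preimage_shift ν₀ _ hA]
    have hr : ∀ z : Cell, ∫⁻ w, ∑' l, {w : Cell → S | H.valid (w z) l}.indicator
        (1 : (Cell → S) → ℝ≥0∞) w ∂ν = m := by
      intro z
      rw [lintegral_tsum fun l => (measurable_one.indicator (hvm z l)).aemeasurable, hm]
      refine tsum_congr fun l => ?_
      rw [lintegral_indicator_one (hvm z l)]
      exact (measurePreserving_eval_infinitePi (fun _ : Cell => ν₀) z).measure_preimage
        (H.measurableSet_valid l).nullMeasurableSet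
    simp only [hl, hr, Finset.sum_const, nsmul_eq_mul] at hint
    have hc1 : ((Finset.univ : Finset (Fin 2 → Fin L)).card : ℝ≥0∞) = (L : ℝ≥0∞) ^ 2 := by simp
    rw [hc1] at hint
    refine hint.trans (mul_le_mul_left ?_ _)
    have hsub : Ann ⊆ box (-N - ρ) (2 * N * L + ρ) \ B := by
      refine Finset.sdiff_subset_sdiff ?_ le_rfl
      intro z hz
      rw [mem_box] at hz ⊢
      intro i
      have := hz i
      constructor <;> linarith
    have hBsub : B ⊆ box (-N - ρ) (2 * N * L + ρ) := by
      intro z hz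
      rw [hB, mem_box] at hz
      rw [mem_box]
      intro i
      have := hz i
      have h4 : (0 : ℤ) ≤ ρ := by positivity
      constructor <;> linarith
    -- With inner side `s = 2 * N * L + N` this is `(s + 2 * ρ) ^ 2 - s ^ 2 = 4 * ρ * s + 4 * ρ ^
    -- 2`.
    have hcardAnn : Ann.card ≤ 4 * ρ * (2 * N * L + N) + 4 * ρ ^ 2 := by
      refine (Finset.card_le_card hsub).trans ?_
      rw [Finset.card_sdiff_of_subset hBsub, hB, card_box, card_box]
      have e1 : ((2 * N * L + ρ : ℤ) - (-N - ρ)).toNat = 2 * N * L + N + 2 * ρ := by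
        have : (2 * N * L + ρ : ℤ) - (-N - ρ) = ((2 * N * L + N + 2 * ρ : ℕ) : ℤ) := by
          push_cast; ring
        rw [this, Int.toNat_natCast]
      have e2 : ((2 * N * L : ℤ) - (-N)).toNat = 2 * N * L + N := by
        have : (2 * N * L : ℤ) - (-N) = ((2 * N * L + N : ℕ) : ℤ) := by
          push_cast; ring
        rw [this, Int.toNat_natCast]
      rw [e1, e2]
      exact Nat.sub_le_iff_le_add.2 (le_of_eq (by ring))
    exact_mod_cast hcardAnn
  have hle : (ν A).toReal ≤ 0 := by
    refine le_zero_of_quadratic_le_linear (a := 8 * ρ * N * m.toReal)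
      (b := (4 * ρ * N + 4 * ρ ^ 2) * m.toReal) (by positivity) fun L => ?_
    have h1 := ENNReal.toReal_mono (ENNReal.mul_ne_top (ENNReal.natCast_ne_top _) hfin) (hmain L)
    rw [ENNReal.toReal_mul, ENNReal.toReal_mul, ENNReal.toReal_pow, ENNReal.toReal_natCast,
      ENNReal.toReal_natCast] at h1
    push_cast at h1
    linarith
  exact (ENNReal.toReal_eq_zero_iff _).1 (le_antisymm hle ENNReal.toReal_nonneg) |>.resolve_right
    (measure_ne_top _ _)

end CellGraph

/-! ### Distances between points in cells. -/

section Geometry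

lemma abs_sub_le_dist (x y : Plane) (i : Fin 2) : |x i - y i| ≤ dist x y := by
  rw [dist_eq_norm, ← Real.norm_eq_abs]
  exact PiLp.norm_apply_le (x - y) i

lemma dist_le_add (x y : Plane) : dist x y ≤ |x 0 - y 0| + |x 1 - y 1| := by
  rw [EuclideanSpace.dist_eq, Fin.sum_univ_two, Real.dist_eq, Real.dist_eq]
  refine Real.sqrt_le_iff.2 ⟨by positivity, ?_⟩
  nlinarith [abs_nonneg (x 0 - y 0), abs_nonneg (x 1 - y 1)]

/-- The point `x` lies in the cell `z` of the lattice of mesh `h`. -/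
def InCell (h : ℝ) (z : Cell) (x : Plane) : Prop := ∀ i, h * z i ≤ x i ∧ x i < h * (z i + 1)

/-- Points in neighbouring cells, diagonal ones included, differ by at most `2 * h` in each
coordinate, and the Euclidean distance is at most the sum of the two. This is the source of the
requirement `4 * h ≤ r`. -/
lemma InCell.dist_le {h : ℝ} {z z' : Cell} {x y : Plane} (hx : InCell h z x)
    (hy : InCell h z' y) (hz : ∀ i, |z i - z' i| ≤ 1) (hh : 0 < h) : dist x y ≤ 4 * h := by
  have key : ∀ i, |x i - y i| ≤ 2 * h := by
    intro i
    have h1 := hx i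
    have h2 := hy i
    have h3 := abs_le.1 (hz i)
    have h4 : (z i : ℝ) - z' i ≤ 1 := by exact_mod_cast h3.2
    have h5 : (-1 : ℝ) ≤ (z i : ℝ) - z' i := by exact_mod_cast h3.1
    rw [abs_le]
    constructor <;> nlinarith
  linarith [dist_le_add x y, key 0, key 1]

lemma InCell.dist_le_two {h : ℝ} {z : Cell} {x y : Plane} (hx : InCell h z x)
    (hy : InCell h z y) : dist x y ≤ 2 * h := by
  have key : ∀ i, |x i - y i| ≤ h := by
    intro i
    have h1 := hx i
    have h2 := hy i
    rw [abs_le]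
    constructor <;> linarith
  linarith [dist_le_add x y, key 0, key 1]

lemma InCell.abs_sub_le {h r : ℝ} (hh : 0 < h) {z z' : Cell} {x y : Plane} (hx : InCell h z x)
    (hy : InCell h z' y) (hxy : dist x y ≤ r) (i : Fin 2) : |z i - z' i| ≤ ⌈r / h⌉ + 1 := by
  have h1 := hx i
  have h2 := hy i
  have h3 := abs_le.1 ((abs_sub_le_dist x y i).trans hxy)
  have h4 : r ≤ h * ⌈r / h⌉ := by
    have := (div_le_iff₀ hh).1 (Int.le_ceil (r / h))
    linarith
  have e1 : h * ((z i : ℝ) - z' i) < h * (⌈r / h⌉ + 1) := by linarith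
  have e2 : h * ((z' i : ℝ) - z i) < h * (⌈r / h⌉ + 1) := by linarith
  have e1' := lt_of_mul_lt_mul_left e1 hh.le
  have e2' := lt_of_mul_lt_mul_left e2 hh.le
  have e3 : z i - z' i < ⌈r / h⌉ + 1 := by exact_mod_cast e1'
  have e4 : z' i - z i < ⌈r / h⌉ + 1 := by exact_mod_cast e2'
  rw [abs_le]
  constructor <;> linarith

/-- The cell containing a point. -/
noncomputable def cellOf (h : ℝ) (x : Plane) : Cell := fun i => ⌊x i / h⌋

lemma inCell_cellOf {h : ℝ} (hh : 0 < h) (x : Plane) : InCell h (cellOf h x) x := by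
  intro i
  have h1 := (le_div_iff₀ hh).1 (Int.floor_le (x i / h))
  have h2 := (div_lt_iff₀ hh).1 (Int.lt_floor_add_one (x i / h))
  constructor
  · simp only [cellOf]; linarith
  · simp only [cellOf]; linarith

lemma InCell.eq_cellOf {h : ℝ} (hh : 0 < h) {z : Cell} {x : Plane} (hx : InCell h z x) :
    z = cellOf h x := by
  funext i
  symm
  rw [cellOf, Int.floor_eq_iff, le_div_iff₀ hh, div_lt_iff₀ hh]
  have := hx i
  constructor <;> linarith

/-- The closed square `[-b, b]²`. -/
def square (b : ℝ) : Set Plane := {p | ∀ i, |p i| ≤ b}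

lemma isClosed_square (b : ℝ) : IsClosed (square b) := by
  simp only [square, Set.ofPred_forall]
  exact isClosed_iInter fun i => isClosed_le (by fun_prop) continuous_const

lemma zero_mem_square {b : ℝ} (hb : 0 ≤ b) : (0 : Plane) ∈ square b := fun i => by simpa using hb

/-- A point at distance at most `r` from the square is within distance `r` of a whole cell of a
slightly larger square. -/
lemma exists_cell_near {h r b : ℝ} {N : ℕ} (hh : 0 < h) (hr : 4 * h ≤ r) (hN : b + 3 * h ≤ h * N)
    {u p : Plane} (hp : p ∈ square b) (hup : dist u p ≤ r) :
    ∃ z ∈ box (-N) N, ∀ y, InCell h z y → dist u y ≤ r := by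
  -- Moving `p` by `2 * h` towards `u` leaves room for the diameter of a cell, bounded by `2 * h`.
  -- The cell of `p'` then works; `p'` is in the square of half-side `b + 2 * h`, and the third `h`
  -- in `hN` makes the bound strict, as the half-open box requires.
  obtain ⟨p', hp'1, hp'2⟩ : ∃ p', dist u p' ≤ r - 2 * h ∧ dist p' p ≤ 2 * h := by
    by_cases hd : dist u p ≤ r - 2 * h
    · exact ⟨p, hd, by simp [hh.le]⟩
    · push Not at hd
      have hd0 : 0 < dist u p := by linarith
      refine ⟨AffineMap.lineMap p u (2 * h / dist u p), ?_, ?_⟩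
      · rw [dist_comm, dist_lineMap_right, dist_comm p u, Real.norm_eq_abs, abs_of_nonneg]
        · rw [sub_mul, div_mul_cancel₀ _ hd0.ne']
          linarith
        · rw [sub_nonneg, div_le_one hd0]
          linarith
      · rw [dist_lineMap_left, dist_comm p u, Real.norm_eq_abs, abs_of_nonneg (by positivity),
          div_mul_cancel₀ _ hd0.ne']
  refine ⟨cellOf h p', ?_, fun y hy => ?_⟩
  · rw [mem_box]
    intro i
    have h1 := abs_le.1 (hp i)
    have h2 := abs_le.1 ((abs_sub_le_dist p' p i).trans hp'2)
    constructor
    · simp only [cellOf]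
      rw [Int.le_floor, le_div_iff₀ hh]
      push_cast
      linarith
    · simp only [cellOf]
      rw [Int.floor_lt, div_lt_iff₀ hh]
      push_cast
      linarith
  · have := (inCell_cellOf hh p').dist_le_two hy
    linarith [dist_triangle u p' y]

end Geometry

/-! ### Marked points in cells and the filling of a box. -/

/-- A family of marked points in the square `[0, h)²`, labelled by `Λ`, depending measurably on a
state `s`. -/
structure CellField (S Λ Q : Type*) [MeasurableSpace S] [MeasurableSpace Q] (h : ℝ) where
  valid : S → Λ → Prop
  pos : S → Λ → Plane
  mark : S → Λ → Q
  measurableSet_valid : ∀ l, MeasurableSet {s | valid s l}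
  measurable_pos : ∀ l, Measurable fun s => pos s l
  measurable_mark : ∀ l, Measurable fun s => mark s l
  pos_mem : ∀ s l, valid s l → ∀ i, 0 ≤ pos s l i ∧ pos s l i < h

/-- Marks that may be joined by an edge. -/
def Linkable {Q : Type*} (f : Q → Q → Fin 2) (a b : Q) : Prop := f a b = 1 ∨ f b a = 1

/-- A set of marks that is connected through marks of the set, each mark being linkable to some
mark of the set. -/
def Linked {Q : Type*} (f : Q → Q → Fin 2) (A : Set Q) : Prop :=
  (∀ a ∈ A, ∀ b ∈ A, Relation.ReflTransGen (fun x y => Linkable f x y ∧ y ∈ A) a b) ∧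
    ∀ a ∈ A, ∃ b ∈ A, Linkable f a b

namespace CellField

variable {S Λ Q : Type*} [MeasurableSpace S] [MeasurableSpace Q] {h : ℝ}
  (F : CellField S Λ Q h)

/-- The corner of a cell. -/
noncomputable def corner (h : ℝ) (z : Cell) : Plane := WithLp.toLp 2 fun i => h * z i

/-- The position of a vertex in the plane. -/
noncomputable def vpos (w : Cell → S) (v : Cell × Λ) : Plane := corner h v.1 + F.pos (w v.1) v.2

/-- The mark of a vertex. -/
def vmark (w : Cell → S) (v : Cell × Λ) : Q := F.mark (w v.1) v.2

/-- The random connection graph on the points present in a field of cell states. -/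
noncomputable def graph (r : ℝ) (f : Q → Q → Fin 2) (w : Cell → S) : SimpleGraph (Cell × Λ) :=
  keep (VertexRCM.graph r f (F.vpos w) (F.vmark w)) {v | F.valid (w v.1) v.2}

lemma inCell_vpos (w : Cell → S) (v : Cell × Λ) (hv : F.valid (w v.1) v.2) :
    InCell h v.1 (F.vpos w v) := by
  intro i
  have h1 := F.pos_mem _ _ hv i
  simp only [vpos, corner, PiLp.add_apply]
  constructor <;> linarith

lemma measurable_vpos (v : Cell × Λ) : Measurable fun w : Cell → S => F.vpos w v :=
  ((F.measurable_pos v.2).comp (measurable_pi_apply v.1)).const_add _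

lemma measurable_vmark (v : Cell × Λ) : Measurable fun w : Cell → S => F.vmark w v :=
  (F.measurable_mark v.2).comp (measurable_pi_apply v.1)

lemma measurableSet_vvalid (v : Cell × Λ) :
    MeasurableSet {w : Cell → S | F.valid (w v.1) v.2} :=
  (measurable_pi_apply v.1 : Measurable fun w : Cell → S => w v.1) (F.measurableSet_valid v.2)

variable [Countable Q] [DiscreteMeasurableSpace Q]

/-- The random connection graph as a translation-covariant random graph of finite range. -/
noncomputable def cellGraph (hh : 0 < h) (r : ℝ) (f : Q → Q → Fin 2) : CellGraph S Λ where
  valid := F.valid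
  gr := F.graph r f
  range := ⌈r / h⌉ + 1
  measurableSet_valid := F.measurableSet_valid
  measurableSet_adj u v := by
    have h1 : MeasurableSet {w : Cell → S | dist (F.vpos w u) (F.vpos w v) ≤ r} :=
      measurableSet_le ((F.measurable_vpos u).dist (F.measurable_vpos v)) measurable_const
    have h2 : MeasurableSet {w : Cell → S | f (F.vmark w u) (F.vmark w v) = 1 ∨
        f (F.vmark w v) (F.vmark w u) = 1} :=
      ((F.measurable_vmark u).prodMk (F.measurable_vmark v))
        (MeasurableSet.of_discrete (s := {p : Q × Q | f p.1 p.2 = 1 ∨ f p.2 p.1 = 1}))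
    exact (((MeasurableSet.const _).inter (h1.inter h2)).inter
      ((F.measurableSet_vvalid u).inter (F.measurableSet_vvalid v)))
  adj_local w w' u v hu hv := by
    simp only [graph, keep, VertexRCM.graph, vpos, vmark, hu, hv, Set.mem_ofPred_eq]
  adj_shift a w u v := by
    have hd : dist (F.vpos (shift a w) u) (F.vpos (shift a w) v) =
        dist (F.vpos w (u.1 + a, u.2)) (F.vpos w (v.1 + a, v.2)) := by
      have hc : ∀ z : Cell, corner h (z + a) = corner h a + corner h z := by
        intro z
        ext i
        simp only [corner, PiLp.add_apply, Pi.add_apply]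
        push_cast
        ring
      simp only [vpos, shift, hc, add_assoc, dist_add_left]
    have hne : u ≠ v ↔ (u.1 + a, u.2) ≠ (v.1 + a, v.2) := by
      rw [Ne, Ne, Prod.ext_iff, Prod.mk.injEq, add_left_inj]
    simp only [graph, keep, VertexRCM.graph, hd, hne, Set.mem_ofPred_eq]
    rfl
  valid_of_adj w u v h := h.2.1
  adj_range w u v h' := (F.inCell_vpos w u h'.2.1).abs_sub_le hh
    (F.inCell_vpos w v h'.2.2) h'.1.2.1

/-- The marks present in a cell. -/
def markSet (s : S) : Set Q := {q | ∃ l, F.valid s l ∧ F.mark s l = q}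

lemma measurableSet_markSet_eq [Countable Λ] (A : Set Q) : MeasurableSet {s | F.markSet s = A} := by
  have : {s | F.markSet s = A} = ⋂ q, {s | (∃ l, F.valid s l ∧ F.mark s l = q) ↔ q ∈ A} := by
    ext s
    simp only [Set.mem_ofPred_eq, Set.mem_iInter, markSet, Set.ext_iff]
  rw [this]
  refine MeasurableSet.iInter fun q => ?_
  have hq : MeasurableSet {s | ∃ l, F.valid s l ∧ F.mark s l = q} := by
    rw [Set.ofPred_exists]
    exact MeasurableSet.iUnion fun l => (F.measurableSet_valid l).inter
      (F.measurable_mark l (measurableSet_singleton q))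
  by_cases hA : q ∈ A
  · simpa only [hA, iff_true] using hq
  · simp only [hA, iff_false]
    exact hq.compl

section Glue

variable {F} {hh : 0 < h} {r : ℝ} {f : Q → Q → Fin 2} {w : Cell → S} {N : ℕ} {A : Set Q}

/-- Cells filled with exactly the marks of a linked set have all their points connected. -/
lemma reachable_of_filled (hr : 4 * h ≤ r) (hA : Linked f A)
    (hw : ∀ z ∈ box (-N) N, F.markSet (w z) = A) {a b : Cell × Λ}
    (ha : a ∈ (F.cellGraph hh r f).occ w (box (-N) N))
    (hb : b ∈ (F.cellGraph hh r f).occ w (box (-N) N)) :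
    (keep ((F.cellGraph hh r f).gr w)
      ((F.cellGraph hh r f).occ w (box (-N) N))).Reachable a b := by
  set T := (F.cellGraph hh r f).occ w (box (-N) N)
  set G := keep ((F.cellGraph hh r f).gr w) T
  have step : ∀ u ∈ T, ∀ v ∈ T, (∀ i, |u.1 i - v.1 i| ≤ 1) →
      Linkable f (F.vmark w u) (F.vmark w v) → G.Reachable u v := by
    intro u hu v hv huv hl
    by_cases hne : u = v
    · rw [hne]
    · have : G.Adj u v := ⟨⟨⟨hne, ((F.inCell_vpos w u hu.2).dist_le (F.inCell_vpos w v hv.2)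
        huv hh).trans hr, hl⟩, hu.2, hv.2⟩, hu, hv⟩
      exact this.reachable
  have hmem : ∀ u ∈ T, F.vmark w u ∈ A := fun u hu => by
    rw [← hw u.1 hu.1]
    exact ⟨u.2, hu.2, rfl⟩
  have hex : ∀ z ∈ box (-N) N, ∀ q ∈ A, ∃ v ∈ T, v.1 = z ∧ F.vmark w v = q := by
    intro z hz q hq
    rw [← hw z hz] at hq
    obtain ⟨l, hl, hq⟩ := hq
    exact ⟨(z, l), ⟨hz, hl⟩, rfl, hq⟩
  -- Equal marks need not be linkable. A detour is made through a point of the cell of `u` whose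
  -- mark is linkable to the common mark; the second clause of `Linked` provides it.
  have hsame : ∀ u ∈ T, ∀ v ∈ T, (∀ i, |u.1 i - v.1 i| ≤ 1) → F.vmark w u = F.vmark w v →
      G.Reachable u v := by
    intro u hu v hv huv hm
    obtain ⟨q, hq, hl⟩ := hA.2 _ (hmem u hu)
    obtain ⟨x, hx, hxu, hxq⟩ := hex u.1 hu.1 q hq
    refine (step u hu x hx (fun i => by simp [hxu]) (hxq ▸ hl)).trans
      (step x hx v hv (fun i => by rw [hxu]; exact huv i) ?_)
    rw [hxq, ← hm]
    exact hl.symm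
  have hmark : ∀ u ∈ T, ∀ q ∈ A, ∃ v ∈ T, v.1 = u.1 ∧ F.vmark w v = q ∧ G.Reachable u v := by
    intro u hu q hq
    have := hA.1 _ (hmem u hu) q hq
    clear hq
    induction this with
    | refl => exact ⟨u, hu, rfl, rfl, SimpleGraph.Reachable.refl u⟩
    | @tail b c _ hbc ih =>
      obtain ⟨v, hv, hvu, hvb, hr⟩ := ih
      obtain ⟨x, hx, hxu, hxc⟩ := hex u.1 hu.1 c hbc.2
      refine ⟨x, hx, hxu, hxc, hr.trans (step v hv x hx (fun i => by simp [hvu, hxu]) ?_)⟩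
      rw [hvb, hxc]
      exact hbc.1
  -- Every point is connected to a point with the same mark in the cell moved `k` steps towards the
  -- lower corner of the box, one neighbouring cell at a time.
  have hdown : ∀ (k : ℕ), ∀ u ∈ T, ∃ v ∈ T, (∀ i, v.1 i = max (u.1 i - k) (-N)) ∧
      F.vmark w v = F.vmark w u ∧ G.Reachable u v := by
    intro k
    induction k with
    | zero =>
      intro u hu
      refine ⟨u, hu, fun i => ?_, rfl, SimpleGraph.Reachable.refl u⟩
      have := (mem_box.1 hu.1 i).1
      simp [this]
    | succ k ih =>
      intro u hu
      obtain ⟨v, hv, hvu, hvm, hr⟩ := ih u hu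
      have hz : (fun i => max (u.1 i - (k + 1 : ℕ)) (-N) : Cell) ∈ box (-N) N := by
        rw [mem_box]
        intro i
        have := mem_box.1 hu.1 i
        push_cast
        omega
      obtain ⟨x, hx, hxz, hxq⟩ := hex _ hz _ (hmem u hu)
      refine ⟨x, hx, fun i => by rw [hxz], hxq, hr.trans (hsame v hv x hx (fun i => ?_)
        (hvm.trans hxq.symm))⟩
      rw [hvu, hxz]
      push_cast
      rw [abs_le]
      omega
  obtain ⟨b', hb', hb'1, hb'2, hb'3⟩ := hmark b hb _ (hmem a ha)
  -- Since coordinates lie in `[-N, N)`, after `2 * N` steps both points have arrived in the corner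
  -- cell.
  obtain ⟨a₂, ha₂, ha₂1, ha₂2, ha₂3⟩ := hdown (2 * N) a ha
  obtain ⟨b₂, hb₂, hb₂1, hb₂2, hb₂3⟩ := hdown (2 * N) b' hb'
  refine ha₂3.trans ((hsame a₂ ha₂ b₂ hb₂ (fun i => ?_) ?_).trans (hb'3.trans hb₂3).symm)
  · have h1 := mem_box.1 ha.1 i
    have h2 := mem_box.1 hb'.1 i
    rw [ha₂1, hb₂1, abs_le]
    push_cast
    omega
  · rw [ha₂2, hb₂2, hb'2]

/-- A point near a filled square, with a mark of the linked set, is joined to a point in it. -/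
lemma exists_adj_of_filled (hr : 4 * h ≤ r) {b : ℝ} (hb : 0 ≤ b) (hN : b + 3 * h ≤ h * N)
    (hA : Linked f A) (hw : ∀ z ∈ box (-N) N, F.markSet (w z) = A) {u : Cell × Λ}
    (hu : u.1 ∉ box (-N) N) (huv : F.valid (w u.1) u.2) (hum : F.vmark w u ∈ A)
    (hd : Metric.infDist (F.vpos w u) (square b) ≤ r) :
    ∃ t ∈ (F.cellGraph hh r f).occ w (box (-N) N), ((F.cellGraph hh r f).gr w).Adj u t := by
  obtain ⟨p, hp, hpd⟩ := (isClosed_square b).exists_infDist_eq_dist ⟨0, zero_mem_square hb⟩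
    (F.vpos w u)
  obtain ⟨z, hz, hzd⟩ := exists_cell_near hh hr hN hp (hpd ▸ hd)
  obtain ⟨q, hq, hl⟩ := hA.2 _ hum
  rw [← hw z hz] at hq
  obtain ⟨l, hlv, rfl⟩ := hq
  have hne : u ≠ (z, l) := by
    rintro rfl
    exact hu hz
  exact ⟨(z, l), ⟨hz, hlv⟩, ⟨hne, hzd _ (F.inCell_vpos w (z, l) hlv), hl⟩, huv, hlv⟩

end Glue

end CellField

lemma CellGraph.measurableSet_adj_keep {S Λ : Type*} [MeasurableSpace S] (H : CellGraph S Λ)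
    (B : Set (Cell × Λ)) (u v : Cell × Λ) : MeasurableSet {w | (keep (H.gr w) B).Adj u v} :=
  (H.measurableSet_adj u v).inter ((MeasurableSet.const _).inter (MeasurableSet.const _))

/-! ### Local modification: excluding three, then two infinite components. -/

namespace CellField

variable {S Λ Q : Type*} [MeasurableSpace S] [MeasurableSpace Q] {h : ℝ}
  (F : CellField S Λ Q h) [Countable Q] [DiscreteMeasurableSpace Q] (hh : 0 < h) (r : ℝ)
  (f : Q → Q → Fin 2)

/-- Outside the box of cells `[-N, N)²` there are `k` distinct infinite components having points
with marks in `A` close to the square `[-b, b]²`. -/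
def Meet (k N : ℕ) (A : Set Q) (b : ℝ) : Set (Cell → S) :=
  {w | ∃ c : Fin k → Cell × Λ,
    (∀ i, (cluster (keep ((F.cellGraph hh r f).gr w) (CellGraph.off Λ (box (-N) N)))
      (c i)).Infinite) ∧
    (∀ i j, i ≠ j → ¬ (keep ((F.cellGraph hh r f).gr w)
      (CellGraph.off Λ (box (-N) N))).Reachable (c i) (c j)) ∧
    ∀ i, (c i).1 ∉ box (-N) N ∧ F.valid (w (c i).1) (c i).2 ∧ F.vmark w (c i) ∈ A ∧
      Metric.infDist (F.vpos w (c i)) (square b) ≤ r}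

/-- Each cell of the box `[-N, N)²` has exactly the marks in `A`. -/
def Filled (N : ℕ) (A : Set Q) : Set (Cell → S) :=
  {w | ∀ z ∈ box (-N) N, F.markSet (w z) = A}

variable [Countable Λ]

lemma measurableSet_meet (k N : ℕ) (A : Set Q) (b : ℝ) :
    MeasurableSet (F.Meet hh r f k N A b) := by
  have hadj := (F.cellGraph hh r f).measurableSet_adj_keep (CellGraph.off Λ (box (-N) N))
  simp only [Meet, Set.ofPred_exists, Set.ofPred_and, Set.ofPred_forall]
  refine MeasurableSet.iUnion fun c => MeasurableSet.inter ?_ (MeasurableSet.inter ?_ ?_)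
  · exact MeasurableSet.iInter fun i => measurableSet_cluster_infinite hadj _
  · exact MeasurableSet.iInter fun i => MeasurableSet.iInter fun j =>
      MeasurableSet.iInter fun _ => (measurableSet_reachable hadj _ _).compl
  · refine MeasurableSet.iInter fun i =>
      (MeasurableSet.iInter fun _ => MeasurableSet.const False).inter
      ((F.measurableSet_vvalid (c i)).inter (MeasurableSet.inter ?_ ?_))
    · exact F.measurable_vmark (c i) (MeasurableSet.of_discrete (s := A))
    · exact measurableSet_le ((Metric.continuous_infDist_pt _).measurable.comp
        (F.measurable_vpos (c i))) measurable_const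

-- Once the box is removed, every remaining edge is determined by the states of two outside cells.
omit [Countable Λ] in
lemma dependsOnly_meet (k N : ℕ) (A : Set Q) (b : ℝ) :
    DependsOnly (F.Meet hh r f k N A b) ((box (-N) N : Set Cell))ᶜ := by
  have key : ∀ w w' : Cell → S, (∀ z ∈ ((box (-N) N : Set Cell))ᶜ, w z = w' z) →
      w ∈ F.Meet hh r f k N A b → w' ∈ F.Meet hh r f k N A b := by
    rintro w w' hww ⟨c, h1, h2, h3⟩
    have hG : keep ((F.cellGraph hh r f).gr w) (CellGraph.off Λ (box (-N) N)) =
        keep ((F.cellGraph hh r f).gr w') (CellGraph.off Λ (box (-N) N)) := by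
      ext u v
      refine and_congr_left fun huv => ?_
      exact (F.cellGraph hh r f).adj_local w w' u v (hww _ huv.1) (hww _ huv.2)
    rw [hG] at h1 h2
    refine ⟨c, h1, h2, fun i => ?_⟩
    obtain ⟨h4, h5, h6, h7⟩ := h3 i
    have hwi := hww (c i).1 h4
    refine ⟨h4, hwi ▸ h5, ?_, ?_⟩
    · rwa [vmark, ← hwi]
    · rwa [vpos, ← hwi]
  exact fun w w' hww => ⟨key w w' hww, key w' w fun z hz => (hww z hz).symm⟩

lemma measurableSet_filled (N : ℕ) (A : Set Q) : MeasurableSet (F.Filled N A) := by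
  simp only [Filled, Set.ofPred_forall]
  exact MeasurableSet.iInter fun z => MeasurableSet.iInter fun _ =>
    (measurable_pi_apply z : Measurable fun w : Cell → S => w z) (F.measurableSet_markSet_eq A)

omit [Countable Λ] [Countable Q] [DiscreteMeasurableSpace Q] in
lemma dependsOnly_filled (N : ℕ) (A : Set Q) :
    DependsOnly (F.Filled N A) (box (-N) N : Set Cell) := fun w w' hww =>
  forall₂_congr fun z hz => by rw [hww z hz]

variable (ν₀ : Measure S) [IsProbabilityMeasure ν₀]

lemma measure_filled_ne_zero (N : ℕ) {A : Set Q} (hA : ν₀ {s | F.markSet s = A} ≠ 0) :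
    Measure.infinitePi (fun _ : Cell => ν₀) (F.Filled N A) ≠ 0 := by
  have : F.Filled N A = Set.pi (box (-N) N : Set Cell) fun _ => {s | F.markSet s = A} := by
    ext w
    simp [Filled, Set.mem_pi]
  rw [this, Measure.infinitePi_pi _ fun z _ => F.measurableSet_markSet_eq A]
  exact Finset.prod_ne_zero_iff.2 fun z _ => hA

lemma measure_inter_filled_ne_zero {E : Set (Cell → S)} (hE : MeasurableSet E) (N : ℕ)
    (hdep : DependsOnly E ((box (-N) N : Set Cell))ᶜ)
    (hpos : Measure.infinitePi (fun _ : Cell => ν₀) E ≠ 0)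
    {A : Set Q} (hA : ν₀ {s | F.markSet s = A} ≠ 0) :
    Measure.infinitePi (fun _ : Cell => ν₀) (E ∩ F.Filled N A) ≠ 0 := by
  rw [measure_inter_of_dependsOnly ν₀ hE (F.measurableSet_filled N A) hdep
    (F.dependsOnly_filled N A) disjoint_compl_left]
  exact mul_ne_zero hpos (F.measure_filled_ne_zero ν₀ N hA)

/-- Three infinite components almost surely do not meet near a square. -/
theorem measure_meet_three (hr : 4 * h ≤ r) {b : ℝ} (hb : 0 ≤ b) {N : ℕ}
    (hN : b + 3 * h ≤ h * N) {A : Set Q} (hA : Linked f A)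
    (hpos : ν₀ {s | F.markSet s = A} ≠ 0) (hfin : ∑' l, ν₀ {s | F.valid s l} ≠ ∞) :
    Measure.infinitePi (fun _ : Cell => ν₀) (F.Meet hh r f 3 N A b) = 0 := by
  -- The event concerns only the cells outside the box, so it is independent of the filling and both
  -- occur together with positive probability. Then the box is a trifurcation.
  by_contra hne
  refine F.measure_inter_filled_ne_zero ν₀ (F.measurableSet_meet hh r f 3 N A b) N
    (F.dependsOnly_meet hh r f 3 N A b) hne hpos ?_
  refine (F.cellGraph hh r f).measure_trif_eq_zero ν₀ hfin N
    ((F.measurableSet_meet hh r f 3 N A b).inter (F.measurableSet_filled N A)) ?_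
  rintro w ⟨⟨c, h1, h2, h3⟩, hw⟩
  refine ⟨fun x hx y hy => reachable_of_filled hr hA hw hx hy, c, h1, h2, fun i => ?_⟩
  obtain ⟨h4, h5, h6, h7⟩ := h3 i
  exact exists_adj_of_filled hr hb hN hA hw h4 h5 h6 h7

/-- If the graph almost surely has fewer than `k` infinite components, the same holds after
removing a box. -/
theorem measure_manyInf_keep (N k : ℕ) (hpos : ν₀ {s | F.markSet s = ∅} ≠ 0)
    (hzero : Measure.infinitePi (fun _ : Cell => ν₀) {w | ManyInf ((F.cellGraph hh r f).gr w) k} = 0) :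
    Measure.infinitePi (fun _ : Cell => ν₀)
      {w | ManyInf (keep ((F.cellGraph hh r f).gr w) (CellGraph.off Λ (box (-N) N))) k} = 0 := by
  -- The outside event is independent of the box being empty, which has positive probability, and on
  -- an empty box the removal changes nothing.
  by_contra hne
  refine F.measure_inter_filled_ne_zero ν₀ (measurableSet_manyInf
    ((F.cellGraph hh r f).measurableSet_adj_keep _) k) N ?_ hne hpos
    (measure_mono_null ?_ hzero)
  · intro w w' hww
    have hG : keep ((F.cellGraph hh r f).gr w) (CellGraph.off Λ (box (-N) N)) =
        keep ((F.cellGraph hh r f).gr w') (CellGraph.off Λ (box (-N) N)) := by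
      ext u v
      refine and_congr_left fun huv => ?_
      exact (F.cellGraph hh r f).adj_local w w' u v (hww _ huv.1) (hww _ huv.2)
    simp only [Set.mem_ofPred_eq, hG]
  · rintro w ⟨hw1, hw2⟩
    have hG : keep ((F.cellGraph hh r f).gr w) (CellGraph.off Λ (box (-N) N)) =
        (F.cellGraph hh r f).gr w := by
      have hempty : ∀ u : Cell × Λ, F.valid (w u.1) u.2 → u.1 ∉ box (-N) N := by
        intro u hu hz
        have : F.mark (w u.1) u.2 ∈ F.markSet (w u.1) := ⟨u.2, hu, rfl⟩
        rw [hw2 _ hz] at this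
        exact this
      ext u v
      refine ⟨fun h => h.1, fun h => ⟨h, hempty u h.2.1, hempty v h.2.2⟩⟩
    simpa only [Set.mem_ofPred_eq, hG] using hw1

-- Removing the finitely many points of the box from an infinite component leaves an infinite
-- outside component. With no third one available, it is that of `u 0` or `u 1`, and these two are
-- joined through the filled box.
omit [Countable Λ] in
lemma not_manyInf_two_of_filled (hr : 4 * h ≤ r) {b : ℝ} (hb : 0 ≤ b) {N : ℕ}
    (hN : b + 3 * h ≤ h * N) {A : Set Q} (hA : Linked f A) {w : Cell → S}
    (hfin : ∀ z, {l | F.valid (w z) l}.Finite) (hmeet : w ∈ F.Meet hh r f 2 N A b)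
    (hw : w ∈ F.Filled N A)
    (hthree : ¬ ManyInf (keep ((F.cellGraph hh r f).gr w) (CellGraph.off Λ (box (-N) N))) 3) :
    ¬ ManyInf ((F.cellGraph hh r f).gr w) 2 := by
  rintro ⟨c, hc1, hc2⟩
  obtain ⟨u, hu1, hu2, hu3⟩ := hmeet
  set H := F.cellGraph hh r f
  set G' := keep (H.gr w) (CellGraph.off Λ (box (-N) N)) with hG'
  have hjoin : ∀ i j, (H.gr w).Reachable (u i) (u j) := by
    have hadj : ∀ i, ∃ t ∈ H.occ w (box (-N) N), (H.gr w).Adj (u i) t := fun i =>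
      exists_adj_of_filled hr hb hN hA hw (hu3 i).1 (hu3 i).2.1 (hu3 i).2.2.1 (hu3 i).2.2.2
    intro i j
    obtain ⟨s, hs, his⟩ := hadj i
    obtain ⟨t, ht, hjt⟩ := hadj j
    exact his.reachable.trans (((reachable_of_filled hr hA hw hs ht).mono (keep_le _ _)).trans
      hjt.symm.reachable)
  have hto : ∀ i, ∃ j, (H.gr w).Reachable (c i) (u j) := by
    intro i
    obtain ⟨x, hx1, hx2, -⟩ := exists_infinite_cluster_keep (H.occ_finite hfin (box (-N) N))
      (fun t _ => H.finite_adj hfin t) (hc1 i)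
    rw [H.keep_occ_compl, ← hG'] at hx2
    by_contra hcon
    push Not at hcon
    have hx3 : ∀ j, ¬ G'.Reachable x (u j) := fun j hj =>
      hcon j (hx1.trans (hj.mono (keep_le _ _)))
    -- An infinite outside component missing both `u 0` and `u 1` would be a third one.
    refine hthree ⟨![u 0, u 1, x], ?_, ?_⟩
    · intro k
      fin_cases k
      · exact hu1 0
      · exact hu1 1
      · exact hx2
    · intro k l hkl
      fin_cases k <;> fin_cases l <;> try exact absurd rfl hkl
      · exact hu2 0 1 (by decide)
      · exact fun h => hx3 0 h.symm
      · exact hu2 1 0 (by decide)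
      · exact fun h => hx3 1 h.symm
      · exact hx3 0
      · exact hx3 1
  obtain ⟨i, hi⟩ := hto 0
  obtain ⟨j, hj⟩ := hto 1
  exact hc2 0 1 (by decide) (hi.trans ((hjoin i j).trans hj.symm))

/-- If at most two infinite components occur almost surely, and two can meet near a square, then
almost surely there is at most one. -/
theorem measure_manyInf_two (hr : 4 * h ≤ r) {b : ℝ} (hb : 0 ≤ b) {N : ℕ}
    (hN : b + 3 * h ≤ h * N) {A : Set Q} (hA : Linked f A)
    (hpos : ν₀ {s | F.markSet s = A} ≠ 0) (hempty : ν₀ {s | F.markSet s = ∅} ≠ 0)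
    (hfin : ∑' l, ν₀ {s | F.valid s l} ≠ ∞)
    (hthree : Measure.infinitePi (fun _ : Cell => ν₀)
      {w | ManyInf ((F.cellGraph hh r f).gr w) 3} = 0)
    (hmeet : Measure.infinitePi (fun _ : Cell => ν₀) (F.Meet hh r f 2 N A b) ≠ 0) :
    Measure.infinitePi (fun _ : Cell => ν₀) {w | ManyInf ((F.cellGraph hh r f).gr w) 2} = 0 := by
  set ν := Measure.infinitePi (fun _ : Cell => ν₀) with hν
  have hm : MeasurableSet {w | ManyInf ((F.cellGraph hh r f).gr w) 2} :=
    measurableSet_manyInf (F.cellGraph hh r f).measurableSet_adj 2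
  -- It suffices to exclude probability one, as the filled configurations meeting `Meet` have
  -- positive probability and almost all of them have at most one infinite component.
  refine (measure_eq_zero_or_one_of_shift_invariant ν₀ hm fun a => ?_).resolve_right fun hone => ?_
  · ext w
    exact (F.cellGraph hh r f).manyInf_shift a w 2
  · have hne := F.measure_inter_filled_ne_zero ν₀ (F.measurableSet_meet hh r f 2 N A b) N
      (F.dependsOnly_meet hh r f 2 N A b) hmeet hpos
    refine hne ?_
    rw [← hν, measure_eq_zero_iff_ae_notMem]
    have h1 : ∀ᵐ w ∂ν, ManyInf ((F.cellGraph hh r f).gr w) 2 := (prob_compl_eq_zero_iff hm).2 hone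
    have h2 : ∀ᵐ w ∂ν, w ∉ {w | ManyInf (keep ((F.cellGraph hh r f).gr w)
        (CellGraph.off Λ (box (-N) N))) 3} :=
      measure_eq_zero_iff_ae_notMem.1 (F.measure_manyInf_keep hh r f ν₀ N 3 hempty hthree)
    filter_upwards [h1, h2, (F.cellGraph hh r f).ae_finite_valid ν₀ hfin] with w hw1 hw2 hw3
    rintro ⟨hw4, hw5⟩
    exact F.not_manyInf_two_of_filled hh r f hr hb hN hA hw3 hw4 hw5 hw2 hw1

end CellField

/-! ### Multisets of independent marks. -/

/-- Finite multisets of marks carry the discrete `σ`-algebra. -/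
instance instMeasurableSpaceMultiset (Q : Type*) : MeasurableSpace (Multiset Q) := ⊤

instance instDiscreteMeasurableSpaceMultiset (Q : Type*) : DiscreteMeasurableSpace (Multiset Q) :=
  ⟨fun _ => trivial⟩

section Marks

variable {Q : Type*}

open Classical in
/-- The multiset of the marks `q n` of the points `x n` in `A`, if these are finitely many. -/
noncomputable def marks (x : ℕ → Plane) (q : ℕ → Q) (A : Set Plane) : Multiset Q :=
  if h : {n | x n ∈ A}.Finite then ∑ n ∈ h.toFinset, {q n} else 0

lemma marks_eq_sum {x : ℕ → Plane} {q : ℕ → Q} {A : Set Plane} {I : Finset ℕ}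
    (hI : ∀ n, x n ∈ A ↔ n ∈ I) : marks x q A = ∑ n ∈ I, {q n} := by
  have h : {n | x n ∈ A}.Finite := I.finite_toSet.subset fun n hn => (hI n).1 hn
  have hI' : h.toFinset = I := by
    ext n
    rw [Set.Finite.mem_toFinset, Set.mem_ofPred_eq, hI]
  rw [marks, dif_pos h, hI']

lemma card_sum_singleton (I : Finset ℕ) (q : ℕ → Q) :
    Multiset.card (∑ n ∈ I, ({q n} : Multiset Q)) = I.card := by
  simp

/-- The probability that independent marks form the multiset `k`. -/
noncomputable def markWeight [MeasurableSpace Q] (p : Measure Q) [IsProbabilityMeasure p]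
    (k : Multiset Q) : ℝ≥0∞ :=
  Measure.infinitePi (fun _ : Fin (Multiset.card k) => p) {x | ∑ j, ({x j} : Multiset Q) = k}

variable [MeasurableSpace Q] [DiscreteMeasurableSpace Q] [Countable Q]
  (p : Measure Q) [IsProbabilityMeasure p]

lemma measurable_sum_singleton {ι : Type*} (I : Finset ι) :
    Measurable fun x : ι → Q => ∑ n ∈ I, ({x n} : Multiset Q) := by
  classical
  have : (fun x : ι → Q => ∑ n ∈ I, ({x n} : Multiset Q)) =
      (fun y : I → Q => ∑ n : I, ({y n} : Multiset Q)) ∘ I.restrict := by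
    funext x
    exact (Finset.sum_coe_sort I fun n => ({x n} : Multiset Q)).symm
  rw [this]
  exact (measurable_of_countable _).comp (measurable_pi_lambda _ fun i => measurable_pi_apply _)

/-- The marks are i.i.d., so only the number of indices matters: an enumeration of `I` carries the
restricted product measure to the one defining `markWeight`. -/
lemma measure_sum_singleton_eq (I : Finset ℕ) (k : Multiset Q) :
    Measure.infinitePi (fun _ : ℕ => p) {x | ∑ n ∈ I, ({x n} : Multiset Q) = k} =
      if I.card = Multiset.card k then markWeight p k else 0 := by
  split_ifs with h
  · let e : I ≃ Fin (Multiset.card k) := I.equivFinOfCardEq h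
    have hinj : Function.Injective fun j => ((e.symm j : I) : ℕ) :=
      Subtype.val_injective.comp e.symm.injective
    have hmap := Measure.map_infinitePi_infinitePi_of_inj (P := fun _ : ℕ => p) hinj
    have hms : MeasurableSet {x : Fin (Multiset.card k) → Q | ∑ j, ({x j} : Multiset Q) = k} :=
      measurable_sum_singleton Finset.univ (MeasurableSet.of_discrete (s := {k}))
    rw [markWeight, ← hmap, Measure.map_apply (by fun_prop) hms]
    congr 1
    ext x
    simp only [Set.mem_ofPred_eq, Set.mem_preimage]
    rw [← Finset.sum_coe_sort I, ← Equiv.sum_comp e.symm]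
  · refine measure_mono_null (fun x hx => h ?_) measure_empty
    rw [← (hx : ∑ n ∈ I, ({x n} : Multiset Q) = k), card_sum_singleton I x]

/-- Disjoint index sets involve disjoint coordinates; the factors split off one at a time by
independence. -/
lemma measure_forall_sum_singleton_eq {ι : Type*} [Fintype ι] (I : ι → Finset ℕ)
    (hI : ∀ i j, i ≠ j → Disjoint (I i) (I j)) (k : ι → Multiset Q) :
    Measure.infinitePi (fun _ : ℕ => p) {x | ∀ i, ∑ n ∈ I i, ({x n} : Multiset Q) = k i} =
      ∏ i, if (I i).card = Multiset.card (k i) then markWeight p (k i) else 0 := by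
  classical
  have hm : ∀ i, MeasurableSet {x : ℕ → Q | ∑ n ∈ I i, ({x n} : Multiset Q) = k i} := fun i =>
    measurable_sum_singleton (I i) (MeasurableSet.of_discrete (s := {k i}))
  have hd : ∀ i, DependsOnly {x : ℕ → Q | ∑ n ∈ I i, ({x n} : Multiset Q) = k i}
      (I i : Set ℕ) := by
    intro i x y hxy
    have : ∑ n ∈ I i, ({x n} : Multiset Q) = ∑ n ∈ I i, ({y n} : Multiset Q) :=
      Finset.sum_congr rfl fun n hn => by rw [hxy n hn]
    simp only [Set.mem_ofPred_eq, this]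
  have hs : ∀ s : Finset ι, Measure.infinitePi (fun _ : ℕ => p)
      {x | ∀ i ∈ s, ∑ n ∈ I i, ({x n} : Multiset Q) = k i} =
      ∏ i ∈ s, if (I i).card = Multiset.card (k i) then markWeight p (k i) else 0 := by
    intro s
    induction s using Finset.induction_on with
    | empty => simp
    | insert a s ha ih =>
      have hset : {x : ℕ → Q | ∀ i ∈ insert a s, ∑ n ∈ I i, ({x n} : Multiset Q) = k i} =
          {x | ∑ n ∈ I a, ({x n} : Multiset Q) = k a} ∩
            {x | ∀ i ∈ s, ∑ n ∈ I i, ({x n} : Multiset Q) = k i} := by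
        ext x
        simp
      rw [hset, measure_inter_of_dependsOnly p (hm a) ?_ (hd a)
        (E := ⋃ i ∈ s, (I i : Set ℕ)) ?_ ?_, ih, Finset.prod_insert ha,
        measure_sum_singleton_eq]
      · simp only [Set.ofPred_forall]
        exact MeasurableSet.iInter fun i => MeasurableSet.iInter fun _ => hm i
      · intro x y hxy
        refine forall₂_congr fun i hi => hd i x y fun n hn => hxy n ?_
        exact Set.mem_biUnion hi hn
      · rw [Set.disjoint_iUnion₂_right]
        intro i hi
        rw [Finset.disjoint_coe]
        exact hI a i fun h => ha (h ▸ hi)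
  simpa using hs Finset.univ

end Marks

/-! ### The marks found in disjoint regions. -/

/-- A Poisson process with independent marks of law `p`, all of whose realisations are locally
finite and without repetitions. -/
structure IsMarkedPoisson {Ω Q : Type*} [MeasurableSpace Ω] [MeasurableSpace Q] (μ : Measure Ω)
    (lam : ℝ) (p : Measure Q) (X : ℕ → Ω → Plane) (ζ : ℕ → Ω → Q) : Prop where
  poisson : IsPoissonProcess μ lam X
  measurable_mark : ∀ n, Measurable (ζ n)
  map_mark : μ.map (fun ω n => ζ n ω) = Measure.infinitePi (fun _ : ℕ => p)
  indep : IndepFun (fun ω n => X n ω) (fun ω n => ζ n ω) μ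
  finite : ∀ ω b, {n | X n ω ∈ square b}.Finite
  injective : ∀ ω, Function.Injective fun n => X n ω

/-- The Poisson weight of a count. -/
noncomputable def poissonWeight (lam v : ℝ) (k : ℕ) : ℝ≥0∞ :=
  ENNReal.ofReal (Real.exp (-(lam * v)) * (lam * v) ^ k / (Nat.factorial k : ℝ))

/-- Regions for the marking lemma: measurable sets of finite area inside some square. -/
structure IsRegion (A : Set Plane) : Prop where
  measurableSet : MeasurableSet A
  subset : ∃ b, A ⊆ square b

lemma IsRegion.volume_ne_top {A : Set Plane} (hA : IsRegion A) : volume A ≠ ∞ := by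
  obtain ⟨b, hb⟩ := hA.subset
  refine (Bornology.IsBounded.measure_lt_top ?_).ne
  refine Bornology.IsBounded.subset (t := square b) ?_ hb
  rw [Metric.isBounded_iff]
  refine ⟨2 * b + 2 * b, fun x hx y hy => (dist_le_add x y).trans ?_⟩
  have key : ∀ i, |x i - y i| ≤ 2 * b := fun i => by
    have h1 := abs_le.1 (hx i)
    have h2 := abs_le.1 (hy i)
    rw [abs_le]
    constructor <;> linarith
  linarith [key 0, key 1]

namespace IsMarkedPoisson

variable {Ω Q : Type*} [MeasurableSpace Ω] [MeasurableSpace Q] {μ : Measure Ω}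
    {lam : ℝ} {p : Measure Q} [IsProbabilityMeasure p]
    {X : ℕ → Ω → Plane} {ζ : ℕ → Ω → Q} (M : IsMarkedPoisson μ lam p X ζ)

include M

omit [IsProbabilityMeasure p] in
lemma finite_mem {A : Set Plane} (hA : IsRegion A) (ω : Ω) : {n | X n ω ∈ A}.Finite := by
  obtain ⟨b, hb⟩ := hA.subset
  exact (M.finite ω b).subset fun n hn => hb hn

variable [DiscreteMeasurableSpace Q] [Countable Q]

/-- The joint law of the multisets of marks found in disjoint regions. -/
lemma measure_forall_marks_eq {ι : Type*} [Fintype ι] (A : ι → Set Plane)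
    (hA : ∀ i, IsRegion (A i)) (hdisj : ∀ i j, i ≠ j → Disjoint (A i) (A j))
    (k : ι → Multiset Q) :
    μ {ω | ∀ i, marks (fun n => X n ω) (fun n => ζ n ω) (A i) = k i} =
      ∏ i, (poissonWeight lam (volume (A i)).toReal (Multiset.card (k i)) *
        markWeight p (k i)) := by
  classical
  -- The enumeration of the points is arbitrary, so the event is split according to the indices `I`
  -- of the points in each region. Given `I`, the marks contribute a factor depending only on the
  -- cardinalities, and summing over `I` with the right cardinalities leaves the probability of the
  -- counts.
  let E : (ι → Finset ℕ) → Set (ℕ → Plane) := fun I => {x | ∀ i n, x n ∈ A i ↔ n ∈ I i}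
  let B : (ι → Finset ℕ) → Set (ℕ → Q) := fun I => {x | ∀ i, ∑ n ∈ I i, ({x n} : Multiset Q) = k i}
  have hE : ∀ I, MeasurableSet (E I) := by
    intro I
    simp only [E, Set.ofPred_forall]
    refine MeasurableSet.iInter fun i => MeasurableSet.iInter fun n => ?_
    have hmem : MeasurableSet {x : ℕ → Plane | x n ∈ A i} :=
      (measurable_pi_apply n : Measurable fun x : ℕ → Plane => x n) (hA i).measurableSet
    by_cases hn : n ∈ I i
    · simpa only [hn, iff_true] using hmem
    · simp only [hn, iff_false]
      exact hmem.compl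
  have hB : ∀ I, MeasurableSet (B I) := by
    intro I
    simp only [B, Set.ofPred_forall]
    exact MeasurableSet.iInter fun i =>
      measurable_sum_singleton (I i) (MeasurableSet.of_discrete (s := {k i}))
  have hXm : Measurable fun ω n => X n ω := measurable_pi_lambda _ M.poisson.measurable
  have hζm : Measurable fun ω n => ζ n ω := measurable_pi_lambda _ M.measurable_mark
  have hex : ∀ ω, ∃ I, (fun n => X n ω) ∈ E I := fun ω =>
    ⟨fun i => (M.finite_mem (hA i) ω).toFinset, fun i n => by simp⟩
  have huniq : ∀ x I J, x ∈ E I → x ∈ E J → I = J := fun x I J hI hJ => by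
    funext i
    ext n
    rw [← hI i n, hJ i n]
  have hmeas : ∀ I, MeasurableSet ((fun ω n => X n ω) ⁻¹' E I) := fun I => hXm (hE I)
  have hpd : Pairwise (Function.onFun Disjoint fun I => (fun ω n => X n ω) ⁻¹' E I) :=
    fun I J hIJ => Set.disjoint_left.2 fun ω h1 h2 => hIJ (huniq _ I J h1 h2)
  have hunion : {ω | ∀ i, marks (fun n => X n ω) (fun n => ζ n ω) (A i) = k i} =
      ⋃ I, ((fun ω n => X n ω) ⁻¹' E I ∩ (fun ω n => ζ n ω) ⁻¹' B I) := by
    ext ω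
    simp only [Set.mem_ofPred_eq, Set.mem_iUnion, Set.mem_inter_iff, Set.mem_preimage]
    constructor
    · intro h
      obtain ⟨I, hI⟩ := hex ω
      exact ⟨I, hI, fun i => by rw [← h i]; exact (marks_eq_sum (hI i)).symm⟩
    · rintro ⟨I, hI, hBI⟩ i
      rw [marks_eq_sum (hI i)]
      exact hBI i
  have hcount : {ω | ∀ i, pointCount (fun n => X n ω) (A i) = (Multiset.card (k i) : ℕ∞)} =
      ⋃ I : {I : ι → Finset ℕ // ∀ i, (I i).card = Multiset.card (k i)},
        (fun ω n => X n ω) ⁻¹' E I := by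
    have hc : ∀ ω I, (fun n => X n ω) ∈ E I → ∀ i,
        pointCount (fun n => X n ω) (A i) = ((I i).card : ℕ∞) := by
      intro ω I hI i
      have : {n | X n ω ∈ A i} = (I i : Set ℕ) := Set.ext fun n => hI i n
      rw [pointCount, this, Set.encard_coe_eq_coe_finsetCard]
    ext ω
    simp only [Set.mem_ofPred_eq, Set.mem_iUnion, Set.mem_preimage]
    constructor
    · intro h
      obtain ⟨I, hI⟩ := hex ω
      exact ⟨⟨I, fun i => by exact_mod_cast (hc ω I hI i).symm.trans (h i)⟩, hI⟩
    · rintro ⟨I, hI⟩ i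
      rw [hc ω I hI i, I.2 i]
  have hterm : ∀ I, μ ((fun ω n => X n ω) ⁻¹' E I ∩ (fun ω n => ζ n ω) ⁻¹' B I) =
      ({I | ∀ i, (I i).card = Multiset.card (k i)} : Set (ι → Finset ℕ)).indicator
        (fun I => μ ((fun ω n => X n ω) ⁻¹' E I)) I * ∏ i, markWeight p (k i) := by
    intro I
    rw [M.indep.measure_inter_preimage_eq_mul _ _ (hE I) (hB I)]
    -- Only realised families `I` are known to be pairwise disjoint; for the others the position
    -- event is empty and both sides vanish.
    by_cases hne : ((fun ω n => X n ω) ⁻¹' E I).Nonempty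
    · obtain ⟨ω, hω⟩ := hne
      have hI : ∀ i j, i ≠ j → Disjoint (I i) (I j) := by
        intro i j hij
        rw [Finset.disjoint_left]
        intro n hi hj
        exact Set.disjoint_left.1 (hdisj i j hij) ((hω i n).2 hi) ((hω j n).2 hj)
      rw [← Measure.map_apply hζm (hB I), M.map_mark, measure_forall_sum_singleton_eq p I hI k]
      by_cases hc : ∀ i, (I i).card = Multiset.card (k i)
      · simp only [Set.indicator_apply, Set.mem_ofPred_eq, hc, if_true, implies_true]
      · simp only [Set.indicator_apply, Set.mem_ofPred_eq, hc, if_false, zero_mul]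
        push Not at hc
        obtain ⟨i, hi⟩ := hc
        rw [Finset.prod_eq_zero (Finset.mem_univ i) (by rw [if_neg hi]), mul_zero]
    · rw [Set.not_nonempty_iff_eq_empty] at hne
      simp only [hne, measure_empty, zero_mul, Set.indicator_apply, ite_self]
  have hprod : μ {ω | ∀ i, pointCount (fun n => X n ω) (A i) = (Multiset.card (k i) : ℕ∞)} =
      ∏ i, poissonWeight lam (volume (A i)).toReal (Multiset.card (k i)) := by
    let e := Fintype.equivFin ι
    have hi := M.poisson.indep (Fintype.card ι) (fun j => A (e.symm j))
      (fun j => (hA _).measurableSet) (fun j => (hA _).volume_ne_top)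
      (fun i j hij => hdisj _ _ fun h => hij (e.symm.injective h))
    have hi' := iIndepFun.precomp e.injective hi
    have := hi'.measure_inter_preimage_eq_mul Finset.univ
      (sets := fun i => {(Multiset.card (k i) : ℕ∞)}) fun i _ => MeasurableSet.of_discrete
    have hset : {ω | ∀ i, pointCount (fun n => X n ω) (A i) = (Multiset.card (k i) : ℕ∞)} =
        ⋂ i ∈ (Finset.univ : Finset ι), (fun ω => pointCount (fun n => X n ω) (A (e.symm (e i)))) ⁻¹'
          {(Multiset.card (k i) : ℕ∞)} := by
      ext ω
      simp
    rw [hset, this]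
    refine Finset.prod_congr rfl fun i _ => ?_
    rw [poissonWeight, ← M.poisson.poisson (A i) (hA i).measurableSet (hA i).volume_ne_top]
    congr 1
    ext ω
    simp
  rw [hunion, measure_iUnion (fun I J hIJ => (hpd hIJ).mono Set.inter_subset_left
    Set.inter_subset_left) fun I => (hmeas I).inter (hζm (hB I))]
  simp only [hterm]
  rw [ENNReal.tsum_mul_right, ← tsum_subtype, Finset.prod_mul_distrib, ← hprod, hcount]
  have hu := measure_iUnion (μ := μ)
    (f := fun I : {I : ι → Finset ℕ // ∀ i, (I i).card = Multiset.card (k i)} =>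
      (fun ω n => X n ω) ⁻¹' E I)
    (fun I J hIJ => hpd fun h => hIJ (Subtype.ext h)) fun I => hmeas I
  rw [hu]
  rfl

omit [IsProbabilityMeasure p] in
lemma measurable_marks {A : Set Plane} (hA : IsRegion A) :
    Measurable fun ω => marks (fun n => X n ω) (fun n => ζ n ω) A := by
  refine measurable_to_countable' fun k => ?_
  have : (fun ω => marks (fun n => X n ω) (fun n => ζ n ω) A) ⁻¹' {k} =
      ⋃ I : Finset ℕ, {ω | ∀ n, X n ω ∈ A ↔ n ∈ I} ∩
        {ω | ∑ n ∈ I, ({ζ n ω} : Multiset Q) = k} := by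
    ext ω
    simp only [Set.mem_preimage, Set.mem_singleton_iff, Set.mem_iUnion, Set.mem_inter_iff,
      Set.mem_ofPred_eq]
    constructor
    · intro h
      have hI : ∀ n, X n ω ∈ A ↔ n ∈ (M.finite_mem hA ω).toFinset := fun n => by simp
      exact ⟨_, hI, by rw [← h]; exact (marks_eq_sum hI).symm⟩
    · rintro ⟨I, hI, h⟩
      rw [← h]
      exact marks_eq_sum hI
  rw [this]
  refine MeasurableSet.iUnion fun I => MeasurableSet.inter ?_ ?_
  · rw [Set.ofPred_forall]
    refine MeasurableSet.iInter fun n => ?_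
    have hmem : MeasurableSet {ω | X n ω ∈ A} := M.poisson.measurable n hA.measurableSet
    by_cases hn : n ∈ I
    · simpa only [hn, iff_true] using hmem
    · simp only [hn, iff_false]
      exact hmem.compl
  · exact ((measurable_sum_singleton I).comp (measurable_pi_lambda _ M.measurable_mark))
      (MeasurableSet.of_discrete (s := {k}))

lemma measure_marks_eq {A : Set Plane} (hA : IsRegion A) (k : Multiset Q) :
    μ {ω | marks (fun n => X n ω) (fun n => ζ n ω) A = k} =
      poissonWeight lam (volume A).toReal (Multiset.card k) * markWeight p k := by
  have := M.measure_forall_marks_eq (fun _ : Unit => A) (fun _ => hA)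
    (fun i j hij => absurd rfl hij) fun _ => k
  simpa using this

lemma map_marks_eq {A B : Set Plane} (hA : IsRegion A) (hB : IsRegion B)
    (hAB : volume A = volume B) :
    μ.map (fun ω => marks (fun n => X n ω) (fun n => ζ n ω) A) =
      μ.map (fun ω => marks (fun n => X n ω) (fun n => ζ n ω) B) := by
  refine Measure.ext_of_singleton fun k => ?_
  rw [Measure.map_apply (M.measurable_marks hA) (measurableSet_singleton k),
    Measure.map_apply (M.measurable_marks hB) (measurableSet_singleton k)]
  have h1 := M.measure_marks_eq hA k
  have h2 := M.measure_marks_eq hB k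
  rw [hAB] at h1
  exact h1.trans h2.symm

/-- The multisets of marks found in disjoint regions are independent. -/
lemma iIndepFun_marks [IsProbabilityMeasure μ] {J : Type*} (A : J → Set Plane) (hA : ∀ j, IsRegion (A j))
    (hdisj : ∀ i j, i ≠ j → Disjoint (A i) (A j)) :
    iIndepFun (fun j ω => marks (fun n => X n ω) (fun n => ζ n ω) (A j)) μ := by
  rw [iIndepFun_iff_finset]
  intro s
  change iIndepFun (fun (j : s) ω => marks (fun n => X n ω) (fun n => ζ n ω) (A j)) μ
  rw [iIndepFun_iff_map_fun_eq_pi_map (ι := s) fun j => (M.measurable_marks (hA j)).aemeasurable]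
  refine Measure.ext_of_singleton fun k => ?_
  rw [Measure.map_apply (measurable_pi_lambda _ fun j : s => M.measurable_marks (hA j))
    (measurableSet_singleton k), Measure.pi_singleton]
  have h1 := M.measure_forall_marks_eq (fun j : s => A j) (fun j => hA j)
    (fun i j hij => hdisj _ _ fun h => hij (Subtype.ext h)) k
  have hset : (fun ω (j : s) => marks (fun n => X n ω) (fun n => ζ n ω) (A j)) ⁻¹' {k} =
      {ω | ∀ j : s, marks (fun n => X n ω) (fun n => ζ n ω) (A j) = k j} := by
    ext ω
    simp only [Set.mem_preimage, Set.mem_singleton_iff, Set.mem_ofPred_eq, funext_iff]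
  rw [hset, h1]
  refine Finset.prod_congr rfl fun j _ => ?_
  rw [← M.measure_marks_eq (hA j)]
  exact (Measure.map_apply (M.measurable_marks (hA j)) (measurableSet_singleton (k j))).symm

end IsMarkedPoisson

/-! ### Dyadic subcells of a cell. -/

section Address

lemma corner_add (h : ℝ) (y z : Cell) :
    CellField.corner h (y + z) = CellField.corner h y + CellField.corner h z := by
  ext i
  simp only [CellField.corner, PiLp.add_apply, Pi.add_apply]
  push_cast
  ring

/-- The position of a point relative to the corner of its cell. -/
noncomputable def rel (h : ℝ) (x : Plane) : Plane := x - CellField.corner h (cellOf h x)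

/-- The points of the cell `z` whose relative position lies in the cell `b` of the lattice of mesh
`h / 2 ^ l`. -/
def addrSet (h : ℝ) (l : ℕ) (z b : Cell) : Set Plane :=
  {x | cellOf h x = z ∧ cellOf (h / 2 ^ l) (rel h x) = b}

lemma cellOf_sub_corner {h : ℝ} (hh : 0 < h) (x : Plane) (z : Cell) :
    cellOf h (x - CellField.corner h z) = cellOf h x - z := by
  funext i
  have : (x - CellField.corner h z) i / h = x i / h - z i := by
    simp only [CellField.corner, PiLp.sub_apply]
    field_simp
  simp only [cellOf, this, Pi.sub_apply, Int.floor_sub_intCast]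

lemma rel_sub_corner {h : ℝ} (hh : 0 < h) (x : Plane) (z : Cell) :
    rel h (x - CellField.corner h z) = rel h x := by
  have := corner_add h (cellOf h x - z) z
  rw [sub_add_cancel] at this
  rw [rel, rel, cellOf_sub_corner hh, this]
  abel

lemma rel_mem {h : ℝ} (hh : 0 < h) (x : Plane) (i : Fin 2) : 0 ≤ rel h x i ∧ rel h x i < h := by
  have := inCell_cellOf hh x i
  simp only [rel, CellField.corner, PiLp.sub_apply]
  constructor <;> linarith

@[fun_prop]
lemma measurable_cellOf (h : ℝ) : Measurable (cellOf h) := by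
  refine measurable_pi_lambda _ fun i => Int.measurable_floor.comp ?_
  fun_prop

@[fun_prop]
lemma measurable_rel (h : ℝ) : Measurable (rel h) :=
  measurable_id.sub ((measurable_of_countable (CellField.corner h)).comp (measurable_cellOf h))

lemma measurableSet_addrSet (h : ℝ) (l : ℕ) (z b : Cell) : MeasurableSet (addrSet h l z b) :=
  (measurable_cellOf h (measurableSet_singleton z)).inter
    (((measurable_cellOf _).comp (measurable_rel h)) (measurableSet_singleton b))

lemma mem_square_of_cellOf {h : ℝ} (hh : 0 < h) {z : Cell} {x : Plane} (hx : cellOf h x = z) :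
    x ∈ square (h * (|z 0| + |z 1| + 1)) := by
  intro i
  have h1 := hx ▸ inCell_cellOf hh x i
  have h2 : |(z i : ℝ)| ≤ |z 0| + |z 1| := by
    push_cast
    fin_cases i
    · simp
    · simp
  have h3 := abs_le.1 h2
  push_cast at h3 ⊢
  rw [abs_le]
  constructor <;> nlinarith

lemma isRegion_addrSet {h : ℝ} (hh : 0 < h) (l : ℕ) (z b : Cell) : IsRegion (addrSet h l z b) :=
  ⟨measurableSet_addrSet h l z b, _, fun _ hx => mem_square_of_cellOf hh hx.1⟩

lemma addrSet_disjoint (h : ℝ) (l : ℕ) {v v' : Cell × Cell} (hv : v ≠ v') :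
    Disjoint (addrSet h l v.1 v.2) (addrSet h l v'.1 v'.2) :=
  Set.disjoint_left.2 fun _ h1 h2 => hv (Prod.ext (h1.1.symm.trans h2.1) (h1.2.symm.trans h2.2))

lemma volume_addrSet {h : ℝ} (hh : 0 < h) (l : ℕ) (z b : Cell) :
    volume (addrSet h l z b) = volume (addrSet h l 0 b) := by
  have : addrSet h l z b = (fun x => x + -CellField.corner h z) ⁻¹' addrSet h l 0 b := by
    ext x
    simp only [addrSet, Set.mem_preimage, Set.mem_ofPred_eq, ← sub_eq_add_neg,
      cellOf_sub_corner hh, rel_sub_corner hh, sub_eq_zero]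
  rw [this, measure_preimage_add_right]

/-- The ancestor, `j` levels up, of a cell in the dyadic hierarchy. -/
def anc (j : ℕ) (b : Cell) : Cell := fun i => b i / 2 ^ j

/-- The descendants, `j` levels down, of a cell. -/
noncomputable def children (j : ℕ) (b : Cell) : Finset Cell :=
  Fintype.piFinset fun i => Finset.Ico (b i * 2 ^ j) ((b i + 1) * 2 ^ j)

lemma mem_children {j : ℕ} {b c : Cell} : c ∈ children j b ↔ anc j c = b := by
  simp only [children, Fintype.mem_piFinset, Finset.mem_Ico, funext_iff, anc]
  refine forall_congr' fun i => ?_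
  have hp : (0 : ℤ) < 2 ^ j := by positivity
  rw [← Int.le_ediv_iff_mul_le hp, ← Int.ediv_lt_iff_lt_mul hp]
  omega

lemma anc_cellOf (h : ℝ) (l j : ℕ) (y : Plane) :
    anc j (cellOf (h / 2 ^ (l + j)) y) = cellOf (h / 2 ^ l) y := by
  funext i
  simp only [anc, cellOf]
  have h1 := Int.floor_div_natCast (y i / (h / 2 ^ (l + j))) (2 ^ j)
  have h2 : y i / (h / 2 ^ (l + j)) / ((2 ^ j : ℕ) : ℝ) = y i / (h / 2 ^ l) := by
    push_cast
    rw [pow_add]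
    field_simp
  rw [h2] at h1
  rw [h1]
  push_cast
  rfl

end Address

/-! ### The state of a cell and its law. -/

section State

variable {Q : Type*}

/-- The state of a cell: the multisets of marks found in all its dyadic subcells. -/
noncomputable def cellState (h : ℝ) (x : ℕ → Plane) (q : ℕ → Q) (z : Cell) :
    ℕ × Cell → Multiset Q :=
  fun l => marks x q (addrSet h l.1 z l.2)

/-- Forget the levels of the hierarchy beyond `L`. -/
def trunc (L : ℕ) (s : ℕ × Cell → Multiset Q) : ℕ × Cell → Multiset Q :=
  fun l => if l.1 ≤ L then s l else 0

/-- The levels of the hierarchy up to `L`, computed from the level `L`. -/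
noncomputable def coarsen (L : ℕ) (m : Cell → Multiset Q) : ℕ × Cell → Multiset Q :=
  fun l => if l.1 ≤ L then ∑ c ∈ children (L - l.1) l.2, m c else 0

/-- A subcell is the disjoint union of its descendants of level `L`, so its marks are the sum of
theirs. Joint laws across levels thus reduce to one level, where the regions are disjoint. -/
lemma trunc_cellState (h : ℝ) {x : ℕ → Plane} {q : ℕ → Q} (hfin : ∀ z, {n | cellOf h (x n) = z}.Finite)
    (z : Cell) (L : ℕ) :
    trunc L (cellState h x q z) = coarsen L fun b => marks x q (addrSet h L z b) := by
  classical
  funext ⟨l, b⟩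
  simp only [trunc, coarsen, cellState]
  split_ifs with hl
  · obtain ⟨j, rfl⟩ := Nat.exists_eq_add_of_le hl
    have hf : {n | x n ∈ addrSet h l z b}.Finite := (hfin z).subset fun n hn => hn.1
    have hI : ∀ n, x n ∈ addrSet h l z b ↔ n ∈ hf.toFinset := fun n => by simp
    rw [marks_eq_sum hI, Nat.add_sub_cancel_left]
    have hmaps : ∀ n ∈ hf.toFinset, cellOf (h / 2 ^ (l + j)) (rel h (x n)) ∈ children j b := by
      intro n hn
      rw [mem_children, anc_cellOf]
      exact ((hI n).2 hn).2
    rw [← Finset.sum_fiberwise_of_maps_to hmaps]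
    refine Finset.sum_congr rfl fun c hc => (marks_eq_sum fun n => ?_).symm
    rw [Finset.mem_filter, ← hI]
    rw [mem_children] at hc
    constructor
    · rintro ⟨h1, h2⟩
      refine ⟨⟨h1, ?_⟩, h2⟩
      rw [← anc_cellOf h l j, h2, hc]
    · rintro ⟨h1, h2⟩
      exact ⟨h1.1, h2⟩
  · rfl

lemma measurable_trunc (L : ℕ) : Measurable (trunc (Q := Q) L) := by
  refine measurable_pi_lambda _ fun l => ?_
  by_cases hl : l.1 ≤ L
  · simpa only [trunc, hl, if_true] using measurable_pi_apply l
  · simpa only [trunc, hl, if_false] using measurable_const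

lemma measurable_coarsen [Countable Q] (L : ℕ) : Measurable (coarsen (Q := Q) L) := by
  refine measurable_pi_lambda _ fun l => ?_
  by_cases hl : l.1 ≤ L
  · simp only [coarsen, hl, if_true]
    have : (fun m : Cell → Multiset Q => ∑ c ∈ children (L - l.1) l.2, m c) =
        (fun y : children (L - l.1) l.2 → Multiset Q => ∑ c, y c) ∘
          (children (L - l.1) l.2).restrict := by
      funext m
      exact (Finset.sum_coe_sort (children (L - l.1) l.2) m).symm
    rw [this]
    exact (measurable_of_countable _).comp (measurable_pi_lambda _ fun i => measurable_pi_apply _)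
  · simpa only [coarsen, hl, if_false] using measurable_const

/-- Laws of fields of cell states are determined by their truncations. -/
lemma ext_of_map_trunc {I : Type*} (ν ν' : Measure (I → ℕ × Cell → Multiset Q))
    [IsFiniteMeasure ν]
    (h : ∀ L, ν.map (fun w i => trunc L (w i)) = ν'.map (fun w i => trunc L (w i))) : ν = ν' := by
  let T : ℕ → (I → ℕ × Cell → Multiset Q) → (I → ℕ × Cell → Multiset Q) :=
    fun L w i => trunc L (w i)
  have hT : ∀ L, Measurable (T L) := fun L =>
    measurable_pi_lambda _ fun i => (measurable_trunc L).comp (measurable_pi_apply i)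
  let m : ℕ → MeasurableSpace (I → ℕ × Cell → Multiset Q) := fun L =>
    MeasurableSpace.comap (T L) inferInstance
  -- Truncations factor through finer truncations, so the events they determine form an increasing
  -- sequence of `σ`-algebras; their union is a π-system generating everything.
  have hmono : Monotone m := by
    intro L L' hL
    have : T L = T L ∘ T L' := by
      funext w i l
      simp only [T, trunc, Function.comp]
      split_ifs with h1 h2
      · rfl
      · exact absurd (h1.trans hL) h2
      · rfl
    rintro s ⟨t, ht, rfl⟩
    refine ⟨T L ⁻¹' t, hT L ht, ?_⟩
    rw [← Set.preimage_comp, ← this]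
  have hgen : (MeasurableSpace.pi : MeasurableSpace (I → ℕ × Cell → Multiset Q)) = ⨆ L, m L := by
    refine le_antisymm ?_ (iSup_le fun L => (hT L).comap_le)
    refine iSup_le fun i => ?_
    rw [MeasurableSpace.comap_le_iff_le_map]
    refine iSup_le fun l => ?_
    rw [MeasurableSpace.comap_le_iff_le_map]
    intro s hs
    refine le_iSup m l.1 _ ⟨{w | w i l ∈ s}, ?_, ?_⟩
    · exact ((measurable_pi_apply l).comp (measurable_pi_apply i) :
        Measurable fun w : I → ℕ × Cell → Multiset Q => w i l) hs
    · ext w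
      simp [T, trunc]
  refine ext_of_generate_finite (⋃ L, {s | MeasurableSet[m L] s})
    (hgen.trans (MeasurableSpace.generateFrom_iUnion_measurableSet m).symm)
    (isPiSystem_iUnion_of_monotone _ (fun L => (m L).isPiSystem_measurableSet)
      fun L L' hL s hs => hmono hL s hs) ?_ ?_
  · intro s hs
    obtain ⟨L, t, ht, rfl⟩ := Set.mem_iUnion.1 hs
    have : ν.map (T L) t = ν'.map (T L) t := by rw [h L]
    rwa [Measure.map_apply (hT L) ht, Measure.map_apply (hT L) ht] at this
  · have : ν.map (T 0) Set.univ = ν'.map (T 0) Set.univ := by rw [h 0]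
    rwa [Measure.map_apply (hT 0) MeasurableSet.univ,
      Measure.map_apply (hT 0) MeasurableSet.univ] at this

end State

namespace IsMarkedPoisson

variable {Ω Q : Type*} [MeasurableSpace Ω] [MeasurableSpace Q] {μ : Measure Ω}
    [IsProbabilityMeasure μ] {lam : ℝ} {p : Measure Q} [IsProbabilityMeasure p]
    {X : ℕ → Ω → Plane} {ζ : ℕ → Ω → Q} (M : IsMarkedPoisson μ lam p X ζ)
    {h : ℝ} (hh : 0 < h)

include M hh

omit [IsProbabilityMeasure μ] [IsProbabilityMeasure p] in
lemma finite_cell (ω : Ω) (z : Cell) : {n | cellOf h (X n ω) = z}.Finite :=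
  (M.finite ω _).subset fun _ hn => mem_square_of_cellOf hh hn

variable [DiscreteMeasurableSpace Q] [Countable Q]

omit [IsProbabilityMeasure μ] [IsProbabilityMeasure p] in
lemma measurable_cellState (z : Cell) :
    Measurable fun ω => cellState h (fun n => X n ω) (fun n => ζ n ω) z :=
  measurable_pi_lambda _ fun l => M.measurable_marks (isRegion_addrSet hh l.1 z l.2)

/-- The cell states of a marked Poisson process are independent and identically distributed. -/
theorem map_cellState :
    μ.map (fun ω z => cellState h (fun n => X n ω) (fun n => ζ n ω) z) =
      Measure.infinitePi fun _ : Cell =>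
        μ.map fun ω => cellState h (fun n => X n ω) (fun n => ζ n ω) 0 := by
  have hs := M.measurable_cellState hh
  have hsm : Measurable fun ω z => cellState h (fun n => X n ω) (fun n => ζ n ω) z :=
    measurable_pi_lambda _ hs
  have hprob : ∀ z, IsProbabilityMeasure
      (μ.map fun ω => cellState h (fun n => X n ω) (fun n => ζ n ω) z) := fun z =>
    Measure.isProbabilityMeasure_map (hs z).aemeasurable
  have hprob0 := hprob 0
  have hprobW := Measure.isProbabilityMeasure_map (μ := μ) hsm.aemeasurable
  refine ext_of_map_trunc _ _ fun L => ?_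
  have hm : ∀ v : Cell × Cell,
      Measurable fun ω => marks (fun n => X n ω) (fun n => ζ n ω) (addrSet h L v.1 v.2) :=
    fun v => M.measurable_marks (isRegion_addrSet hh L v.1 v.2)
  let η : Cell → Measure (Multiset Q) := fun b =>
    μ.map fun ω => marks (fun n => X n ω) (fun n => ζ n ω) (addrSet h L 0 b)
  have hη : ∀ b, IsProbabilityMeasure (η b) := fun b =>
    Measure.isProbabilityMeasure_map (hm (0, b)).aemeasurable
  -- At a single level all subcells of all cells are disjoint, and the law of a subcell depends only
  -- on its relative position `b`. The independent family over pairs, once curried, is i.i.d. over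
  -- cells.
  have hlevel : μ.map (fun ω (z b : Cell) =>
      marks (fun n => X n ω) (fun n => ζ n ω) (addrSet h L z b)) =
      Measure.infinitePi fun _ : Cell => Measure.infinitePi η := by
    have hi := M.iIndepFun_marks (fun v : Cell × Cell => addrSet h L v.1 v.2)
      (fun v => isRegion_addrSet hh L v.1 v.2) fun v v' hv => addrSet_disjoint h L hv
    have h1 := (iIndepFun_iff_map_fun_eq_infinitePi_map hm).1 hi
    have h2 : (fun v : Cell × Cell => μ.map fun ω =>
        marks (fun n => X n ω) (fun n => ζ n ω) (addrSet h L v.1 v.2)) = fun v => η v.2 := by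
      funext v
      exact M.map_marks_eq (isRegion_addrSet hh L v.1 v.2) (isRegion_addrSet hh L 0 v.2)
        (volume_addrSet hh L v.1 v.2)
    rw [h2] at h1
    have h3 := Measure.infinitePi_map_curry (fun (_ : Cell) b => η b)
    rw [← h1, Measure.map_map (MeasurableEquiv.measurable _) (measurable_pi_lambda _ hm)] at h3
    exact h3
  have hlm : Measurable fun ω (z b : Cell) =>
      marks (fun n => X n ω) (fun n => ζ n ω) (addrSet h L z b) :=
    measurable_pi_lambda _ fun z => measurable_pi_lambda _ fun b => hm (z, b)
  have htr : ∀ z, (fun ω => trunc L (cellState h (fun n => X n ω) (fun n => ζ n ω) z)) =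
      fun ω => coarsen L fun b => marks (fun n => X n ω) (fun n => ζ n ω) (addrSet h L z b) :=
    fun z => funext fun ω => trunc_cellState h (M.finite_cell hh ω) z L
  have hT : Measurable fun (w : Cell → ℕ × Cell → Multiset Q) z => trunc L (w z) :=
    measurable_pi_lambda _ fun z => (measurable_trunc L).comp (measurable_pi_apply z)
  have hC : Measurable fun (w : Cell → Cell → Multiset Q) z => coarsen L (w z) :=
    measurable_pi_lambda _ fun z => (measurable_coarsen L).comp (measurable_pi_apply z)
  have hleft : (μ.map fun ω z => cellState h (fun n => X n ω) (fun n => ζ n ω) z).map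
      (fun w z => trunc L (w z)) =
      Measure.infinitePi fun _ : Cell => (Measure.infinitePi η).map (coarsen L) := by
    rw [Measure.map_map hT hsm]
    have : (fun (w : Cell → ℕ × Cell → Multiset Q) z => trunc L (w z)) ∘
        (fun ω z => cellState h (fun n => X n ω) (fun n => ζ n ω) z) =
        (fun (w : Cell → Cell → Multiset Q) z => coarsen L (w z)) ∘ fun ω (z b : Cell) =>
          marks (fun n => X n ω) (fun n => ζ n ω) (addrSet h L z b) := by
      funext ω z
      exact congrFun (htr z) ω
    rw [this, ← Measure.map_map hC hlm, hlevel]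
    exact Measure.infinitePi_map_pi (fun _ => Measure.infinitePi η) fun _ => measurable_coarsen L
  rw [hleft, Measure.infinitePi_map_pi _ fun _ => measurable_trunc L]
  congr 1
  funext _
  rw [Measure.map_map (measurable_trunc L) (hs 0)]
  have h0 : trunc L ∘ (fun ω => cellState h (fun n => X n ω) (fun n => ζ n ω) 0) =
      coarsen L ∘ (fun w : Cell → Cell → Multiset Q => w 0) ∘ fun ω (z b : Cell) =>
          marks (fun n => X n ω) (fun n => ζ n ω) (addrSet h L z b) := htr 0
  rw [h0, ← Measure.map_map (measurable_coarsen L) ((measurable_pi_apply 0).comp hlm),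
    ← Measure.map_map (measurable_pi_apply 0) hlm, hlevel, Measure.infinitePi_map_eval]

end IsMarkedPoisson

/-! ### Recovering points and marks from the cell states. -/

section DyadicField

variable {Q : Type*}

/-- The position of the point alone in the dyadic subcell `l`, as the supremum of the corners of
the subcells isolating it. -/
noncomputable def statePos (h : ℝ) (s : ℕ × Cell → Multiset Q) (l : ℕ × Cell) : Plane :=
  WithLp.toLp 2 fun i => (⨆ c : ℕ × Cell,
    ({s : ℕ × Cell → Multiset Q | l.1 ≤ c.1 ∧ anc (c.1 - l.1) c.2 = l.2 ∧
      Multiset.card (s c) = 1}.indicator (fun _ => ENNReal.ofReal (h / 2 ^ c.1 * c.2 i)) s)).toReal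

/-- The dyadic subcell `l` is the first one in the hierarchy to isolate its point. -/
def StateValid (h : ℝ) (s : ℕ × Cell → Multiset Q) (l : ℕ × Cell) : Prop :=
  Multiset.card (s l) = 1 ∧ (∀ i < l.1, Multiset.card (s (i, anc (l.1 - i) l.2)) ≠ 1) ∧
    ∀ i, 0 ≤ statePos h s l i ∧ statePos h s l i < h

/-- The mark of the point alone in the dyadic subcell `l`. -/
noncomputable def stateMark [Nonempty Q] (s : ℕ × Cell → Multiset Q) (l : ℕ × Cell) : Q :=
  Classical.epsilon fun q => s l = {q}

lemma measurableSet_card_eq_one (c : ℕ × Cell) :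
    MeasurableSet {s : ℕ × Cell → Multiset Q | Multiset.card (s c) = 1} :=
  (measurable_pi_apply c : Measurable fun s : ℕ × Cell → Multiset Q => s c)
    (MeasurableSet.of_discrete (s := {m | Multiset.card m = 1}))

lemma measurable_statePos (h : ℝ) (l : ℕ × Cell) :
    Measurable fun s : ℕ × Cell → Multiset Q => statePos h s l := by
  refine (WithLp.measurable_toLp 2 (Fin 2 → ℝ)).comp (measurable_pi_lambda _ fun i => ?_)
  refine ENNReal.measurable_toReal.comp (Measurable.iSup fun c => ?_)
  exact measurable_const.indicator ((MeasurableSet.const _).inter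
    ((MeasurableSet.const _).inter (measurableSet_card_eq_one c)))

/-- The marked points described by dyadic cell states. -/
noncomputable def dyadicField (Q : Type*) [MeasurableSpace Q] [Nonempty Q] (h : ℝ) :
    CellField (ℕ × Cell → Multiset Q) (ℕ × Cell) Q h where
  valid := StateValid h
  pos := statePos h
  mark := stateMark
  measurableSet_valid l := by
    have h1 : MeasurableSet {s : ℕ × Cell → Multiset Q |
        ∀ i < l.1, Multiset.card (s (i, anc (l.1 - i) l.2)) ≠ 1} := by
      simp only [Set.ofPred_forall]
      exact MeasurableSet.iInter fun i => MeasurableSet.iInter fun _ =>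
        (measurableSet_card_eq_one _).compl
    have h2 : MeasurableSet {s : ℕ × Cell → Multiset Q |
        ∀ i, 0 ≤ statePos h s l i ∧ statePos h s l i < h} := by
      simp only [Set.ofPred_forall]
      refine MeasurableSet.iInter fun i => ?_
      have hm : Measurable fun s : ℕ × Cell → Multiset Q => statePos h s l i :=
        (by fun_prop : Measurable fun x : Plane => x i).comp (measurable_statePos h l)
      exact (measurableSet_le measurable_const hm).inter (measurableSet_lt hm measurable_const)
    exact (measurableSet_card_eq_one l).inter (h1.inter h2)
  measurable_pos := measurable_statePos h
  measurable_mark l := (Measurable.of_discrete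
    (f := fun m : Multiset Q => Classical.epsilon fun q => m = {q})).comp (measurable_pi_apply l)
  -- This is required of every state, including those produced by no configuration of points; hence
  -- the bounds are built into `StateValid`.
  pos_mem _ _ hv := hv.2.2

end DyadicField

section Label

variable {Q : Type*} {h : ℝ} {x : ℕ → Plane} {q : ℕ → Q}

/-- The dyadic subcell of level `l`, in its cell, of the `n`-th point. -/
noncomputable def key (h : ℝ) (x : ℕ → Plane) (l : ℕ) (n : ℕ) : Cell :=
  cellOf (h / 2 ^ l) (rel h (x n))

/-- The `n`-th point is alone in its dyadic subcell of level `l`. -/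
def Alone (h : ℝ) (x : ℕ → Plane) (l : ℕ) (n : ℕ) : Prop :=
  ∀ m, cellOf h (x m) = cellOf h (x n) → key h x l m = key h x l n → m = n

lemma anc_key (l j n : ℕ) : anc j (key h x (l + j) n) = key h x l n := anc_cellOf h l j _

lemma Alone.add {l n : ℕ} (ha : Alone h x l n) (j : ℕ) : Alone h x (l + j) n := fun m hm hk =>
  ha m hm (by rw [← anc_key l j m, hk, anc_key])

/-- A cell holds finitely many points, and each of the others differs from the given one in some
coordinate of the relative position, by more than the mesh `h / 2 ^ l` once `l` is large. -/
lemma exists_alone (hh : 0 < h) (hfin : ∀ z, {n | cellOf h (x n) = z}.Finite)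
    (hinj : Function.Injective x) (n : ℕ) : ∃ l, Alone h x l n := by
  have hev : ∀ᶠ l in Filter.atTop, ∀ m ∈ {m | cellOf h (x m) = cellOf h (x n)},
      key h x l m = key h x l n → m = n := by
    refine (Filter.eventually_all_finite (hfin _)).2 fun m hm => ?_
    by_cases hmn : m = n
    · exact Filter.Eventually.of_forall fun _ _ => hmn
    · have hrel : ∃ i, rel h (x m) i ≠ rel h (x n) i := by
        by_contra hcon
        push Not at hcon
        refine hmn (hinj ?_)
        have h1 : rel h (x m) = rel h (x n) := by
          ext i
          exact hcon i
        have hm' : cellOf h (x m) = cellOf h (x n) := hm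
        rw [rel, rel, hm'] at h1
        exact sub_left_injective h1
      obtain ⟨i, hi⟩ := hrel
      have hpos : 0 < |rel h (x m) i - rel h (x n) i| := abs_pos.2 (sub_ne_zero.2 hi)
      have hlim : Filter.Tendsto (fun l : ℕ => h / 2 ^ l) Filter.atTop (nhds 0) :=
        tendsto_const_nhds.div_atTop (tendsto_pow_atTop_atTop_of_one_lt one_lt_two)
      filter_upwards [hlim.eventually_lt_const hpos] with l hl hk
      have hl0 : 0 < h / 2 ^ l := by positivity
      have h1 := inCell_cellOf hl0 (rel h (x m)) i
      have h2 := inCell_cellOf hl0 (rel h (x n)) i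
      have hk' : cellOf (h / 2 ^ l) (rel h (x m)) = cellOf (h / 2 ^ l) (rel h (x n)) := hk
      rw [hk'] at h1
      have : |rel h (x m) i - rel h (x n) i| ≤ h / 2 ^ l := by
        rw [abs_le]
        constructor <;> linarith
      exact absurd this (not_le.2 hl)
  obtain ⟨l, hl⟩ := hev.exists
  exact ⟨l, hl⟩

lemma cellState_eq_singleton {z b : Cell} {l n : ℕ}
    (hn : ∀ m, x m ∈ addrSet h l z b ↔ m = n) : cellState h x q z (l, b) = {q n} := by
  rw [cellState, marks_eq_sum (I := {n}) (fun m => by rw [hn, Finset.mem_singleton]),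
    Finset.sum_singleton]

lemma card_cellState_eq_one_iff (hfin : ∀ z, {n | cellOf h (x n) = z}.Finite) (z b : Cell)
    (l : ℕ) : Multiset.card (cellState h x q z (l, b)) = 1 ↔
      ∃ n, ∀ m, x m ∈ addrSet h l z b ↔ m = n := by
  have hf : {n | x n ∈ addrSet h l z b}.Finite := (hfin z).subset fun n hn => hn.1
  have hI : ∀ n, x n ∈ addrSet h l z b ↔ n ∈ hf.toFinset := fun n => by simp
  constructor
  · intro hc
    rw [cellState, marks_eq_sum hI, card_sum_singleton, Finset.card_eq_one] at hc
    obtain ⟨n, hn⟩ := hc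
    exact ⟨n, fun m => by rw [hI, hn, Finset.mem_singleton]⟩
  · rintro ⟨n, hn⟩
    rw [cellState_eq_singleton hn, Multiset.card_singleton]

lemma Alone.mem_iff {l n : ℕ} (ha : Alone h x l n) (m : ℕ) :
    x m ∈ addrSet h l (cellOf h (x n)) (key h x l n) ↔ m = n := by
  constructor
  · rintro ⟨h1, h2⟩
    exact ha m h1 h2
  · rintro rfl
    exact ⟨rfl, rfl⟩

lemma alone_of_card (hfin : ∀ z, {n | cellOf h (x n) = z}.Finite) {l n : ℕ}
    (hc : Multiset.card (cellState h x q (cellOf h (x n)) (l, key h x l n)) = 1) :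
    Alone h x l n := by
  obtain ⟨k, hk⟩ := (card_cellState_eq_one_iff hfin _ _ _).1 hc
  have hn : n = k := (hk n).1 ⟨rfl, rfl⟩
  intro m h1 h2
  rw [hn]
  exact (hk m).1 ⟨h1, h2⟩

/-- Descendants of the isolating subcell that contain one point contain the point `n`, so their
lower corners lie below it. Those at level `l + j` are within `h / 2 ^ (l + j)` of it in each
coordinate, so the supremum is attained in the limit. -/
lemma statePos_eq (hh : 0 < h) (hfin : ∀ z, {n | cellOf h (x n) = z}.Finite) {l n : ℕ}
    (ha : Alone h x l n) :
    statePos h (cellState h x q (cellOf h (x n))) (l, key h x l n) = rel h (x n) := by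
  ext i
  set y := rel h (x n) i
  have hy := rel_mem hh (x n) i
  have hkey : ∀ j, h / 2 ^ j * (key h x j n i : ℝ) ≤ y ∧
      y ≤ h / 2 ^ j * (key h x j n i : ℝ) + h / 2 ^ j := by
    intro j
    have := inCell_cellOf (show 0 < h / 2 ^ j by positivity) (rel h (x n)) i
    refine ⟨this.1, ?_⟩
    have h2 := this.2.le
    simp only [key]
    linarith
  simp only [statePos]
  set U := ⨆ c : ℕ × Cell, {s : ℕ × Cell → Multiset Q | l ≤ c.1 ∧
      anc (c.1 - l) c.2 = key h x l n ∧ Multiset.card (s c) = 1}.indicator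
      (fun _ => ENNReal.ofReal (h / 2 ^ c.1 * c.2 i)) (cellState h x q (cellOf h (x n))) with hU
  have hle : U ≤ ENNReal.ofReal y := by
    refine iSup_le fun c => ?_
    refine Set.indicator_apply_le' (fun hc => ?_) fun _ => zero_le
    obtain ⟨h1, h2, h3⟩ := hc
    obtain ⟨c1, c2⟩ := c
    obtain ⟨j, rfl⟩ := Nat.exists_eq_add_of_le h1
    obtain ⟨m, hm⟩ := (card_cellState_eq_one_iff hfin _ _ _).1 h3
    obtain ⟨h4, h5⟩ := (hm m).2 rfl
    simp only [Nat.add_sub_cancel_left] at h2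
    have hmn : m = n := ha m h4 (by rw [← anc_key l j m, ← h2]; exact congrArg (anc j) h5)
    subst hmn
    have h6 : c2 = key h x (l + j) m := h5.symm
    rw [h6]
    exact ENNReal.ofReal_le_ofReal (hkey (l + j)).1
  have hge : ∀ j, ENNReal.ofReal y ≤ U + ENNReal.ofReal (h / 2 ^ (l + j)) := by
    intro j
    have hterm : ENNReal.ofReal (h / 2 ^ (l + j) * (key h x (l + j) n i : ℝ)) ≤ U := by
      have := le_iSup (fun c : ℕ × Cell => {s : ℕ × Cell → Multiset Q | l ≤ c.1 ∧
        anc (c.1 - l) c.2 = key h x l n ∧ Multiset.card (s c) = 1}.indicator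
        (fun _ => ENNReal.ofReal (h / 2 ^ c.1 * c.2 i)) (cellState h x q (cellOf h (x n))))
        (l + j, key h x (l + j) n)
      rw [← hU, Set.indicator_of_mem] at this
      · exact this
      · refine ⟨Nat.le_add_right l j, ?_, ?_⟩
        · rw [Nat.add_sub_cancel_left, anc_key]
        · exact (card_cellState_eq_one_iff hfin _ _ _).2 ⟨n, (ha.add j).mem_iff⟩
    calc ENNReal.ofReal y ≤ ENNReal.ofReal (h / 2 ^ (l + j) * (key h x (l + j) n i : ℝ) +
          h / 2 ^ (l + j)) := ENNReal.ofReal_le_ofReal (hkey (l + j)).2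
      _ ≤ _ := ENNReal.ofReal_add_le.trans (by gcongr)
  have hlim : Filter.Tendsto (fun j : ℕ => U + ENNReal.ofReal (h / 2 ^ (l + j))) Filter.atTop
      (nhds (U + ENNReal.ofReal 0)) := by
    refine tendsto_const_nhds.add (ENNReal.tendsto_ofReal ?_)
    have : Filter.Tendsto (fun k : ℕ => h / 2 ^ k) Filter.atTop (nhds 0) :=
      tendsto_const_nhds.div_atTop (tendsto_pow_atTop_atTop_of_one_lt one_lt_two)
    simpa only [add_comm] using (Filter.tendsto_add_atTop_iff_nat l).2 this
  have hge' := ge_of_tendsto' hlim hge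
  rw [ENNReal.ofReal_zero, add_zero] at hge'
  rw [le_antisymm hle hge', ENNReal.toReal_ofReal hy.1]

/-- The vertices of the dyadic field are in bijection with the points, preserving positions and
marks. -/
theorem exists_label [MeasurableSpace Q] [Nonempty Q] (hh : 0 < h)
    (hfin : ∀ z, {n | cellOf h (x n) = z}.Finite) (hinj : Function.Injective x) :
    ∃ e : ℕ → Cell × (ℕ × Cell), Function.Injective e ∧
      (∀ n, (e n).1 = cellOf h (x n)) ∧
      (∀ n, (dyadicField Q h).valid (cellState h x q (e n).1) (e n).2) ∧
      (∀ v : Cell × (ℕ × Cell), (dyadicField Q h).valid (cellState h x q v.1) v.2 →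
        ∃ n, e n = v) ∧
      (∀ n, (dyadicField Q h).vpos (cellState h x q) (e n) = x n) ∧
      ∀ n, (dyadicField Q h).vmark (cellState h x q) (e n) = q n := by
  classical
  have hex := exists_alone hh hfin hinj
  -- A point stays isolated at all finer levels; taking the first isolating level gives it exactly
  -- one label.
  let lev : ℕ → ℕ := fun n => Nat.find (hex n)
  have hlev : ∀ n, Alone h x (lev n) n := fun n => Nat.find_spec (hex n)
  have hmin : ∀ n k, k < lev n → ¬ Alone h x k n := fun n k hk => Nat.find_min (hex n) hk
  refine ⟨fun n => (cellOf h (x n), (lev n, key h x (lev n) n)), ?_, fun _ => rfl, fun n => ?_,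
    ?_, fun n => ?_, fun n => ?_⟩
  · intro n m hnm
    simp only [Prod.mk.injEq] at hnm
    obtain ⟨h1, h2, h3⟩ := hnm
    exact hlev m n h1 (by rw [← h2, h3, ← h2])
  · refine ⟨?_, fun i hi hc => ?_, fun i => ?_⟩
    · exact (card_cellState_eq_one_iff hfin _ _ _).2 ⟨n, (hlev n).mem_iff⟩
    · refine hmin n i hi (alone_of_card (q := q) hfin ?_)
      have hi' : i ≤ lev n := le_of_lt hi
      obtain ⟨j, hj⟩ := Nat.exists_eq_add_of_le hi'
      simp only [hj, Nat.add_sub_cancel_left, anc_key] at hc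
      exact hc
    · have := statePos_eq (q := q) hh hfin (hlev n)
      simp only [this]
      exact rel_mem hh (x n) i
  · rintro ⟨z, l, b⟩ ⟨h1, h2, -⟩
    obtain ⟨n, hn⟩ := (card_cellState_eq_one_iff hfin _ _ _).1 h1
    obtain ⟨rfl, hb⟩ := (hn n).2 rfl
    have hb' : key h x l n = b := hb
    subst hb'
    have hal : Alone h x l n := alone_of_card hfin h1
    have hle : lev n ≤ l := Nat.find_min' (hex n) hal
    -- An isolating subcell of smaller level would be an ancestor of `b`, which validity of the
    -- label forbids.
    rcases hle.lt_or_eq with hlt | heq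
    · refine absurd ?_ (h2 (lev n) hlt)
      obtain ⟨j, hj⟩ := Nat.exists_eq_add_of_le hle
      have : anc (l - lev n) (key h x l n) = key h x (lev n) n := by
        rw [hj, Nat.add_sub_cancel_left, anc_key]
      simp only [this]
      exact (card_cellState_eq_one_iff hfin _ _ _).2 ⟨n, (hlev n).mem_iff⟩
    · exact ⟨n, by simp only [heq]⟩
  · have := statePos_eq (q := q) hh hfin (hlev n)
    simp only [CellField.vpos, dyadicField, this, rel, add_sub_cancel]
  · have := cellState_eq_singleton (q := q) (hlev n).mem_iff
    simp only [CellField.vmark, dyadicField, stateMark, this, Multiset.singleton_inj]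
    exact (Classical.epsilon_spec (p := fun q' => q n = q') ⟨q n, rfl⟩).symm

end Label

/-! ### Positivity of mark configurations and finite mean number of points in a cell. -/

lemma volume_cell {h : ℝ} (hh : 0 < h) (z : Cell) :
    volume {x : Plane | cellOf h x = z} = ENNReal.ofReal h ^ 2 := by
  have hset : {x : Plane | cellOf h x = z} = (WithLp.ofLp : Plane → Fin 2 → ℝ) ⁻¹'
      Set.pi Set.univ fun i => Set.Ico (h * z i) (h * (z i + 1)) := by
    ext x
    simp only [Set.mem_ofPred_eq, Set.mem_preimage, Set.mem_pi, Set.mem_univ, true_imp_iff,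
      Set.mem_Ico]
    constructor
    · rintro rfl
      exact inCell_cellOf hh x
    · intro hx
      exact (InCell.eq_cellOf hh hx).symm
  rw [hset, (PiLp.volume_preserving_ofLp (Fin 2)).measure_preimage
    (MeasurableSet.univ_pi fun i => measurableSet_Ico).nullMeasurableSet, Real.volume_pi_Ico]
  have : ∀ i, h * ((z i : ℝ) + 1) - h * z i = h := fun i => by ring
  simp only [this, Fin.prod_univ_two, sq]

lemma addrSet_zero {h : ℝ} (hh : 0 < h) (z : Cell) :
    addrSet h 0 z 0 = {x : Plane | cellOf h x = z} := by
  ext x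
  refine ⟨fun hx => hx.1, fun hx => ⟨hx, (InCell.eq_cellOf (by positivity) fun i => ?_).symm⟩⟩
  have := rel_mem hh x i
  simpa using this

lemma volume_addrSet_zero {h : ℝ} (hh : 0 < h) (z : Cell) :
    (volume (addrSet h 0 z 0)).toReal = h ^ 2 := by
  rw [addrSet_zero hh, volume_cell hh, ENNReal.toReal_pow, ENNReal.toReal_ofReal hh.le]

lemma poissonWeight_ne_zero {lam v : ℝ} (hlam : 0 < lam) (hv : 0 < v) (k : ℕ) :
    poissonWeight lam v k ≠ 0 := by
  rw [poissonWeight, ENNReal.ofReal_ne_zero_iff]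
  positivity

lemma tsum_mul_poissonWeight_ne_top {lam v : ℝ} (hlam : 0 < lam) (hv : 0 < v) :
    ∑' k : ℕ, (k : ℝ≥0∞) * poissonWeight lam v k ≠ ∞ := by
  have hterm : ∀ k : ℕ, (k : ℝ≥0∞) * poissonWeight lam v k =
      ENNReal.ofReal (k * (Real.exp (-(lam * v)) * (lam * v) ^ k / (Nat.factorial k : ℝ))) :=
    fun k => by rw [poissonWeight, ENNReal.ofReal_mul (by positivity), ENNReal.ofReal_natCast]
  simp only [hterm]
  refine Summable.tsum_ofReal_ne_top ?_
  have hs := (Real.summable_pow_div_factorial (2 * (lam * v))).mul_left (Real.exp (-(lam * v)))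
  refine Summable.of_nonneg_of_le (fun k => by positivity) (fun k => ?_) hs
  -- The factor `k` is absorbed by doubling the parameter in the exponential series.
  have hk : (k : ℝ) ≤ 2 ^ k := by exact_mod_cast Nat.lt_two_pow_self.le
  calc k * (Real.exp (-(lam * v)) * (lam * v) ^ k / (Nat.factorial k : ℝ))
      ≤ 2 ^ k * (Real.exp (-(lam * v)) * (lam * v) ^ k / (Nat.factorial k : ℝ)) := by gcongr
    _ = _ := by rw [mul_pow]; ring

/-- A single listing of the multiset already has positive probability, as a finite product of
positive weights. -/
lemma markWeight_ne_zero {Q : Type*} [MeasurableSpace Q] [DiscreteMeasurableSpace Q] [Countable Q]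
    (p : Measure Q) [IsProbabilityMeasure p] {k : Multiset Q} (hk : ∀ q ∈ k, p {q} ≠ 0) :
    markWeight p k ≠ 0 := by
  obtain ⟨l, rfl⟩ := Quot.exists_rep k
  let y : Fin (Multiset.card (Quot.mk _ l : Multiset Q)) → Q := fun j => l.get j
  have hy : ({y} : Set (Fin (Multiset.card (Quot.mk _ l : Multiset Q)) → Q)) ⊆
      {x | ∑ j, ({x j} : Multiset Q) = Quot.mk _ l} := by
    rintro _ rfl
    simp only [Set.mem_ofPred_eq]
    change ∑ j : Fin l.length, ({l[j.1]} : Multiset Q) = (l : Multiset Q)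
    rw [Fin.sum_univ_fun_getElem l fun q => ({q} : Multiset Q)]
    exact Multiset.sum_map_singleton (l : Multiset Q)
  intro h0
  have := measure_mono_null hy h0
  rw [Measure.infinitePi_singleton_of_fintype, Finset.prod_eq_zero_iff] at this
  obtain ⟨j, -, hj⟩ := this
  exact hk _ (List.get_mem l j) hj

section MarkSet

variable {Q : Type*} [MeasurableSpace Q] [Nonempty Q] {h : ℝ} {x : ℕ → Plane} {q : ℕ → Q}

lemma markSet_cellState (hh : 0 < h) (hfin : ∀ z, {n | cellOf h (x n) = z}.Finite)
    (hinj : Function.Injective x) (z : Cell) :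
    (dyadicField Q h).markSet (cellState h x q z) = {a | a ∈ marks x q (addrSet h 0 z 0)} := by
  obtain ⟨e, -, h1, h2, h3, -, h5⟩ := exists_label (q := q) hh hfin hinj
  have hI : ∀ n, x n ∈ addrSet h 0 z 0 ↔ n ∈ (hfin z).toFinset := fun n => by
    rw [addrSet_zero hh]
    simp
  ext a
  simp only [Set.mem_ofPred_eq, CellField.markSet, marks_eq_sum hI, Multiset.mem_sum,
    Set.Finite.mem_toFinset, Multiset.mem_singleton]
  constructor
  · rintro ⟨l, hl, rfl⟩
    obtain ⟨n, hn⟩ := h3 (z, l) hl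
    have h6 := h5 n
    rw [hn] at h6
    exact ⟨n, by rw [← h1, hn], h6⟩
  · rintro ⟨n, rfl, rfl⟩
    exact ⟨(e n).2, h1 n ▸ h2 n, h1 n ▸ h5 n⟩

/-- Every valid label comes from a point of the cell, so labels are no more numerous than points;
integrated, this bounds their mean number by a Poisson mean. -/
lemma tsum_valid_cellState_le (hh : 0 < h) (hfin : ∀ z, {n | cellOf h (x n) = z}.Finite)
    (hinj : Function.Injective x) (z : Cell) :
    ∑' l, {l | (dyadicField Q h).valid (cellState h x q z) l}.indicator (fun _ => (1 : ℝ≥0∞)) l ≤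
      Multiset.card (marks x q (addrSet h 0 z 0)) := by
  classical
  obtain ⟨e, -, h1, h2, h3, -, h5⟩ := exists_label (q := q) hh hfin hinj
  have hI : ∀ n, x n ∈ addrSet h 0 z 0 ↔ n ∈ (hfin z).toFinset := fun n => by
    rw [addrSet_zero hh]
    simp
  rw [marks_eq_sum hI, card_sum_singleton]
  rw [tsum_eq_sum (s := (hfin z).toFinset.image fun n => (e n).2)]
  · refine (Finset.sum_le_sum (g := fun _ => (1 : ℝ≥0∞)) fun l _ =>
      Set.indicator_le_self' (fun _ _ => zero_le) l).trans ?_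
    rw [Finset.sum_const, nsmul_one]
    exact_mod_cast Finset.card_image_le
  · intro l hl
    refine Set.indicator_of_notMem (fun hv => hl ?_) _
    obtain ⟨n, hn⟩ := h3 (z, l) hv
    refine Finset.mem_image.2 ⟨n, ?_, by rw [hn]⟩
    rw [Set.Finite.mem_toFinset, Set.mem_ofPred_eq, ← h1, hn]

end MarkSet

namespace IsMarkedPoisson

variable {Ω Q : Type*} [MeasurableSpace Ω] [MeasurableSpace Q] {μ : Measure Ω}
    [IsProbabilityMeasure μ] {lam : ℝ} {p : Measure Q} [IsProbabilityMeasure p]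
    {X : ℕ → Ω → Plane} {ζ : ℕ → Ω → Q} (M : IsMarkedPoisson μ lam p X ζ)
    {h : ℝ} (hh : 0 < h) (hlam : 0 < lam) [DiscreteMeasurableSpace Q] [Countable Q] [Nonempty Q]

include M hh hlam

omit [IsProbabilityMeasure μ] in
/-- Each finite set of possible marks is the set of marks of a cell with positive probability. -/
lemma measure_markSet_ne_zero (A : Finset Q) (hA : ∀ q ∈ A, p {q} ≠ 0) :
    μ.map (fun ω => cellState h (fun n => X n ω) (fun n => ζ n ω) 0)
      {s | (dyadicField Q h).markSet s = A} ≠ 0 := by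
  rw [Measure.map_apply (M.measurable_cellState hh 0) ((dyadicField Q h).measurableSet_markSet_eq _)]
  intro h0
  -- One way to realise `A` is to have each of its marks exactly once in the cell.
  have h1 : {ω | marks (fun n => X n ω) (fun n => ζ n ω) (addrSet h 0 0 0) = A.val} ⊆
      (fun ω => cellState h (fun n => X n ω) (fun n => ζ n ω) 0) ⁻¹'
        {s | (dyadicField Q h).markSet s = A} := by
    intro ω hω
    simp only [Set.mem_preimage, Set.mem_ofPred_eq]
    rw [markSet_cellState hh (M.finite_cell hh ω) (M.injective ω), hω]
    rfl
  have h2 := measure_mono_null h1 h0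
  rw [M.measure_marks_eq (isRegion_addrSet hh 0 0 0), volume_addrSet_zero hh] at h2
  exact mul_ne_zero (poissonWeight_ne_zero hlam (by positivity) _) (markWeight_ne_zero p hA) h2

omit [IsProbabilityMeasure μ] [IsProbabilityMeasure p] in
/-- The number of points of a cell has finite expectation. -/
lemma tsum_measure_valid_ne_top :
    ∑' l, μ.map (fun ω => cellState h (fun n => X n ω) (fun n => ζ n ω) 0)
      {s | (dyadicField Q h).valid s l} ≠ ∞ := by
  have hm := M.measurable_cellState hh 0
  have hA := isRegion_addrSet hh 0 0 0
  have hset : ∀ l, MeasurableSet {ω | (dyadicField Q h).valid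
      (cellState h (fun n => X n ω) (fun n => ζ n ω) 0) l} := fun l =>
    hm ((dyadicField Q h).measurableSet_valid l)
  have hcard : Measurable fun ω =>
      Multiset.card (marks (fun n => X n ω) (fun n => ζ n ω) (addrSet h 0 0 0)) :=
    (Measurable.of_discrete (f := fun m : Multiset Q => Multiset.card m)).comp
      (M.measurable_marks hA)
  have h1 : ∑' l, μ.map (fun ω => cellState h (fun n => X n ω) (fun n => ζ n ω) 0)
      {s | (dyadicField Q h).valid s l} = ∫⁻ ω, ∑' l, {ω | (dyadicField Q h).valid
        (cellState h (fun n => X n ω) (fun n => ζ n ω) 0) l}.indicator (fun _ => 1) ω ∂μ := by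
    rw [lintegral_tsum fun l => (measurable_const.indicator (hset l)).aemeasurable]
    refine tsum_congr fun l => ?_
    rw [lintegral_indicator_const (hset l), one_mul,
      Measure.map_apply hm ((dyadicField Q h).measurableSet_valid l)]
    rfl
  have h2 : ∫⁻ ω, ∑' l, {ω | (dyadicField Q h).valid
        (cellState h (fun n => X n ω) (fun n => ζ n ω) 0) l}.indicator (fun _ => 1) ω ∂μ ≤
      ∫⁻ ω, (Multiset.card (marks (fun n => X n ω) (fun n => ζ n ω) (addrSet h 0 0 0)) : ℝ≥0∞) ∂μ :=
    lintegral_mono fun ω =>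
      tsum_valid_cellState_le hh (M.finite_cell hh ω) (M.injective ω) 0
  have h3 : ∫⁻ ω, (Multiset.card (marks (fun n => X n ω) (fun n => ζ n ω) (addrSet h 0 0 0)) :
      ℝ≥0∞) ∂μ = ∑' k : ℕ, (k : ℝ≥0∞) * poissonWeight lam (h ^ 2) k := by
    rw [← lintegral_map (f := fun k : ℕ => (k : ℝ≥0∞)) (Measurable.of_discrete) hcard,
      lintegral_countable']
    refine tsum_congr fun k => ?_
    rw [Measure.map_apply hcard (measurableSet_singleton k), ← volume_addrSet_zero hh 0,
      poissonWeight, ← M.poisson.poisson _ hA.measurableSet hA.volume_ne_top]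
    congr 2
    ext ω
    obtain ⟨I, hI⟩ : ∃ I : Finset ℕ, ∀ n, X n ω ∈ addrSet h 0 0 0 ↔ n ∈ I :=
      ⟨(M.finite_mem hA ω).toFinset, fun n => by simp⟩
    have hI' : {n | X n ω ∈ addrSet h 0 0 0} = (I : Set ℕ) := Set.ext hI
    rw [Set.mem_preimage, Set.mem_singleton_iff, Set.mem_ofPred_eq, marks_eq_sum hI,
      card_sum_singleton, pointCount, hI', Set.encard_coe_eq_coe_finsetCard, Nat.cast_inj]
  rw [h1]
  exact ne_top_of_le_ne_top (tsum_mul_poissonWeight_ne_top hlam (by positivity)) (h3 ▸ h2)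

end IsMarkedPoisson

/-! ### Relabelling a graph up to isolated vertices. -/

section Embedding

variable {V W : Type*} {G : SimpleGraph V} {H : SimpleGraph W} {e : V → W}

/-- The graph `G` is carried by `e` onto the non-isolated part of `H`. -/
structure IsRelabelling (G : SimpleGraph V) (H : SimpleGraph W) (e : V → W) : Prop where
  injective : Function.Injective e
  adj_iff : ∀ u v, H.Adj (e u) (e v) ↔ G.Adj u v
  mem_range : ∀ a b, H.Adj a b → a ∈ Set.range e

namespace IsRelabelling

variable (E : IsRelabelling G H e)
include E

lemma exists_of_reachable {u : V} {b : W} (h : H.Reachable (e u) b) :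
    ∃ v, e v = b ∧ G.Reachable u v := by
  rw [SimpleGraph.reachable_iff_reflTransGen] at h
  induction h with
  | refl => exact ⟨u, rfl, SimpleGraph.Reachable.refl u⟩
  | tail _ hab ih =>
    obtain ⟨v, rfl, hv⟩ := ih
    obtain ⟨w, rfl⟩ := E.mem_range _ _ hab.symm
    exact ⟨w, rfl, hv.trans ((E.adj_iff v w).1 hab).reachable⟩

lemma reachable_iff (u v : V) : H.Reachable (e u) (e v) ↔ G.Reachable u v := by
  constructor
  · intro h
    obtain ⟨w, hw, h'⟩ := E.exists_of_reachable h
    exact E.injective hw ▸ h'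
  · intro h
    exact h.map ⟨e, fun {a b} hab => (E.adj_iff a b).2 hab⟩

lemma cluster_infinite_iff (u : V) : (cluster H (e u)).Infinite ↔ (cluster G u).Infinite := by
  have : cluster H (e u) = e '' cluster G u := by
    ext b
    constructor
    · intro hb
      obtain ⟨v, hv, h⟩ := E.exists_of_reachable hb
      exact ⟨v, h, hv⟩
    · rintro ⟨v, hv, rfl⟩
      exact (E.reachable_iff u v).2 hv
  rw [this, Set.infinite_image_iff E.injective.injOn]

lemma mem_range_of_cluster_infinite {a : W} (ha : (cluster H a).Infinite) : a ∈ Set.range e := by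
  obtain ⟨b, hb, hba⟩ := ha.nontrivial.exists_ne a
  obtain ⟨p⟩ : H.Reachable a b := hb
  cases p with
  | nil => exact absurd rfl hba
  | cons hab _ => exact E.mem_range _ _ hab

lemma manyInf_iff (k : ℕ) : ManyInf H k ↔ ManyInf G k := by
  constructor
  · rintro ⟨c, h1, h2⟩
    choose d hd using fun i => E.mem_range_of_cluster_infinite (h1 i)
    refine ⟨d, fun i => ?_, fun i j hij h => h2 i j hij ?_⟩
    · rw [← E.cluster_infinite_iff, hd]
      exact h1 i
    · rw [← hd, ← hd, E.reachable_iff]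
      exact h
  · rintro ⟨c, h1, h2⟩
    refine ⟨fun i => e (c i), fun i => (E.cluster_infinite_iff _).2 (h1 i), fun i j hij h => ?_⟩
    exact h2 i j hij ((E.reachable_iff _ _).1 h)

lemma keep (B : Set W) : IsRelabelling (keep G (e ⁻¹' B)) (keep H B) e where
  injective := E.injective
  adj_iff u v := and_congr_left fun _ => E.adj_iff u v
  mem_range a b h := E.mem_range a b h.1

end IsRelabelling

end Embedding

/-! ### Infinite components near a square at a fine mesh. -/

section Deterministic

variable {Q : Type*} [MeasurableSpace Q] [Countable Q] [DiscreteMeasurableSpace Q] [Nonempty Q]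
  {r : ℝ} {f : Q → Q → Fin 2} {x : ℕ → Plane} {q : ℕ → Q}

/-- The field of cell states of locally finite points without repetitions yields a relabelling of
their random connection graph. -/
lemma exists_relabelling {h : ℝ} (hh : 0 < h) (hfin : ∀ z, {n | cellOf h (x n) = z}.Finite)
    (hinj : Function.Injective x) (r : ℝ) (f : Q → Q → Fin 2) :
    ∃ e : ℕ → Cell × (ℕ × Cell), IsRelabelling (graph r f x q)
        (((dyadicField Q h).cellGraph hh r f).gr (cellState h x q)) e ∧
      (∀ n, (e n).1 = cellOf h (x n)) ∧
      (∀ n, (dyadicField Q h).valid (cellState h x q (e n).1) (e n).2) ∧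
      (∀ n, (dyadicField Q h).vpos (cellState h x q) (e n) = x n) ∧
      ∀ n, (dyadicField Q h).vmark (cellState h x q) (e n) = q n := by
  obtain ⟨e, h0, h1, h2, h3, h4, h5⟩ := exists_label (q := q) hh hfin hinj
  refine ⟨e, ⟨h0, fun u v => ?_, fun a b hab => h3 a hab.2.1⟩, h1, h2, h4, h5⟩
  have : ((dyadicField Q h).cellGraph hh r f).gr (cellState h x q) =
    VertexRCM.keep (graph r f ((dyadicField Q h).vpos (cellState h x q))
      ((dyadicField Q h).vmark (cellState h x q)))
      {v | (dyadicField Q h).valid (cellState h x q v.1) v.2} := rfl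
  rw [this]
  simp only [VertexRCM.keep, graph, h4, h5, Set.mem_ofPred_eq, h2, and_self, and_true, Ne,
    h0.eq_iff]

omit [MeasurableSpace Q] [Countable Q] [DiscreteMeasurableSpace Q] [Nonempty Q] in
lemma finite_adj_graph (hlf : ∀ b, {n | x n ∈ square b}.Finite) (r : ℝ) (f : Q → Q → Fin 2)
    (t : ℕ) : {u | (graph r f x q).Adj t u}.Finite := by
  refine (hlf (|x t 0| + |x t 1| + r)).subset fun u hu i => ?_
  have h1 := abs_le.1 ((abs_sub_le_dist (x t) (x u) i).trans hu.2.1)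
  have h2 : |x t i| ≤ |x t 0| + |x t 1| := by
    fin_cases i <;> simp
  have h3 := abs_le.1 h2
  rw [abs_le]
  constructor <;> linarith

/-- Infinite components of the random connection graph meet some large square, and survive outside
that square when resolved at a sufficiently small mesh. -/
lemma exists_mem_meet (hr : 0 < r) (hlf : ∀ b, {n | x n ∈ square b}.Finite)
    (hinj : Function.Injective x) {k : ℕ} (hk : ManyInf (graph r f x q) k) :
    ∃ n m : ℕ, 4 * (1 / ((m : ℝ) + 1)) ≤ r ∧ ∃ B : Finset Q, (∀ b ∈ B, b ∈ Set.range q) ∧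
      ∀ A : Set Q, ↑B ⊆ A → cellState (1 / ((m : ℝ) + 1)) x q ∈
        (dyadicField Q (1 / ((m : ℝ) + 1))).Meet Nat.one_div_pos_of_nat r f k
          (n * (m + 1) + 3) A n := by
  classical
  obtain ⟨c, hc1, hc2⟩ := hk
  -- The square contains every `c i`. After its removal the surviving infinite component therefore
  -- cannot be that of `c i` itself, so it has a vertex next to a removed point.
  obtain ⟨n, hn⟩ : ∃ n : ℕ, ∀ i, x (c i) ∈ square n := by
    obtain ⟨n, hn⟩ := exists_nat_ge (∑ i, (|x (c i) 0| + |x (c i) 1|))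
    refine ⟨n, fun i j => le_trans ?_ hn⟩
    refine le_trans ?_ (Finset.single_le_sum (f := fun i => |x (c i) 0| + |x (c i) 1|)
      (fun i _ => by positivity) (Finset.mem_univ i))
    fin_cases j <;> simp
  have hlim : Filter.Tendsto (fun m : ℕ => 4 * (1 / ((m : ℝ) + 1))) Filter.atTop (nhds 0) := by
    simpa using (tendsto_one_div_add_atTop_nhds_zero_nat (𝕜 := ℝ)).const_mul 4
  -- Only finitely many points lie in the slightly larger square, so for a fine mesh none falls in
  -- the margin of width `4 * h` around the square of half-side `n`.
  have hgap : ∀ᶠ m : ℕ in Filter.atTop, ∀ j ∈ {j | x j ∈ square ((n : ℝ) + 1)},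
      x j ∉ square n → x j ∉ square (n + 4 * (1 / ((m : ℝ) + 1))) := by
    refine (Filter.eventually_all_finite (hlf _)).2 fun j _ => ?_
    by_cases hj : x j ∈ square n
    · exact Filter.Eventually.of_forall fun _ h => absurd hj h
    · simp only [square, Set.mem_ofPred_eq, not_forall, not_le] at hj
      obtain ⟨i, hi⟩ := hj
      filter_upwards [hlim.eventually_lt_const (sub_pos.2 hi)] with m hm _ hcon
      have := hcon i
      linarith
  obtain ⟨m, hm1, hm2, hm3⟩ := (hgap.and ((hlim.eventually_le_const hr).and
    (hlim.eventually_le_const one_pos))).exists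
  have hh : (0 : ℝ) < 1 / ((m : ℝ) + 1) := Nat.one_div_pos_of_nat
  set N : ℕ := n * (m + 1) + 3 with hN
  have hNh : 1 / ((m : ℝ) + 1) * (N : ℝ) = n + 3 * (1 / ((m : ℝ) + 1)) := by
    rw [hN]
    push_cast
    field_simp
  -- With `N = n * (m + 1) + 3` the box of cells is the square of half-side `n + 3 * h`, exactly the
  -- margin needed to reach a whole cell from a nearby point.
  set h : ℝ := 1 / ((m : ℝ) + 1)
  have hfin : ∀ z, {n | cellOf h (x n) = z}.Finite := fun z =>
    (hlf _).subset fun _ hn => mem_square_of_cellOf hh hn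
  have hbox : ∀ j, cellOf h (x j) ∈ box (-N) N ↔ x j ∈ square n := by
    intro j
    -- A point of the box is in the square of half-side `n + 4 * h`, which is inside that of
    -- half-side `n + 1`; by the empty margin it is in the original square.
    have hin := inCell_cellOf hh (x j)
    rw [mem_box]
    constructor
    · intro hz
      have hsq : x j ∈ square (n + 4 * h) := by
        intro i
        have h1 : (-(N : ℝ)) ≤ cellOf h (x j) i := by exact_mod_cast (hz i).1
        have h2 : (cellOf h (x j) i : ℝ) + 1 ≤ N := by exact_mod_cast (hz i).2
        have h3 := mul_le_mul_of_nonneg_left h1 hh.le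
        have h4 := mul_le_mul_of_nonneg_left h2 hh.le
        have h5 := hin i
        rw [abs_le]
        constructor <;> linarith
      by_contra hcon
      exact hm1 j (fun i => (hsq i).trans (by linarith)) hcon hsq
    · intro hsq i
      have h1 := abs_le.1 (hsq i)
      have h5 := hin i
      have h2 : h * (-(N : ℝ)) < h * (cellOf h (x j) i + 1) := by linarith
      have h3 : h * (cellOf h (x j) i : ℝ) < h * N := by linarith
      have h2' := lt_of_mul_lt_mul_left h2 hh.le
      have h3' := lt_of_mul_lt_mul_left h3 hh.le
      constructor
      · have : (-(N : ℤ)) < cellOf h (x j) i + 1 := by exact_mod_cast h2'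
        omega
      · exact_mod_cast h3'
  obtain ⟨e, E, he1, he2, he3, he4⟩ := exists_relabelling (q := q) hh hfin hinj r f
  set T : Set ℕ := {j | x j ∈ square n}
  have hT : e ⁻¹' CellGraph.off (ℕ × Cell) (box (-N) N) = Tᶜ := by
    ext j
    simp only [CellGraph.off, Set.mem_preimage, Set.mem_ofPred_eq, he1, hbox, T, Set.mem_compl_iff]
  have E' := E.keep (CellGraph.off (ℕ × Cell) (box (-N) N))
  rw [hT] at E'
  choose u hu1 hu2 hu3 using fun i => exists_infinite_cluster_keep (hlf n)
    (fun t _ => finite_adj_graph hlf r f t) (hc1 i)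
  -- The marks to be accommodated are those of the `k` surviving vertices `u i`; any larger set `A`
  -- serves as well.
  refine ⟨n, m, hm2, Finset.univ.image fun i => q (u i), by simp, fun A hA => ?_⟩
  refine ⟨fun i => e (u i), fun i => (E'.cluster_infinite_iff _).2 (hu2 i), fun i j hij hcon => ?_,
    fun i => ⟨?_, he2 _, ?_, ?_⟩⟩
  · have := ((E'.reachable_iff _ _).1 hcon).mono (keep_le _ _)
    exact hc2 i j hij ((hu1 i).trans (this.trans (hu1 j).symm))
  · have := mem_of_cluster_infinite (hu2 i)
    rw [he1, hbox]
    exact this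
  · rw [he4]
    exact hA (by simp)
  · rw [he3]
    rcases hu3 i with hi | ⟨t, ht, hut⟩
    · exact absurd (hi ▸ hn i) (mem_of_cluster_infinite (hu2 i))
    · exact (Metric.infDist_le_dist_of_mem (show x t ∈ square n from ht)).trans hut.2.1

end Deterministic

/-! ### Finite linked sets of marks. -/

section Linked

variable {Q : Type*} {f : Q → Q → Fin 2}

lemma Linkable.symm {a b : Q} (h : Linkable f a b) : Linkable f b a := Or.symm h

/-- Under finite reachability, each finite set of possible marks is contained in a linked one. -/
lemma exists_linked {S : Set Q} (hedge : ∃ a ∈ S, ∃ b ∈ S, f a b = 1)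
    (hreach : ∀ x ∈ S, ∀ y ∈ S, ∃ (k : ℕ) (w : ℕ → Q), w 0 = x ∧ w k = y ∧
      (∀ i, 0 < i → i < k → w i ∈ S) ∧ ∀ i, i < k → f (w i) (w (i + 1)) = 1)
    (B : Finset Q) (hB : ∀ b ∈ B, b ∈ S) :
    ∃ A : Finset Q, B ⊆ A ∧ (∀ a ∈ A, a ∈ S) ∧ Linked f A := by
  classical
  obtain ⟨o, ho, b, hb, hob⟩ := hedge
  have hpath : ∀ y, ∃ (k : ℕ) (w : ℕ → Q), y ∈ S → w 0 = o ∧ w k = y ∧ (∀ i ≤ k, w i ∈ S) ∧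
      ∀ i, i < k → f (w i) (w (i + 1)) = 1 := by
    intro y
    by_cases hy : y ∈ S
    · obtain ⟨k, w, h0, hk, hS, hf⟩ := hreach o ho y hy
      refine ⟨k, w, fun _ => ⟨h0, hk, fun i hi => ?_, hf⟩⟩
      rcases Nat.eq_zero_or_pos i with rfl | hpos
      · exact h0 ▸ ho
      · rcases hi.lt_or_eq with hlt | rfl
        · exact hS i hpos hlt
        · exact hk ▸ hy
    · exact ⟨0, fun _ => y, fun h => absurd h hy⟩
  choose k w hw using hpath
  have hB' : ∀ y ∈ insert b B, y ∈ S := fun y hy => by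
    rcases Finset.mem_insert.1 hy with rfl | hy
    · exact hb
    · exact hB y hy
  -- All paths start at `o`, so `A` is connected through `o`. Including `b` puts `o` in `A` and
  -- gives it a linkable partner, even when `B` is empty.
  set A : Finset Q := (insert b B).biUnion fun y => (Finset.range (k y + 1)).image (w y) with hA
  have hmem : ∀ y ∈ insert b B, ∀ i ≤ k y, w y i ∈ A := fun y hy i hi =>
    Finset.mem_biUnion.2 ⟨y, hy, Finset.mem_image_of_mem _ (Finset.mem_range.2 (by omega))⟩
  have hsub : insert b B ⊆ A := fun y hy => by
    have := hmem y hy (k y) le_rfl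
    rwa [(hw y (hB' y hy)).2.1] at this
  have hoA : o ∈ A := by
    have := hmem b (Finset.mem_insert_self _ _) 0 (Nat.zero_le _)
    rwa [(hw b hb).1] at this
  have hstep : ∀ y ∈ insert b B, ∀ i ≤ k y,
      Relation.ReflTransGen (fun x y => Linkable f x y ∧ y ∈ (A : Set Q)) o (w y i) ∧
      Relation.ReflTransGen (fun x y => Linkable f x y ∧ y ∈ (A : Set Q)) (w y i) o := by
    intro y hy i
    obtain ⟨h0, -, -, hf⟩ := hw y (hB' y hy)
    induction i with
    | zero =>
      intro _
      rw [h0]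
      exact ⟨.refl, .refl⟩
    | succ j ih =>
      intro hi
      obtain ⟨h1, h2⟩ := ih (by omega)
      have hl : Linkable f (w y j) (w y (j + 1)) := Or.inl (hf j (by omega))
      exact ⟨h1.tail ⟨hl, hmem y hy _ hi⟩, h2.head ⟨hl.symm, hmem y hy j (by omega)⟩⟩
  have hout : ∀ a ∈ A, Relation.ReflTransGen (fun x y => Linkable f x y ∧ y ∈ (A : Set Q)) o a ∧
      Relation.ReflTransGen (fun x y => Linkable f x y ∧ y ∈ (A : Set Q)) a o := by
    intro a ha
    obtain ⟨y, hy, ha⟩ := Finset.mem_biUnion.1 ha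
    obtain ⟨i, hi, rfl⟩ := Finset.mem_image.1 ha
    rw [Finset.mem_range, Nat.lt_succ_iff] at hi
    exact hstep y hy i hi
  refine ⟨A, (Finset.subset_insert _ _).trans hsub, ?_, ?_, ?_⟩
  · intro a ha
    obtain ⟨y, hy, ha⟩ := Finset.mem_biUnion.1 ha
    obtain ⟨i, hi, rfl⟩ := Finset.mem_image.1 ha
    rw [Finset.mem_range, Nat.lt_succ_iff] at hi
    exact (hw y (hB' y hy)).2.2.1 i hi
  · exact fun a ha c hc => (hout a ha).2.trans (hout c hc).1
  · intro a ha
    -- The first step of a path from `a` to `o` yields a partner of `a`; if there is no step, then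
    -- `a = o` and `b` serves.
    rcases (hout a ha).2.cases_head with rfl | ⟨c, ⟨hc1, hc2⟩, -⟩
    · exact ⟨b, hsub (Finset.mem_insert_self _ _), Or.inl hob⟩
    · exact ⟨c, hc2, hc1⟩

end Linked

/-! ### Uniqueness for a marked Poisson process. -/

namespace IsMarkedPoisson

variable {Ω Q : Type*} [MeasurableSpace Ω] [MeasurableSpace Q] {μ : Measure Ω}
    [IsProbabilityMeasure μ] {lam : ℝ} {p : Measure Q} [IsProbabilityMeasure p]
    {X : ℕ → Ω → Plane} {ζ : ℕ → Ω → Q} (M : IsMarkedPoisson μ lam p X ζ)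
    [DiscreteMeasurableSpace Q] [Countable Q]

include M

-- In a countable mark space the values of zero probability form a null set.
omit [IsProbabilityMeasure μ] [DiscreteMeasurableSpace Q] in
lemma ae_mark : ∀ᵐ ω ∂μ, ∀ n, p {ζ n ω} ≠ 0 := by
  rw [ae_all_iff]
  intro n
  have hmap : μ.map (ζ n) = p := by
    rw [← Measure.infinitePi_map_eval (fun _ : ℕ => p) n, ← M.map_mark,
      Measure.map_map (measurable_pi_apply n) (measurable_pi_lambda _ M.measurable_mark)]
    rfl
  have h1 : ∀ᵐ q ∂p, p {q} ≠ 0 := by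
    rw [ae_iff]
    have : {q | ¬ p {q} ≠ 0} = ⋃ q : {q // p {q} = 0}, {q.1} := by
      ext q
      simp
    rw [this, measure_iUnion_null_iff]
    exact fun q => q.2
  rw [← hmap] at h1
  have := ae_of_ae_map (M.measurable_mark n).aemeasurable h1
  rwa [hmap] at this

variable [Nonempty Q] {r : ℝ} (hr : 0 < r) {f : Q → Q → Fin 2}
    (hlink : ∀ B : Finset Q, (∀ b ∈ B, p {b} ≠ 0) →
      ∃ A : Finset Q, B ⊆ A ∧ (∀ a ∈ A, p {a} ≠ 0) ∧ Linked f A)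

include hr hlink

/-- If infinite components almost surely do not meet near any square, then they do not exist. -/
lemma measure_manyInf_eq_zero (k : ℕ)
    (hk : ∀ n m : ℕ, 4 * (1 / ((m : ℝ) + 1)) ≤ r → ∀ A : Finset Q, (∀ a ∈ A, p {a} ≠ 0) →
      Linked f A → (Measure.infinitePi fun _ : Cell => μ.map fun ω =>
        cellState (1 / ((m : ℝ) + 1)) (fun n => X n ω) (fun n => ζ n ω) 0)
          ((dyadicField Q (1 / ((m : ℝ) + 1))).Meet Nat.one_div_pos_of_nat r f k
            (n * (m + 1) + 3) A n) = 0) :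
    ∀ᵐ ω ∂μ, ¬ ManyInf (graph r f (fun n => X n ω) fun n => ζ n ω) k := by
  -- The square, the mesh and the set of marks depend on the configuration, but there are only
  -- countably many triples of them.
  have hall : ∀ᵐ ω ∂μ, ∀ n m : ℕ, ∀ A : Finset Q, 4 * (1 / ((m : ℝ) + 1)) ≤ r →
      (∀ a ∈ A, p {a} ≠ 0) → Linked f A →
      cellState (1 / ((m : ℝ) + 1)) (fun n => X n ω) (fun n => ζ n ω) ∉
        (dyadicField Q (1 / ((m : ℝ) + 1))).Meet Nat.one_div_pos_of_nat r f k
            (n * (m + 1) + 3) A n := by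
    simp only [ae_all_iff]
    intro n m A h1 h2 h3
    have hh : (0 : ℝ) < 1 / ((m : ℝ) + 1) := Nat.one_div_pos_of_nat
    have := hk n m h1 A h2 h3
    rw [← M.map_cellState hh] at this
    exact ae_of_ae_map (measurable_pi_lambda _ (M.measurable_cellState hh)).aemeasurable
      (measure_eq_zero_iff_ae_notMem.1 this)
  filter_upwards [hall, M.ae_mark] with ω hω hmark hcon
  obtain ⟨n, m, h1, B, hB, hA⟩ := exists_mem_meet hr (M.finite ω) (M.injective ω) hcon
  obtain ⟨A, hBA, hA1, hA2⟩ := hlink B fun b hb => by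
    obtain ⟨i, rfl⟩ := hB b hb
    exact hmark i
  exact hω n m A h1 hA1 hA2 (hA A (by exact_mod_cast hBA))

/-- The random connection graph of a marked Poisson process almost surely does not have two
infinite components. -/
theorem ae_not_manyInf_two (hlam : 0 < lam) :
    ∀ᵐ ω ∂μ, ¬ ManyInf (graph r f (fun n => X n ω) fun n => ζ n ω) 2 := by
  have hh : ∀ m : ℕ, (0 : ℝ) < 1 / ((m : ℝ) + 1) := fun m => Nat.one_div_pos_of_nat
  have hprob : ∀ m : ℕ, IsProbabilityMeasure (μ.map fun ω =>
      cellState (1 / ((m : ℝ) + 1)) (fun n => X n ω) (fun n => ζ n ω) 0) := fun m =>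
    Measure.isProbabilityMeasure_map (M.measurable_cellState (hh m) 0).aemeasurable
  have hN : ∀ n m : ℕ, (n : ℝ) + 3 * (1 / ((m : ℝ) + 1)) ≤
      1 / ((m : ℝ) + 1) * ((n * (m + 1) + 3 : ℕ) : ℝ) := fun n m => by
    push_cast
    field_simp
    exact le_rfl
  have hthree := M.measure_manyInf_eq_zero hr hlink 3 fun n m hm A hA1 hA2 =>
    (dyadicField Q _).measure_meet_three (hh m) r f _ hm n.cast_nonneg (hN n m) hA2
      (M.measure_markSet_ne_zero (hh m) hlam A hA1) (M.tsum_measure_valid_ne_top (hh m) hlam)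
  -- The number of infinite components is the same at every mesh, since each cell field encodes the
  -- same graph. This carries almost sure statements from one mesh to another.
  have hfield : ∀ (m k : ℕ), (Measure.infinitePi fun _ : Cell => μ.map fun ω =>
      cellState (1 / ((m : ℝ) + 1)) (fun n => X n ω) (fun n => ζ n ω) 0)
        {w | ManyInf (((dyadicField Q _).cellGraph (hh m) r f).gr w) k} = 0 ↔
      ∀ᵐ ω ∂μ, ¬ ManyInf (graph r f (fun n => X n ω) fun n => ζ n ω) k := by
    intro m k
    have hms := measurable_pi_lambda _ (M.measurable_cellState (hh m))
    rw [← M.map_cellState (hh m), Measure.map_apply hms (measurableSet_manyInf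
      ((dyadicField Q _).cellGraph (hh m) r f).measurableSet_adj k), measure_eq_zero_iff_ae_notMem]
    refine Filter.eventually_congr (Filter.Eventually.of_forall fun ω => not_congr ?_)
    obtain ⟨e, E, -⟩ := exists_relabelling (q := fun n => ζ n ω) (hh m)
      (M.finite_cell (hh m) ω) (M.injective ω) r f
    exact E.manyInf_iff k
  -- Either the two-component events `Meet` are null for all admissible parameters, and there are no
  -- two infinite components, or one of them has positive probability, and the zero-one argument at
  -- its mesh gives the same conclusion.
  by_contra hcon
  refine hcon (M.measure_manyInf_eq_zero hr hlink 2 fun n m hm A hA1 hA2 => ?_)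
  by_contra hmeet
  refine hcon ((hfield m 2).1 ?_)
  refine (dyadicField Q _).measure_manyInf_two (hh m) r f _ hm n.cast_nonneg (hN n m) hA2
    (M.measure_markSet_ne_zero (hh m) hlam A hA1) ?_ (M.tsum_measure_valid_ne_top (hh m) hlam)
    ((hfield m 3).2 hthree) hmeet
  have := M.measure_markSet_ne_zero (hh m) hlam ∅ (by simp)
  rwa [Finset.coe_empty] at this

end IsMarkedPoisson

/-! ### Almost sure local finiteness and absence of repeated points. -/

section Regularity

variable {Ω : Type*} [MeasurableSpace Ω] {μ : Measure Ω} [IsProbabilityMeasure μ] {lam : ℝ}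
  {X : ℕ → Ω → Plane}

lemma pointCount_eq_iff {x : ℕ → Plane} {A : Set Plane} {k : ℕ} :
    pointCount x A = (k : ℕ∞) ↔ ∃ I : Finset ℕ, I.card = k ∧ ∀ n, x n ∈ A ↔ n ∈ I := by
  constructor
  · intro h
    have hf : {n | x n ∈ A}.Finite := Set.finite_of_encard_eq_coe h
    refine ⟨hf.toFinset, ?_, fun n => by simp⟩
    rw [pointCount, hf.encard_eq_coe_toFinset_card] at h
    exact_mod_cast h
  · rintro ⟨I, rfl, hI⟩
    rw [pointCount, show {n | x n ∈ A} = (I : Set ℕ) from Set.ext hI,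
      Set.encard_coe_eq_coe_finsetCard]

namespace IsPoissonProcess

variable (hX : IsPoissonProcess μ lam X)

include hX

omit [IsProbabilityMeasure μ] in
lemma measurableSet_pointCount_eq {A : Set Plane} (hA : MeasurableSet A) (k : ℕ) :
    MeasurableSet {ω | pointCount (fun n => X n ω) A = (k : ℕ∞)} := by
  simp only [pointCount_eq_iff, Set.ofPred_exists, Set.ofPred_and, Set.ofPred_forall]
  refine MeasurableSet.iUnion fun I => (MeasurableSet.const _).inter
    (MeasurableSet.iInter fun n => ?_)
  have hmem : MeasurableSet {ω | X n ω ∈ A} := hX.measurable n hA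
  by_cases hn : n ∈ I
  · simpa only [hn, iff_true] using hmem
  · simp only [hn, iff_false]
    exact hmem.compl

/-- A region almost surely contains finitely many points. -/
lemma ae_finite_mem (hlam : 0 < lam) {A : Set Plane} (hA : MeasurableSet A) (hv : volume A ≠ ∞) :
    ∀ᵐ ω ∂μ, {n | X n ω ∈ A}.Finite := by
  have hms := hX.measurableSet_pointCount_eq hA
  have hsum : μ (⋃ k : ℕ, {ω | pointCount (fun n => X n ω) A = (k : ℕ∞)}) = 1 := by
    rw [measure_iUnion (fun k l hkl => Set.disjoint_left.2 fun ω h1 h2 => hkl ?_) hms]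
    · simp only [hX.poisson A hA hv]
      have ha : 0 ≤ lam * (volume A).toReal := by positivity
      have h1 := NormedSpace.expSeries_div_hasSum_exp (lam * (volume A).toReal)
      rw [← Real.exp_eq_exp_ℝ] at h1
      have h2 := h1.mul_left (Real.exp (-(lam * (volume A).toReal)))
      rw [← Real.exp_add, neg_add_cancel, Real.exp_zero] at h2
      simp only [mul_div_assoc]
      rw [← ENNReal.ofReal_tsum_of_nonneg (fun k => by positivity) h2.summable, h2.tsum_eq,
        ENNReal.ofReal_one]
    · have h3 := h1.symm.trans h2
      exact_mod_cast h3
  filter_upwards [(mem_ae_iff_prob_eq_one (MeasurableSet.iUnion hms)).2 hsum] with ω hω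
  obtain ⟨k, hk⟩ := Set.mem_iUnion.1 hω
  exact Set.finite_of_encard_eq_coe hk

/-- Two indices in `A` force a count of at least two, of probability `1 - (1 + a) * exp (-a)`, which
is at most `1 - (1 + a) * (1 - a) = a ^ 2`. -/
lemma measure_two_le (hlam : 0 < lam) {A : Set Plane} (hA : MeasurableSet A)
    (hv : volume A ≠ ∞) {i j : ℕ} (hij : i ≠ j) :
    μ {ω | X i ω ∈ A ∧ X j ω ∈ A} ≤ ENNReal.ofReal ((lam * (volume A).toReal) ^ 2) := by
  set a := lam * (volume A).toReal with ha
  have ha0 : 0 ≤ a := by positivity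
  have hms := hX.measurableSet_pointCount_eq hA
  have hsub : {ω | X i ω ∈ A ∧ X j ω ∈ A} ⊆
      ({ω | pointCount (fun n => X n ω) A = ((0 : ℕ) : ℕ∞)} ∪
        {ω | pointCount (fun n => X n ω) A = ((1 : ℕ) : ℕ∞)})ᶜ := by
    rintro ω ⟨h1, h2⟩ (h | h)
    · obtain ⟨I, hI, h3⟩ := pointCount_eq_iff.1 h
      rw [Finset.card_eq_zero] at hI
      have := (h3 i).1 h1
      simp [hI] at this
    · obtain ⟨I, hI, h3⟩ := pointCount_eq_iff.1 h
      obtain ⟨c, rfl⟩ := Finset.card_eq_one.1 hI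
      exact hij ((Finset.mem_singleton.1 ((h3 i).1 h1)).trans
        (Finset.mem_singleton.1 ((h3 j).1 h2)).symm)
  refine (measure_mono hsub).trans ?_
  rw [prob_compl_eq_one_sub ((hms 0).union (hms 1)), measure_union
    (Set.disjoint_left.2 fun ω h1 h2 => ?_) (hms 1), hX.poisson A hA hv, hX.poisson A hA hv,
    tsub_le_iff_right, ← ha, ← ENNReal.ofReal_add (by positivity) (by positivity),
    ← ENNReal.ofReal_add (by positivity) (by positivity), ENNReal.one_le_ofReal]
  · have h1 := Real.add_one_le_exp (-a)
    have h2 := mul_le_mul_of_nonneg_left h1 (show 0 ≤ 1 + a by positivity)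
    simp only [pow_zero, pow_one, Nat.factorial_zero, Nat.factorial_one, Nat.cast_one, div_one]
    nlinarith
  · have h3 : ((0 : ℕ) : ℕ∞) = ((1 : ℕ) : ℕ∞) := Eq.trans (Eq.symm h1) h2
    exact absurd h3 (by norm_num)

/-- A repeated point gives two indices in one cell. Of the order of `h⁻²` cells of mesh `h` cover
the square, each contributing at most `(lam * h ^ 2) ^ 2`, and the total tends to zero with `h`. -/
lemma ae_injective (hlam : 0 < lam) : ∀ᵐ ω ∂μ, Function.Injective fun n => X n ω := by
  have key : ∀ i j n : ℕ, i ≠ j → μ {ω | X i ω = X j ω ∧ X i ω ∈ square n} = 0 := by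
    intro i j n hij
    have hbound : ∀ m : ℕ, μ {ω | X i ω = X j ω ∧ X i ω ∈ square n} ≤
        ENNReal.ofReal (4 * ((n : ℝ) + 1) ^ 2 * lam ^ 2 * (1 / ((m : ℝ) + 1)) ^ 2) := by
      intro m
      have hh : (0 : ℝ) < 1 / ((m : ℝ) + 1) := Nat.one_div_pos_of_nat
      set N : ℕ := (n + 1) * (m + 1) with hN
      have hNh : 1 / ((m : ℝ) + 1) * (N : ℝ) = n + 1 := by
        rw [hN]
        push_cast
        field_simp
      have hNh' : (N : ℝ) = (n + 1) * (m + 1) := by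
        rw [hN]
        push_cast
        ring
      set h : ℝ := 1 / ((m : ℝ) + 1) with hhdef
      have hsub : {ω | X i ω = X j ω ∧ X i ω ∈ square n} ⊆ ⋃ z ∈ box (-N) N,
          {ω | X i ω ∈ {x | cellOf h x = z} ∧ X j ω ∈ {x | cellOf h x = z}} := by
        rintro ω ⟨h1, h2⟩
        refine Set.mem_biUnion (x := cellOf h (X i ω)) ?_ ⟨rfl, h1 ▸ rfl⟩
        have hin := inCell_cellOf hh (X i ω)
        refine mem_box.2 fun k => ?_
        have h3 := abs_le.1 (h2 k)
        have h5 := hin k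
        have h6 : h * (-(N : ℝ)) < h * (cellOf h (X i ω) k + 1) := by linarith
        have h7 : h * (cellOf h (X i ω) k : ℝ) < h * N := by linarith
        have h6' := lt_of_mul_lt_mul_left h6 hh.le
        have h7' := lt_of_mul_lt_mul_left h7 hh.le
        constructor
        · have : (-(N : ℤ)) < cellOf h (X i ω) k + 1 := by exact_mod_cast h6'
          omega
        · exact_mod_cast h7'
      refine (measure_mono hsub).trans ((measure_biUnion_finset_le _ _).trans ?_)
      have hcell : ∀ z ∈ box (-N) N, μ {ω | X i ω ∈ {x | cellOf h x = z} ∧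
          X j ω ∈ {x | cellOf h x = z}} ≤ ENNReal.ofReal ((lam * h ^ 2) ^ 2) := by
        intro z _
        have h1 := hX.measure_two_le hlam (A := {x | cellOf h x = z})
          (measurable_cellOf h (measurableSet_singleton z)) (by rw [volume_cell hh]; simp) hij
        rwa [volume_cell hh, ENNReal.toReal_pow, ENNReal.toReal_ofReal hh.le] at h1
      refine (Finset.sum_le_sum hcell).trans ?_
      rw [Finset.sum_const, card_box, nsmul_eq_mul, ← ENNReal.ofReal_natCast,
        ← ENNReal.ofReal_mul (by positivity)]
      refine ENNReal.ofReal_le_ofReal (le_of_eq ?_)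
      have h1 : ((N : ℤ) - -N).toNat = 2 * N := by omega
      rw [h1]
      push_cast
      rw [hNh', hhdef]
      field_simp
      norm_num
    have hlim : Filter.Tendsto (fun m : ℕ => ENNReal.ofReal
        (4 * ((n : ℝ) + 1) ^ 2 * lam ^ 2 * (1 / ((m : ℝ) + 1)) ^ 2)) Filter.atTop (nhds 0) := by
      rw [← ENNReal.ofReal_zero]
      refine ENNReal.tendsto_ofReal ?_
      simpa using ((tendsto_one_div_add_atTop_nhds_zero_nat (𝕜 := ℝ)).pow 2).const_mul
        (4 * ((n : ℝ) + 1) ^ 2 * lam ^ 2)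
    exact le_antisymm (ge_of_tendsto' hlim hbound) zero_le
  have hall : ∀ᵐ ω ∂μ, ∀ i j n : ℕ, i ≠ j → ¬ (X i ω = X j ω ∧ X i ω ∈ square n) := by
    simp only [ae_all_iff]
    intro i j n hij
    exact measure_eq_zero_iff_ae_notMem.1 (key i j n hij)
  filter_upwards [hall] with ω hω i j hij
  by_contra hne
  obtain ⟨n, hn⟩ := exists_nat_ge (|X i ω 0| + |X i ω 1|)
  refine hω i j n hne ⟨hij, fun k => le_trans ?_ hn⟩
  fin_cases k <;> simp

lemma ae_finite (hlam : 0 < lam) : ∀ᵐ ω ∂μ, ∀ b, {n | X n ω ∈ square b}.Finite := by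
  have : ∀ᵐ ω ∂μ, ∀ k : ℕ, {n | X n ω ∈ square k}.Finite := ae_all_iff.2 fun k =>
    hX.ae_finite_mem hlam (isClosed_square k).measurableSet
      (IsRegion.volume_ne_top ⟨(isClosed_square k).measurableSet, k, subset_rfl⟩)
  filter_upwards [this] with ω hω b
  obtain ⟨k, hk⟩ := exists_nat_ge b
  exact (hω k).subset fun n hn i => (hn i).trans hk

end IsPoissonProcess

end Regularity

/-! ### Passing from the model to a regular marked process. -/

namespace IsModel

variable {Ω Ω₀ Q : Type*} [MeasurableSpace Ω] [MeasurableSpace Ω₀]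
    [Countable Q] [MeasurableSpace Q] [DiscreteMeasurableSpace Q]
    {μ : Measure Ω} [IsProbabilityMeasure μ] {P : Measure Ω₀} [IsProbabilityMeasure P]
    {lam : ℝ} {Z : Ω₀ → Q} {X : ℕ → Ω → Plane} {ζ : Option ℕ → Ω → Q}

omit [Countable Q] [DiscreteMeasurableSpace Q] [IsProbabilityMeasure P] in
/-- Up to a null set, the points other than the origin form a marked Poisson process all of whose
realisations are locally finite and without repetitions. -/
lemma exists_isMarkedPoisson (hlam : 0 < lam) (hM : IsModel μ lam P Z X ζ) :
    ∃ Y : ℕ → Ω → Plane, (∀ᵐ ω ∂μ, ∀ n, Y n ω = X n ω) ∧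
      IsMarkedPoisson μ lam (P.map Z) Y fun n => ζ (some n) := by
  classical
  have hgood := (hM.poisson.ae_finite hlam).and (hM.poisson.ae_injective hlam)
  -- A measurable null set containing all irregular realisations, so that the modified process stays
  -- measurable.
  obtain ⟨B, hB1, hB2, hB3⟩ := exists_measurable_superset_of_null (ae_iff.1 hgood)
  -- On the null set the points are replaced by the locally finite sequence `(n, n)`, which has no
  -- repetitions; every realisation is then regular.
  let o : ℕ → Plane := fun n => WithLp.toLp 2 fun _ => (n : ℝ)
  let Y : ℕ → Ω → Plane := fun n ω => if ω ∈ B then o n else X n ω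
  have hY : ∀ᵐ ω ∂μ, ∀ n, Y n ω = X n ω := by
    filter_upwards [measure_eq_zero_iff_ae_notMem.1 hB3] with ω hω n
    exact if_neg hω
  have hYcount : ∀ A, (fun ω => pointCount (fun n => X n ω) A) =ᵐ[μ]
      fun ω => pointCount (fun n => Y n ω) A := fun A => by
    filter_upwards [hY] with ω hω
    simp only [hω]
  have hYfun : (fun ω n => X n ω) =ᵐ[μ] fun ω n => Y n ω := by
    filter_upwards [hY] with ω hω
    exact funext fun n => (hω n).symm
  refine ⟨Y, hY, ⟨fun n => ?_, fun A hA hv k => ?_, fun m A h1 h2 h3 => ?_⟩,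
    fun n => hM.measurable_mark _, ?_, ?_, fun ω b => ?_, fun ω => ?_⟩
  · exact Measurable.ite hB2 measurable_const (hM.poisson.measurable n)
  · rw [← hM.poisson.poisson A hA hv k]
    refine measure_congr ?_
    filter_upwards [hYcount A] with ω hω
    exact propext (by
      change pointCount _ A = _ ↔ pointCount _ A = _
      rw [hω])
  · exact (hM.poisson.indep m A h1 h2 h3).congr fun i => hYcount (A i)
  · have h1 := iIndepFun.precomp (Option.some_injective ℕ) hM.indep_marks
    have h2 := (iIndepFun_iff_map_fun_eq_infinitePi_map fun n => hM.measurable_mark (some n)).1 h1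
    rw [h2]
    congr 1
    funext n
    exact (hM.identDistrib (some n)).map_eq
  · have h1 := hM.indep_points_marks.comp (φ := id) (ψ := fun (z : Option ℕ → Q) n => z (some n))
      measurable_id (measurable_pi_lambda _ fun n => measurable_pi_apply _)
    exact h1.congr hYfun (Filter.EventuallyEq.rfl)
  · by_cases hω : ω ∈ B
    · simp only [Y, hω, if_true]
      refine (Set.finite_Iic ⌊b⌋₊).subset fun n hn => ?_
      have := hn 0
      simp only [o, Nat.abs_cast] at this
      exact Nat.le_floor this
    · simp only [Y, hω, if_false]
      by_contra hcon
      exact hω (hB1 fun h => hcon (h.1 b))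
  · by_cases hω : ω ∈ B
    · simp only [Y, hω, if_true]
      intro n m hnm
      have := congrArg (fun p : Plane => p 0) hnm
      simpa [o] using this
    · simp only [Y, hω, if_false]
      by_contra hcon
      exact hω (hB1 fun h => hcon h.2)

end IsModel

/-! ### Adding the origin, and conclusion. -/

section Origin

variable {Q : Type*} {r : ℝ} {f : Q → Q → Fin 2}

lemma isRelabelling_some (x : ℕ → Plane) (q : Option ℕ → Q) :
    IsRelabelling (graph r f x fun n => q (some n))
      (keep (graph r f (position x) q) {none}ᶜ) some where
  injective := Option.some_injective ℕ
  adj_iff u v := by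
    simp [keep, graph, position]
  mem_range a b h := by
    obtain ⟨n, hn⟩ := Option.ne_none_iff_exists'.1 h.2.1
    exact ⟨n, hn.symm⟩

/-- Adding a vertex of finite degree does not create infinite components. -/
lemma eq_of_not_manyInf_two {x : ℕ → Plane} {q : Option ℕ → Q}
    (hlf : ∀ b, {n | x n ∈ square b}.Finite)
    (h2 : ¬ ManyInf (graph r f x fun n => q (some n)) 2)
    (C D : (graph r f (position x) q).ConnectedComponent) (hC : C.supp.Infinite)
    (hD : D.supp.Infinite) : C = D := by
  by_contra hne
  let G := graph r f (position x) q
  have hdeg : ∀ t ∈ ({none} : Set (Option ℕ)), {u | G.Adj t u}.Finite := by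
    rintro _ rfl
    refine ((hlf r).image some).subset fun u hu => ?_
    obtain ⟨n, rfl⟩ := Option.ne_none_iff_exists'.1 hu.1.symm
    refine ⟨n, fun i => ?_, rfl⟩
    have h1 := (abs_sub_le_dist 0 (x n) i).trans hu.2.1
    simpa using h1
  have hex : ∀ C : G.ConnectedComponent, C.supp.Infinite →
      ∃ u, G.connectedComponentMk u = C ∧ (cluster (keep G {none}ᶜ) u).Infinite := by
    intro C
    induction C using SimpleGraph.ConnectedComponent.ind with | _ v
    intro hv
    have hcl : (G.connectedComponentMk v).supp = cluster G v := by
      ext u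
      rw [SimpleGraph.ConnectedComponent.mem_supp_iff, SimpleGraph.ConnectedComponent.eq]
      exact SimpleGraph.reachable_comm
    rw [hcl] at hv
    obtain ⟨u, h1, h2, -⟩ := exists_infinite_cluster_keep (Set.finite_singleton none) hdeg hv
    exact ⟨u, SimpleGraph.ConnectedComponent.eq.2 h1.symm, h2⟩
  obtain ⟨u, hu1, hu2⟩ := hex C hC
  obtain ⟨v, hv1, hv2⟩ := hex D hD
  have huv : ¬ (keep G {none}ᶜ).Reachable u v := fun h =>
    hne (hu1 ▸ hv1 ▸ SimpleGraph.ConnectedComponent.eq.2 (h.mono (keep_le _ _)))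
  refine h2 (((isRelabelling_some x q).manyInf_iff 2).1 ⟨![u, v], fun i => ?_, fun i j hij => ?_⟩)
  · fin_cases i
    · exact hu2
    · exact hv2
  · fin_cases i <;> fin_cases j
    · exact absurd rfl hij
    · exact huv
    · exact fun h => huv h.symm
    · exact absurd rfl hij

end Origin

/-- Non-triviality provides two possible marks joined by `f`. -/
lemma exists_edge {Ω₀ Q : Type*} [MeasurableSpace Ω₀] [Countable Q] {P : Measure Ω₀}
    [IsProbabilityMeasure P] {Z : Ω₀ → Q} {f : Q → Q → Fin 2} (h : NonTrivial P Z f) :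
    ∃ a ∈ discreteSupport P Z, ∃ b ∈ discreteSupport P Z, f a b = 1 := by
  have hnull : ∀ᵐ ω ∂P, Z ω ∈ discreteSupport P Z := by
    rw [ae_iff]
    have : {ω | Z ω ∉ discreteSupport P Z} =
        ⋃ q : {q // q ∉ discreteSupport P Z}, {ω | Z ω = q.1} := by
      ext ω
      simp
    rw [this, measure_iUnion_null_iff]
    intro q
    have := q.2
    simp only [discreteSupport, Set.mem_ofPred_eq, not_lt] at this
    exact le_antisymm this zero_le
  by_contra hcon
  push Not at hcon
  refine h.1.ne' ?_
  have h1 : ∀ᵐ p ∂(P.prod P), Z p.1 ∈ discreteSupport P Z :=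
    Measure.quasiMeasurePreserving_fst.ae hnull
  have h2 : ∀ᵐ p ∂(P.prod P), Z p.2 ∈ discreteSupport P Z :=
    Measure.quasiMeasurePreserving_snd.ae hnull
  rw [measure_eq_zero_iff_ae_notMem]
  filter_upwards [h1, h2] with p hp1 hp2
  exact hcon _ hp1 _ hp2

end VertexRCM

theorem mainTheorem8
    {Ω Ω₀ Q : Type*} [MeasurableSpace Ω] [MeasurableSpace Ω₀]
    [Countable Q] [MeasurableSpace Q] [DiscreteMeasurableSpace Q]
    (μ : Measure Ω) [IsProbabilityMeasure μ]
    (P : Measure Ω₀) [IsProbabilityMeasure P]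
    (lam r : ℝ) (hlam : 0 < lam) (hr : 0 < r)
    (Z : Ω₀ → Q) (hZ : Measurable Z) (f : Q → Q → Fin 2)
    (hnontriv : VertexRCM.NonTrivial P Z f)
    (hreach : VertexRCM.FiniteReachability P Z f)
    (X : ℕ → Ω → VertexRCM.Plane) (ζ : Option ℕ → Ω → Q)
    (hmodel : VertexRCM.IsModel μ lam P Z X ζ) :
    ∀ᵐ ω ∂μ,
      ∀ C D : (VertexRCM.graph r f (VertexRCM.position (fun n => X n ω))
          (fun u => ζ u ω)).ConnectedComponent,
        C.supp.Infinite → D.supp.Infinite → C = D := by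
  have : IsProbabilityMeasure (P.map Z) := Measure.isProbabilityMeasure_map hZ.aemeasurable
  have hne : Nonempty Q := by
    obtain ⟨a, -⟩ := VertexRCM.exists_edge hnontriv
    exact ⟨a⟩
  have hsupp : ∀ q, P.map Z {q} ≠ 0 ↔ q ∈ VertexRCM.discreteSupport P Z := fun q => by
    rw [Measure.map_apply hZ (measurableSet_singleton q), ← pos_iff_ne_zero]
    rfl
  obtain ⟨Y, hY, M⟩ := hmodel.exists_isMarkedPoisson hlam
  have h2 := M.ae_not_manyInf_two hr (f := f) (fun B hB => by
    simp only [hsupp] at hB ⊢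
    exact VertexRCM.exists_linked (VertexRCM.exists_edge hnontriv) hreach B hB) hlam
  filter_upwards [h2, hY, hmodel.poisson.ae_finite hlam] with ω hω1 hω2 hω3
  simp only [hω2] at hω1
  exact VertexRCM.eq_of_not_manyInf_two hω3 hω1
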